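/- **Definitions.** Let the variables be the natural numbers. A *clause* is a finite set of literals (variables or negated variables) containing no complementary pair; a *clause-set* is a finite set of clauses, read as a CNF (conjunction of disjunctions). Write $\bot$ for the empty clause, $\top$ for the empty clause-set, $\mathrm{lit}(F)$ for the set of literals whose variable occurs in $F$, $c(F)=|F|$ and $\ell(F)=\sum_{C\in F}|C|$. For a partial assignment $\varphi$, $\varphi * F$ is obtained from $F$ by removing the satisfied clauses and then removing the falsified literals from the remaining clauses; for a clause $C$, $\varphi_C$ is the partial assignment setting exactly the literals of $C$ to $0$. The maps $r_k$, $k\in\mathbb N_0$, on clause-sets are defined by $r_0(F)=\{\bot\}$ if $\bot\in F$ and $r_0(F)=F$ otherwise; $r_{k+1}(F)=r_{k+1}(\langle x\to1\rangle * F)$ if there is $x\in\mathrm{lit}(F)$ with $r_k(\langle x\to 0\rangle * F)=\{\bot\}$ (any such $x$ may be chosen), and $r_{k+1}(F)=F$ otherwise. The *hardness* $\mathrm{hd}(F)$ is the least $k\in\mathbb N_0$ such that every clause $C$ with $F\models C$ satisfies $r_k(\varphi_C * F)=\{\bot\}$. For $k\in\mathbb N_0\cup\{\infty\}$, $F$ is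 a *$k$-base* if $\mathrm{hd}(F)\le k$ and every $F'$ obtained from $F$ by removing one clause or one literal occurrence is not equivalent to $F$ or has $\mathrm{hd}(F')>k$. A *shortest* $k$-base for $F$ (w.r.t. $c$ or $\ell$) is a $k$-base equivalent to $F$ which minimises $c$ (resp. $\ell$) among all $k$-bases equivalent to $F$. A *prime implicate* of $F$ is a clause $C$ with $F\models C$ and $F\not\models C'$ for all $C'\subsetneq C$; $\mathrm{prc}_0(F)$ is the set of all of them. A literal $x$ is *forced* for $F$ if $F\models x$. **Theorem.** Clause-sets are given as lists of clauses, with variable names in binary. For every $k\in\mathbb N_0\cup\{\infty\}$ there is a polynomial-time algorithm which, for every input clause-set $F$ all of whose clauses have length at most $2$, computes an equivalent $k$-base $F'$ that is shortest both with respect to the number of clauses $c$ and with respect to the number of literal occurrences $\ell$; one and the same algorithm serves all $k\ge1$. Moreover, for every such $F$ and all $k\in\mathbb N_0\cup\{\infty\}$: 1. If $F$ is unsatisfiable, then $\{\bot\}$ is a shortest $k$-base for $F$ (for both measures). 2. If $F=\top$, then $\top$ is a shortest $k$-base for $F$ (for both measures). 3. If $F$ is satisfiable and $x$ is a forced literal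 for $F$, then every $k$-base equivalent to $F$ contains $\{x\}$, and if $G$ is a shortest $k$-base for $\langle x\to1\rangle * F$, then $G\cup\{\{x\}\}$ is a shortest $k$-base for $F$ (for each of the two measures). If $F$ is satisfiable and has no forced literal, then all clauses of $F$ and of $\mathrm{prc}_0(F)$ have length exactly $2$. 4. Every $k$-base equivalent to $F$ is a subset of $\mathrm{prc}_0(F)$, and the shortest $k$-bases for $F$ with respect to $c$ are the same as those with respect to $\ell$. 5. All prime implicates of $F$ have length at most $2$, and $\mathrm{prc}_0(F)$ is the unique $0$-base equivalent to $F$ (so the algorithm for $k=0$ computes $\mathrm{prc}_0(F)$ in polynomial time). 6. Every $\infty$-base equivalent to $F$ is a $1$-base, and for $k\ge1$ the shortest $k$-bases for $F$ are precisely the smallest (in number of clauses) subsets of $\mathrm{prc}_0(F)$ equivalent to $F$ (so these can be computed in polynomial time). -/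

import Mathlib

namespace KBase

/-! ### Literals, clauses, clause-sets -/

/-- A literal over the variables `ℕ`: `(v, true)` is the variable `v`, `(v, false)` its negation. -/
abbrev Literal : Type := ℕ × Bool

/-- The complement of a literal. -/
def compl (x : Literal) : Literal := (x.1, !x.2)

/-- `C` is a clause: a finite set of literals without clashes. -/
def IsClause (C : Finset Literal) : Prop := ∀ x ∈ C, compl x ∉ C

/-- A finite set of finite sets of literals; see `IsClauseSet` for the condition that its
elements are clauses. -/
abbrev ClauseSet : Type := Finset (Finset Literal)

/-- All elements of `F` are clauses. -/
def IsClauseSet (F : ClauseSet) : Prop := ∀ C ∈ F, IsClause C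

/-- `F` is a clause-set all of whose clauses have length at most 2. -/
def IsTwoCNF (F : ClauseSet) : Prop := IsClauseSet F ∧ ∀ C ∈ F, C.card ≤ 2

/-- The variables of a clause-set. -/
def vars (F : ClauseSet) : Finset ℕ := F.biUnion fun C => C.image Prod.fst

/-- The literals occurring in `F` in at least one polarity. -/
def lits (F : ClauseSet) : Finset Literal := F.biUnion fun C => C ∪ C.image compl

/-- The number of clauses. -/
def numClauses (F : ClauseSet) : ℕ := F.card

/-- The number of literal occurrences. -/
def numLitOcc (F : ClauseSet) : ℕ := ∑ C ∈ F, C.card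

/-! ### Semantics (CNF-interpretation) -/

/-- The total assignment `v` satisfies some literal of `C`. -/
def SatClause (v : ℕ → Bool) (C : Finset Literal) : Prop := ∃ x ∈ C, v x.1 = x.2

/-- The total assignment `v` satisfies all clauses of `F`. -/
def SatCNF (v : ℕ → Bool) (F : ClauseSet) : Prop := ∀ C ∈ F, SatClause v C

/-- `F` is satisfiable. -/
def Satisfiable (F : ClauseSet) : Prop := ∃ v, SatCNF v F

/-- `F ⊨ C`. -/
def Implies (F : ClauseSet) (C : Finset Literal) : Prop := ∀ v, SatCNF v F → SatClause v C

/-- Logical equivalence of clause-sets. -/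
def Equivalent (F G : ClauseSet) : Prop := ∀ v, SatCNF v F ↔ SatCNF v G

/-- The literal `x` is forced for `F`. -/
def Forced (F : ClauseSet) (x : Literal) : Prop := Implies F {x}

/-- `C` is a prime implicate of `F`. -/
def IsPrimeImplicate (F : ClauseSet) (C : Finset Literal) : Prop :=
  IsClause C ∧ Implies F C ∧ ∀ D, D ⊂ C → ¬ Implies F D

/-! ### Partial assignments and generalised unit-clause propagation -/

/-- Application of a partial assignment to `F`. The assignment is given by the finite
(clash-free) set `T` of literals it makes true: clauses containing a literal of `T` are removed,
and from the remaining clauses all literals with complement in `T` are removed. -/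
def assign (T : Finset Literal) (F : ClauseSet) : ClauseSet :=
  (F.filter fun C => Disjoint C T).image fun C => C.filter fun x => compl x ∉ T

/-- `⟨x → 1⟩ * F`. -/
def setTrue (x : Literal) (F : ClauseSet) : ClauseSet := assign {x} F

/-- `⟨x → 0⟩ * F`. -/
def setFalse (x : Literal) (F : ClauseSet) : ClauseSet := assign {compl x} F

/-- `φ_C * F`, where `φ_C` sets precisely the literals of `C` to `0`. -/
def falsify (C : Finset Literal) (F : ClauseSet) : ClauseSet := assign (C.image compl) F

theorem vars_setTrue_card_lt {x : Literal} {F : ClauseSet} (hx : x ∈ lits F) :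
    (vars (setTrue x F)).card < (vars F).card := by
  have key : vars (setTrue x F) ⊆ (vars F).erase x.1 := by
    intro v hv
    simp only [vars, setTrue, assign, Finset.mem_biUnion, Finset.mem_image, Finset.mem_filter,
      Finset.mem_singleton, Finset.disjoint_singleton_right] at hv
    obtain ⟨_, ⟨C, ⟨hC, hxC⟩, rfl⟩, y, hy, rfl⟩ := hv
    rw [Finset.mem_filter] at hy
    refine Finset.mem_erase.2 ⟨fun h => ?_, ?_⟩
    · by_cases h2 : y.2 = x.2
      · exact hxC ((Prod.ext h h2 : y = x) ▸ hy.1)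
      · refine hy.2 (Prod.ext h ?_)
        revert h2
        simp only [compl]
        cases y.2 <;> cases x.2 <;> simp
    · simp only [vars, Finset.mem_biUnion, Finset.mem_image]
      exact ⟨C, hC, y, hy.1, rfl⟩
  have hxv : x.1 ∈ vars F := by
    simp only [lits, Finset.mem_biUnion, Finset.mem_union, Finset.mem_image] at hx
    simp only [vars, Finset.mem_biUnion, Finset.mem_image]
    obtain ⟨C, hC, h | ⟨y, hy, rfl⟩⟩ := hx
    · exact ⟨C, hC, x, h, rfl⟩
    · exact ⟨C, hC, y, hy, rfl⟩
  exact lt_of_le_of_lt (Finset.card_le_card key) (Finset.card_erase_lt_of_mem hxv)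

open scoped Classical in
/-- Iterated application of `⟨x → 1⟩`, as long as there is a literal `x ∈ lits F` such that
`⟨x → 0⟩ * F` has the property `P`; an arbitrary such literal is chosen in each round. -/
noncomputable def propagate (P : ClauseSet → Prop) (F : ClauseSet) : ClauseSet :=
  if h : ∃ x ∈ lits F, P (setFalse x F) then propagate P (setTrue h.choose F) else F
  termination_by (vars F).card
  decreasing_by exact vars_setTrue_card_lt h.choose_spec.1

/-- The reductions `r_k` (generalised unit-clause propagation of level `k`): `r_0` only recognises
the empty clause, and `r_{k+1}(F) = r_{k+1}(⟨x → 1⟩ * F)` if there is a literal `x ∈ lits F` with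
`r_k(⟨x → 0⟩ * F) = {⊥}`, while otherwise `r_{k+1}(F) = F`. -/
noncomputable def rk : ℕ → ClauseSet → ClauseSet
  | 0, F => if ∅ ∈ F then {∅} else F
  | k + 1, F => propagate (fun G => rk k G = {∅}) F

/-- `F ⊨_k C`: the reduction `r_k` refutes `φ_C * F`. -/
def ImpliesK (k : ℕ) (F : ClauseSet) (C : Finset Literal) : Prop := rk k (falsify C F) = {∅}

/-! ### Hardness and `k`-bases -/

/-- The hardness of `F`: the least `k : ℕ` such that `F ⊨ C` implies `F ⊨_k C` for all
clauses `C`. -/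
noncomputable def hardness (F : ClauseSet) : ℕ∞ :=
  sInf {m : ℕ∞ | ∃ k : ℕ, m = k ∧ ∀ C, IsClause C → Implies F C → ImpliesK k F C}

/-- `G` results from `F` by removing one clause or one literal occurrence. -/
def IsRemoval (F G : ClauseSet) : Prop :=
  (∃ C ∈ F, G = F.erase C) ∨ (∃ C ∈ F, ∃ x ∈ C, G = insert (C.erase x) (F.erase C))

/-- `F` is a `k`-base, for `k ∈ ℕ ∪ {∞}`. -/
def IsKBase (k : ℕ∞) (F : ClauseSet) : Prop :=
  IsClauseSet F ∧ hardness F ≤ k ∧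
    ∀ G, IsRemoval F G → ¬ Equivalent G F ∨ k < hardness G

/-- `G` is a `k`-base equivalent to `F`. -/
def IsEquivKBase (k : ℕ∞) (F G : ClauseSet) : Prop := IsKBase k G ∧ Equivalent G F

/-- `G` is, with respect to the size measure `μ`, a shortest `k`-base equivalent to `F`. -/
def IsShortestKBase (μ : ClauseSet → ℕ) (k : ℕ∞) (F G : ClauseSet) : Prop :=
  IsEquivKBase k F G ∧ ∀ H, IsEquivKBase k F H → μ G ≤ μ H

/-- `G` is a set of prime implicates of `F` which is equivalent to `F`. -/
def IsEquivPrimeSubset (F G : ClauseSet) : Prop :=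
  (∀ C ∈ G, IsPrimeImplicate F C) ∧ Equivalent G F

/-- `G` is an equivalent set of prime implicates of `F` with the least number of clauses. -/
def IsSmallestPrimeSubset (F G : ClauseSet) : Prop :=
  IsEquivPrimeSubset F G ∧ ∀ H, IsEquivPrimeSubset F H → numClauses G ≤ numClauses H

/-! ### Polynomial-time computation on clause-sets -/

/-- A list of lists of literals is how an algorithm reads and writes a clause-set. -/
abbrev Formula : Type := List (List Literal)

/-- The clause-set listed by `L`. -/
def toClauseSet (L : Formula) : ClauseSet := (L.map List.toFinset).toFinset

/-- The alphabet for writing formulas. -/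
inductive Sym : Type
  | bit (b : Bool)
  | sign (b : Bool)
  | endClause
  deriving DecidableEq, Fintype

/-- A literal is written as the binary digits of its variable, closed by its sign. -/
def encodeLiteral (x : Literal) : List Sym :=
  (Computability.encodeNat x.1).map Sym.bit ++ [Sym.sign x.2]

/-- A clause is written as the sequence of its literals, closed by an end marker. -/
def encodeClause (C : List Literal) : List Sym := C.flatMap encodeLiteral ++ [Sym.endClause]

/-- A formula is written as the sequence of its clauses. -/
def encodeFormula (L : Formula) : List Sym := L.flatMap encodeClause

/-- One step of reading a formula from left to right; the state holds the clauses, the literals of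
the current clause, and the digits of the current literal read so far. -/
def decodeStep (s : Formula × List Literal × List Bool) :
    Sym → Formula × List Literal × List Bool
  | Sym.bit b => (s.1, s.2.1, s.2.2 ++ [b])
  | Sym.sign b => (s.1, s.2.1 ++ [(Computability.decodeNat s.2.2, b)], [])
  | Sym.endClause => (s.1 ++ [s.2.1], [], [])

theorem decode_bits (l : List Bool) (s : Formula × List Literal × List Bool) :
    (l.map Sym.bit).foldl decodeStep s = (s.1, s.2.1, s.2.2 ++ l) := by
  induction l generalizing s with
  | nil => simp
  | cons b l ih => simp [ih, decodeStep]

theorem decode_literals (C : List Literal) (L : Formula) (D : List Literal) :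
    (C.flatMap encodeLiteral).foldl decodeStep (L, D, []) = (L, D ++ C, []) := by
  induction C generalizing D with
  | nil => simp
  | cons x C ih =>
    simp [List.flatMap_cons, encodeLiteral, List.foldl_append, decode_bits, decodeStep, ih]

theorem decode_clauses (L M : Formula) :
    (L.flatMap encodeClause).foldl decodeStep (M, [], []) = (M ++ L, [], []) := by
  induction L generalizing M with
  | nil => simp
  | cons C L ih =>
    simp [List.flatMap_cons, encodeClause, List.foldl_append, decode_literals, decodeStep, ih]

/-- The encoding of formulas over the finite alphabet `Sym`. -/
def formulaEncoding : Computability.Encoding Formula Sym where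
  encode := encodeFormula
  decode w := some (w.foldl decodeStep ([], [], [])).1
  decode_encode L := by simp [encodeFormula, decode_clauses]

/-- `f` is computed by a Turing machine in time polynomial in the length of the encoded input. -/
def PolyTime (f : Formula → Formula) : Prop :=
  Nonempty (Turing.TM2ComputableInPolyTime formulaEncoding.encode formulaEncoding.encode f)

end KBase

/-!
A prime implicate of a satisfiable 2-CNF `F` is a unit clause `{q}` with `q` reachable from `¬q`
in the implication digraph of `F`, or a clause `{¬p, q}` for a path from `p` to `q` between free
literals. Following the path, one propagates unit clauses, so that every equivalent set of prime
implicates has hardness at most one. Hence, for `k ≥ 1`, the shortest `k`-bases are the smallest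
such sets. These contain all forced literals. On the free literals a smallest set consists of a
directed cycle through one of each two complementary strong components, and of one arc for each
covering pair of components, taken up to contraposition; no equivalent set can do with less, as a
path between two literals of a component has a first arc in it, and a path along a covering pair
has an arc between the two components.

Satisfiability, reachability and the selection of arcs are polynomial-time by Warshall's algorithm.
To turn this into a Turing machine, data are coded by binary trees on the stacks of a structured
program, for which polynomial-time functions are closed under composition, pairing, branching, and
folds over lists with polynomially bounded accumulator.
-/

namespace KBase

/-! ### Structured stack programs -/

/-- Structured programs on stacks indexed by `K` over the alphabet `Γ`; `branch` and `loop` inspect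
the top symbol of a stack (`none` for an empty stack) without removing it. -/
inductive StackProg (K Γ : Type) : Type
  | push (k : K) (a : Γ)
  | pop (k : K)
  | seq (p q : StackProg K Γ)
  | branch (k : K) (f : Option Γ → StackProg K Γ)
  | loop (k : K) (c : Option Γ → Bool) (p : StackProg K Γ)

namespace StackProg

open Turing Function

variable {K Γ : Type}

/-- `Runs p s s' t`: started on the stacks `s`, the program `p` ends with `s'` after `t` steps. -/
inductive Runs [DecidableEq K] : StackProg K Γ → (K → List Γ) → (K → List Γ) → ℕ → Prop
  | push (k a s) : Runs (.push k a) s (update s k (a :: s k)) 1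
  | pop (k s) : Runs (.pop k) s (update s k (s k).tail) 1
  | seq {p q s s₁ s₂ t₁ t₂} : Runs p s s₁ t₁ → Runs q s₁ s₂ t₂ → Runs (.seq p q) s s₂ (t₁ + t₂)
  | branch {k f s s' t} : Runs (f (s k).head?) s s' t → Runs (.branch k f) s s' (t + 1)
  | loop_done {k c p s} : c (s k).head? = false → Runs (.loop k c p) s s 1
  | loop_step {k c p s s₁ s₂ t₁ t₂} : c (s k).head? = true → Runs p s s₁ t₁ →
      Runs (.loop k c p) s₁ s₂ t₂ → Runs (.loop k c p) s s₂ (t₁ + t₂ + 1)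

/-- The labels of the Turing machine executing a program. -/
def Label : StackProg K Γ → Type
  | .push _ _ => Unit
  | .pop _ => Unit
  | .seq p q => p.Label ⊕ q.Label
  | .branch _ f => Option (Σ a, (f a).Label)
  | .loop _ _ p => Option p.Label

@[reducible]
def fintypeLabel [Fintype Γ] : (p : StackProg K Γ) → Fintype p.Label
  | .push _ _ => inferInstanceAs (Fintype Unit)
  | .pop _ => inferInstanceAs (Fintype Unit)
  | .seq p q =>
    let _ := p.fintypeLabel
    let _ := q.fintypeLabel
    inferInstanceAs (Fintype (p.Label ⊕ q.Label))
  | .branch _ f =>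
    let _ := fun a => (f a).fintypeLabel
    inferInstanceAs (Fintype (Option (Σ a, (f a).Label)))
  | .loop _ _ p =>
    let _ := p.fintypeLabel
    inferInstanceAs (Fintype (Option p.Label))

/-- The label at which the execution of a program starts. -/
def entry : (p : StackProg K Γ) → p.Label
  | .push _ _ => ()
  | .pop _ => ()
  | .seq p _ => Sum.inl p.entry
  | .branch _ _ => none
  | .loop _ _ _ => none

/-- The statements executing a program inside a machine with labels `Λ`, given an embedding `emb` of
the labels of the program and the label `exit` to continue with. The state of the machine is the
symbol read last. -/
def code : (p : StackProg K Γ) → {Λ : Type} → (p.Label → Λ) → Λ → p.Label →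
    TM2.Stmt (fun _ : K => Γ) Λ (Option Γ)
  | .push k a, _, _, exit, _ => .push k (fun _ => a) (.goto fun _ => exit)
  | .pop k, _, _, exit, _ => .pop k (fun v _ => v) (.goto fun _ => exit)
  | .seq p q, _, emb, _, Sum.inl l =>
    p.code (fun l => emb (Sum.inl l)) (emb (Sum.inr q.entry)) l
  | .seq _ q, _, emb, exit, Sum.inr l => q.code (fun l => emb (Sum.inr l)) exit l
  | .branch k f, _, emb, _, none =>
    .peek k (fun _ a => a) (.goto fun a => emb (some ⟨a, (f a).entry⟩))
  | .branch _ f, _, emb, exit, some ⟨a, l⟩ => (f a).code (fun l => emb (some ⟨a, l⟩)) exit l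
  | .loop k c p, _, emb, exit, none =>
    .peek k (fun _ a => a) (.goto fun a => if c a then emb (some p.entry) else exit)
  | .loop _ _ p, _, emb, _, some l => p.code (fun l => emb (some l)) (emb none) l

variable [DecidableEq K]

theorem Runs.iterate_step {p : StackProg K Γ} {s s' : K → List Γ} {t : ℕ} (h : Runs p s s' t)
    {Λ : Type} (M : Λ → TM2.Stmt (fun _ : K => Γ) Λ (Option Γ)) (emb : p.Label → Λ) (exit : Λ)
    (hM : ∀ l, M (emb l) = p.code emb exit l) (v : Option Γ) :
    ∃ v', (flip bind (TM2.step M))^[t] (some ⟨some (emb p.entry), v, s⟩) =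
      some ⟨some exit, v', s'⟩ := by
  induction h generalizing v exit with
  | push k a s => exact ⟨v, by simp [flip, hM, code, TM2.step, TM2.stepAux]⟩
  | pop k s => exact ⟨v, by simp [flip, hM, code, TM2.step, TM2.stepAux]⟩
  | @seq p q s s₁ s₂ t₁ t₂ _ _ ih₁ ih₂ =>
    obtain ⟨v₁, h₁⟩ := ih₁ (fun l => emb (Sum.inl l)) (emb (Sum.inr q.entry))
      (fun l => hM (Sum.inl l)) v
    obtain ⟨v₂, h₂⟩ := ih₂ (fun l => emb (Sum.inr l)) exit (fun l => hM (Sum.inr l)) v₁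
    refine ⟨v₂, ?_⟩
    rw [Nat.add_comm, iterate_add_apply]
    exact (congrArg _ h₁).trans h₂
  | @branch k f s s' t _ ih =>
    obtain ⟨v₁, h₁⟩ := ih (fun l => emb (some ⟨_, l⟩)) exit (fun l => hM (some ⟨_, l⟩)) (s k).head?
    have first : TM2.step M ⟨some (emb none), v, s⟩ =
        some ⟨some (emb (some ⟨(s k).head?, (f (s k).head?).entry⟩)), (s k).head?, s⟩ := by
      rw [TM2.step, show M (emb none) = _ from hM none]
      simp [code, TM2.stepAux]
    exact ⟨v₁, by rw [iterate_succ_apply, ← h₁]; exact congrArg _ first⟩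
  | @loop_done k c p s hc =>
    refine ⟨(s k).head?, ?_⟩
    change TM2.step M ⟨some (emb none), v, s⟩ = _
    rw [TM2.step, show M (emb none) = _ from hM none]
    simp [code, TM2.stepAux, hc]
  | @loop_step k c p s s₁ s₂ t₁ t₂ hc _ _ ih₁ ih₂ =>
    obtain ⟨v₁, h₁⟩ := ih₁ (fun l => emb (some l)) (emb none) (fun l => hM (some l)) (s k).head?
    obtain ⟨v₂, h₂⟩ := ih₂ emb exit hM v₁
    have first : TM2.step M ⟨some (emb none), v, s⟩ =
        some ⟨some (emb (some p.entry)), (s k).head?, s⟩ := by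
      rw [TM2.step, show M (emb none) = _ from hM none]
      simp [code, TM2.stepAux, hc]
    refine ⟨v₂, ?_⟩
    rw [iterate_succ_apply, Nat.add_comm, iterate_add_apply, ← h₂]
    exact congrArg _ ((congrArg _ first).trans h₁)

/-- The Turing machine which executes a program, with input and output on the stack `port`, and then
halts. -/
def machine [Fintype K] [Fintype Γ] (p : StackProg K Γ) (port : K) : FinTM2 :=
  letI := p.fintypeLabel
  { K := K
    k₀ := port
    k₁ := port
    Γ := fun _ => Γ
    Λ := Option p.Label
    main := some p.entry
    σ := Option Γ
    initialState := none
    Γk₀Fin := inferInstance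
    m := fun l => match l with
      | none => .load (fun _ => none) .halt
      | some l => p.code some none l }

theorem nonempty_computableInPolyTime [Finite K] [Finite Γ] {α β : Type} {ea : α → List Γ}
    {eb : β → List Γ} {f : α → β} (p : StackProg K Γ) (port : K) (q : Polynomial ℕ)
    (h : ∀ x, ∃ t ≤ q.eval (ea x).length,
      Runs p (update (fun _ => []) port (ea x)) (update (fun _ => []) port (eb (f x))) t) :
    Nonempty (TM2ComputableInPolyTime ea eb f) := by
  cases nonempty_fintype K
  cases nonempty_fintype Γ
  choose t ht runs using h
  have stack_eq (w : List Γ) (k : K) : @dite (List Γ) (k = port) (inferInstance)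
      (fun _ => w.map (Equiv.refl Γ).invFun) (fun _ => []) =
      update (fun _ => []) port w k := by
    by_cases hk : k = port <;> simp [hk]
  have init x : initList (p.machine port) ((ea x).map (Equiv.refl Γ).invFun) =
      (⟨some (some p.entry), none, update (fun _ => []) port (ea x)⟩ :
        TM2.Cfg (fun _ : K => Γ) (Option p.Label) (Option Γ)) :=
    congrArg (TM2.Cfg.mk _ _) (funext fun k => stack_eq (ea x) k)
  have halt x : haltList (p.machine port) ((eb (f x)).map (Equiv.refl Γ).invFun) =
      (⟨none, none, update (fun _ => []) port (eb (f x))⟩ :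
        TM2.Cfg (fun _ : K => Γ) (Option p.Label) (Option Γ)) :=
    congrArg (TM2.Cfg.mk _ _) (funext fun k => stack_eq (eb (f x)) k)
  refine ⟨{ tm := p.machine port, inputAlphabet := Equiv.refl _, outputAlphabet := Equiv.refl _,
            time := q + 1, outputsFun := fun x => ⟨⟨t x + 1, ?_⟩, ?_⟩ }⟩
  · obtain ⟨v, hv⟩ := (runs x).iterate_step (p.machine port).m some none (fun _ => rfl) none
    rw [Nat.add_comm, iterate_add_apply]
    refine (congrArg _ ((congrArg _ (congrArg some (init x))).trans hv)).trans ?_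
    exact congrArg some (halt x).symm
  · simpa using ht x

/-- The total height of the stacks. -/
def height [Fintype K] (s : K → List Γ) : ℕ := ∑ k, (s k).length

theorem height_update [Fintype K] (s : K → List Γ) (k : K) (w : List Γ) :
    height (update s k w) + (s k).length = height s + w.length := by
  have off : ∑ j ∈ {k}ᶜ, (update s k w j).length = ∑ j ∈ {k}ᶜ, (s j).length :=
    Finset.sum_congr rfl fun j hj => by
      rw [update_of_ne (Finset.notMem_singleton.1 (Finset.mem_compl.1 hj))]
  simp only [height, Fintype.sum_eq_add_sum_compl k, update_self, off]
  omega

theorem Runs.height_le [Fintype K] {p : StackProg K Γ} {s s' : K → List Γ} {t : ℕ}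
    (h : Runs p s s' t) : height s' ≤ height s + t := by
  induction h with
  | push k a s => have := height_update s k (a :: s k); simp only [List.length_cons] at this; omega
  | pop k s => have := height_update s k (s k).tail; simp only [List.length_tail] at this; omega
  | _ => omega

theorem Runs.of_eq {p : StackProg K Γ} {s s₁ s' : K → List Γ} {t t' : ℕ} (h : Runs p s s₁ t)
    (hs : s₁ = s') (ht : t = t') : Runs p s s' t' := hs ▸ ht ▸ h

theorem Runs.push_of_eq {k : K} {a : Γ} {s s' : K → List Γ} (h : update s k (a :: s k) = s') :
    Runs (.push k a) s s' 1 := (Runs.push k a s).of_eq h rfl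

theorem Runs.pop_of_eq {k : K} {s s' : K → List Γ} (h : update s k (s k).tail = s') :
    Runs (.pop k) s s' 1 := (Runs.pop k s).of_eq h rfl

/-- Move the contents of stack `k` to stack `j`, in reverse order. -/
def move (k j : K) : StackProg K Γ :=
  .loop k Option.isSome (.branch k fun
    | some a => .seq (.push j a) (.pop k)
    | none => .pop k)

theorem runs_move {k j : K} (hkj : k ≠ j) (w : List Γ) (s : K → List Γ) (hw : s k = w) :
    Runs (.move k j) s (update (update s j (w.reverse ++ s j)) k []) (4 * w.length + 1) := by
  induction w generalizing s with
  | nil =>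
    refine (Runs.loop_done (by simp [hw])).of_eq ?_ rfl
    rw [List.reverse_nil, List.nil_append, update_eq_self, ← hw, update_eq_self]
  | cons a w ih =>
    have body : Runs (.branch k fun
        | some a => .seq (.push j a) (.pop k)
        | none => .pop k) s (update (update s j (a :: s j)) k w) (1 + 1 + 1) := by
      refine .branch ?_
      rw [hw]
      refine .seq (.push _ _ _) (.pop_of_eq ?_)
      rw [update_of_ne hkj, hw, List.tail_cons]
    refine (Runs.loop_step (c := Option.isSome) (by simp [hw]) body
      (ih (update (update s j (a :: s j)) k w) (by simp))).of_eq ?_ ?_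
    · rw [update_of_ne hkj.symm, update_self, update_comm hkj.symm, update_idem,
        update_comm hkj.symm, update_idem, update_comm hkj, List.reverse_cons, List.append_assoc,
        List.singleton_append]
    · simp only [List.length_cons]
      omega

end StackProg

/-! ### Programs on stacks of binary trees -/

section TreeStacks

open Function StackProg

/-- The stacks of a program working on trees: `port` holds the input and the output, `main` the
trees; the other stacks are working space and empty between the operations. -/
inductive StackId : Type
  | port | main | buffer | spareA | spareB | counter
  deriving DecidableEq

instance : Fintype StackId where
  elems := {.port, .main, .buffer, .spareA, .spareB, .counter}
  complete k := by cases k <;> simp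

/-- Structured programs working on trees. -/
abbrev TreeProg : Type := StackProg StackId Sym

/-- The contents of the stacks. -/
structure Store : Type where
  port : List Sym := []
  main : List Sym := []
  buffer : List Sym := []
  spareA : List Sym := []
  spareB : List Sym := []
  counter : List Sym := []

namespace Store

/-- The contents of the stack of a given name. -/
def get (s : Store) : StackId → List Sym
  | .port => s.port
  | .main => s.main
  | .buffer => s.buffer
  | .spareA => s.spareA
  | .spareB => s.spareB
  | .counter => s.counter

variable (s : Store) (w : List Sym)

@[simp] theorem get_port : s.get .port = s.port := rfl
@[simp] theorem get_main : s.get .main = s.main := rfl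
@[simp] theorem get_buffer : s.get .buffer = s.buffer := rfl
@[simp] theorem get_spareA : s.get .spareA = s.spareA := rfl
@[simp] theorem get_spareB : s.get .spareB = s.spareB := rfl
@[simp] theorem get_counter : s.get .counter = s.counter := rfl

@[simp] theorem update_get_port : update s.get .port w = { s with port := w }.get := by
  funext k; cases k <;> simp [update]
@[simp] theorem update_get_main : update s.get .main w = { s with main := w }.get := by
  funext k; cases k <;> simp [update]
@[simp] theorem update_get_buffer : update s.get .buffer w = { s with buffer := w }.get := by
  funext k; cases k <;> simp [update]
@[simp] theorem update_get_spareA : update s.get .spareA w = { s with spareA := w }.get := by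
  funext k; cases k <;> simp [update]
@[simp] theorem update_get_spareB : update s.get .spareB w = { s with spareB := w }.get := by
  funext k; cases k <;> simp [update]
@[simp] theorem update_get_counter : update s.get .counter w = { s with counter := w }.get := by
  funext k; cases k <;> simp [update]

end Store

/-- The Polish notation of an unlabelled binary tree: a node is written before its two subtrees. -/
def treeWord : BinaryTree Unit → List Sym
  | .nil => [Sym.bit false]
  | .node _ a b => Sym.bit true :: (treeWord a ++ treeWord b)

namespace TreeProg

/-- The program doing nothing. -/
def skip : TreeProg := .loop .main (fun _ => false) (.pop .main)

/-- Move as many trees from `main` to `buffer` as there are symbols in `counter`, in reverse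
order. -/
def takeTrees : TreeProg :=
  .loop .counter Option.isSome (.branch .main fun
    | some (Sym.bit true) =>
      .seq (.push .buffer (Sym.bit true)) (.seq (.pop .main) (.push .counter Sym.endClause))
    | _ => .seq (.push .buffer (Sym.bit false)) (.seq (.pop .main) (.pop .counter)))

/-- Move the top tree of `main` to `buffer`, in reverse order. -/
def takeTree : TreeProg := .seq (.push .counter Sym.endClause) takeTrees

/-- Move the top tree of `main` to the stack `k`. -/
def stash (k : StackId) : TreeProg := .seq takeTree (move .buffer k)

/-- Move the contents of the stack `k` to `main`. -/
def fetch (k : StackId) : TreeProg := .seq (move k .buffer) (move .buffer .main)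

/-- Empty the stack `buffer`. -/
def clear : TreeProg := .loop .buffer Option.isSome (.pop .buffer)

/-- Move the contents of `buffer` both to `main` and to `spareA`, in reverse order. -/
def fork : TreeProg :=
  .loop .buffer Option.isSome (.branch .buffer fun
    | some a => .seq (.push .main a) (.seq (.push .spareA a) (.pop .buffer))
    | none => .pop .buffer)

/-- Remove the top tree. -/
def drop : TreeProg := .seq takeTree clear

/-- Duplicate the top tree. -/
def dup : TreeProg := .seq takeTree (.seq fork (fetch .spareA))

/-- Exchange the two top trees. -/
def swap : TreeProg :=
  .seq (stash .spareA) (.seq (stash .spareB) (.seq (fetch .spareA) (fetch .spareB)))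

/-- Join the second and third tree to a node, and leave it on top of the first tree. -/
def joinBelow : TreeProg :=
  .seq (stash .spareA) (.seq (.push .main (Sym.bit true)) (.seq (stash .spareB)
    (.seq (fetch .spareA) (fetch .spareB))))

/-- Push a word to `main`. -/
def pushWord : List Sym → TreeProg
  | [] => skip
  | a :: w => .seq (pushWord w) (.push .main a)

theorem runs_takeTrees (d : BinaryTree Unit) (s : Store) (a : Sym) {s' : StackId → List Sym} {t : ℕ}
    (h : Runs takeTrees { s with buffer := (treeWord d).reverse ++ s.buffer }.get s' t) :
    Runs takeTrees { s with main := treeWord d ++ s.main, counter := a :: s.counter }.get s'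
      (t + 5 * (treeWord d).length) := by
  induction d generalizing s a t with
  | nil =>
    refine .of_eq (.loop_step (by simp) (.branch (.seq (.push StackId.buffer _ _)
      (.seq (.pop StackId.main _) (.pop_of_eq (k := StackId.counter) ?_)))) h) rfl ?_
    · simp [treeWord]
    · simp only [treeWord, List.length_cons, List.length_nil]; omega
  | node _ d e ihd ihe =>
    have rest := ihe { s with buffer := (treeWord d).reverse ++ (Sym.bit true :: s.buffer) }
      a (by simpa [treeWord] using h)
    have all := ihd { s with main := treeWord e ++ s.main, buffer := Sym.bit true :: s.buffer,
                             counter := a :: s.counter } Sym.endClause rest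
    refine .of_eq (.loop_step (by simp) (.branch (.seq (.push StackId.buffer _ _)
      (.seq (.pop StackId.main _) (.push_of_eq (k := StackId.counter) ?_)))) all) rfl ?_
    · simp [treeWord]
    · simp only [treeWord, List.length_cons, List.length_append]; omega

theorem runs_takeTree (d : BinaryTree Unit) (s : Store) :
    Runs takeTree { s with main := treeWord d ++ s.main, buffer := [], counter := [] }.get
      { s with buffer := (treeWord d).reverse, counter := [] }.get
      (5 * (treeWord d).length + 2) := by
  have take := runs_takeTrees d { s with buffer := [], counter := [] } Sym.endClause
    (.loop_done (by simp))
  refine ((Runs.push_of_eq ?_).seq take).of_eq ?_ (by omega) <;> simp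

theorem runs_stash {k : StackId} (hm : k ≠ .main) (hb : k ≠ .buffer) (hc : k ≠ .counter)
    (d : BinaryTree Unit) (s : Store) :
    Runs (stash k) { s with main := treeWord d ++ s.main, buffer := [], counter := [] }.get
      (update { s with buffer := [], counter := [] }.get k (treeWord d ++ s.get k))
      (9 * (treeWord d).length + 3) := by
  refine ((runs_takeTree d s).seq (runs_move hb.symm (treeWord d).reverse _ rfl)).of_eq ?_ ?_
  · cases k <;> simp at hm hb hc ⊢
  · rw [List.length_reverse]; omega

theorem runs_stash_spareA (d : BinaryTree Unit) (r b : List Sym) :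
    Runs (stash .spareA) (Store.get { main := treeWord d ++ r, spareB := b })
      (Store.get { main := r, spareA := treeWord d, spareB := b }) (9 * (treeWord d).length + 3) :=
  (runs_stash (by decide) (by decide) (by decide) d { main := r, spareB := b }).of_eq (by simp) rfl

theorem runs_stash_spareB (d : BinaryTree Unit) (r a : List Sym) :
    Runs (stash .spareB) (Store.get { main := treeWord d ++ r, spareA := a })
      (Store.get { main := r, spareA := a, spareB := treeWord d }) (9 * (treeWord d).length + 3) :=
  (runs_stash (by decide) (by decide) (by decide) d { main := r, spareA := a }).of_eq (by simp) rfl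

theorem runs_fetch {k : StackId} (hm : k ≠ .main) (hb : k ≠ .buffer) (s : Store) :
    Runs (fetch k) { s with buffer := [] }.get
      (update { s with main := s.get k ++ s.main, buffer := [] }.get k [])
      (8 * (s.get k).length + 2) := by
  have hk : { s with buffer := [] }.get k = s.get k := by cases k <;> simp at hb ⊢
  refine ((runs_move hb _ _ hk).seq
    (runs_move (k := .buffer) (j := .main) (by decide) (s.get k).reverse _ ?_)).of_eq ?_ ?_
  · cases k <;> simp at hb ⊢
  · cases k <;> simp at hm hb ⊢
  · rw [List.length_reverse]; omega

theorem runs_fetch_spareA (a r b : List Sym) :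
    Runs (fetch .spareA) (Store.get { main := r, spareA := a, spareB := b })
      (Store.get { main := a ++ r, spareB := b }) (8 * a.length + 2) :=
  (runs_fetch (by decide) (by decide) { main := r, spareA := a, spareB := b }).of_eq (by simp) rfl

theorem runs_fetch_spareB (b r : List Sym) :
    Runs (fetch .spareB) (Store.get { main := r, spareB := b }) (Store.get { main := b ++ r })
      (8 * b.length + 2) :=
  (runs_fetch (by decide) (by decide) { main := r, spareB := b }).of_eq (by simp) rfl

theorem runs_clear (s : Store) :
    Runs clear s.get { s with buffer := [] }.get (2 * s.buffer.length + 1) := by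
  obtain ⟨u, m, w, a, b, c⟩ := s
  induction w with
  | nil => exact .loop_done rfl
  | cons x w ih =>
    refine .of_eq (.loop_step (by simp) (.pop_of_eq ?_) ih) rfl ?_
    · simp
    · simp only [List.length_cons]; omega

theorem runs_fork (s : Store) :
    Runs fork s.get { s with main := s.buffer.reverse ++ s.main, buffer := [],
                             spareA := s.buffer.reverse ++ s.spareA }.get
      (5 * s.buffer.length + 1) := by
  obtain ⟨u, m, w, a, b, c⟩ := s
  induction w generalizing m a with
  | nil => exact .loop_done rfl
  | cons x w ih =>
    refine .of_eq (.loop_step (by simp) (.branch (.seq (.push StackId.main _ _)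
      (.seq (.push StackId.spareA _ _) (.pop_of_eq (k := StackId.buffer) ?_))))
      (ih (x :: m) (x :: a))) ?_ ?_
    · simp
    · simp
    · simp only [List.length_cons]; omega

end TreeProg

/-- The program `p` turns the contents `m` of the main stack into `m'` in at most `n` steps; the
other stacks are empty before and after. -/
def Transforms (p : TreeProg) (m m' : List Sym) (n : ℕ) : Prop :=
  ∃ t ≤ n, Runs p ({ main := m } : Store).get ({ main := m' } : Store).get t

namespace Transforms

open TreeProg

variable {p q : TreeProg} {m m₁ m₂ : List Sym} {n n₁ n₂ : ℕ}

theorem mono (h : Transforms p m m₁ n₁) (hn : n₁ ≤ n₂) : Transforms p m m₁ n₂ :=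
  let ⟨t, ht, runs⟩ := h
  ⟨t, ht.trans hn, runs⟩

theorem seq (hp : Transforms p m m₁ n₁) (hq : Transforms q m₁ m₂ n₂) :
    Transforms (.seq p q) m m₂ (n₁ + n₂) :=
  let ⟨_, ht₁, runs₁⟩ := hp
  let ⟨_, ht₂, runs₂⟩ := hq
  ⟨_, add_le_add ht₁ ht₂, runs₁.seq runs₂⟩

theorem branch {f : Option Sym → TreeProg} (h : Transforms (f m.head?) m m₁ n) :
    Transforms (.branch .main f) m m₁ (n + 1) :=
  let ⟨_, ht, runs⟩ := h
  ⟨_, Nat.add_le_add_right ht 1, .branch runs⟩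

theorem length_le (h : Transforms p m m₁ n) : m₁.length ≤ m.length + n := by
  obtain ⟨t, ht, runs⟩ := h
  have univ : (Finset.univ : Finset StackId) =
    {.port, .main, .buffer, .spareA, .spareB, .counter} := rfl
  have hle := runs.height_le
  simp only [height, univ, Finset.mem_insert, reduceCtorEq, Finset.mem_singleton, or_self,
    not_false_eq_true, Finset.sum_insert, Store.get_port, List.length_nil, Store.get_main,
    Store.get_buffer, Store.get_spareA, Store.get_spareB, Finset.sum_singleton,
    Store.get_counter, add_zero, zero_add] at hle
  omega

theorem skip (m : List Sym) : Transforms skip m m 1 := ⟨1, le_rfl, .loop_done rfl⟩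

theorem push (a : Sym) (m : List Sym) : Transforms (.push .main a) m (a :: m) 1 :=
  ⟨1, le_rfl, .push_of_eq (by simp)⟩

theorem pop (a : Sym) (m : List Sym) : Transforms (.pop .main) (a :: m) m 1 :=
  ⟨1, le_rfl, .pop_of_eq (by simp)⟩

theorem pushWord (w m : List Sym) : Transforms (pushWord w) m (w ++ m) (w.length + 1) := by
  induction w with
  | nil => exact skip m
  | cons a w ih => exact (ih.seq (push a _)).mono (by simp)

theorem drop (d : BinaryTree Unit) (r : List Sym) :
    Transforms drop (treeWord d ++ r) r (7 * (treeWord d).length + 3) := by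
  refine ⟨_, ?_, (runs_takeTree d { main := r }).seq (runs_clear _)⟩
  rw [List.length_reverse]
  omega

theorem dup (d : BinaryTree Unit) (r : List Sym) :
    Transforms dup (treeWord d ++ r) (treeWord d ++ (treeWord d ++ r))
      (18 * (treeWord d).length + 5) := by
  have fork := (runs_fork { main := r, buffer := (treeWord d).reverse }).of_eq
    (s' := Store.get { main := treeWord d ++ r, spareA := treeWord d }) (by simp) rfl
  refine ⟨_, ?_, (runs_takeTree d { main := r }).seq (fork.seq (runs_fetch_spareA _ _ _))⟩
  rw [List.length_reverse]
  omega

theorem swap (d e : BinaryTree Unit) (r : List Sym) :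
    Transforms swap (treeWord d ++ (treeWord e ++ r)) (treeWord e ++ (treeWord d ++ r))
      (17 * (treeWord d).length + 17 * (treeWord e).length + 10) :=
  ⟨_, by omega, (runs_stash_spareA d _ []).seq ((runs_stash_spareB e _ _).seq
    ((runs_fetch_spareA _ _ _).seq (runs_fetch_spareB _ _)))⟩

theorem joinBelow (l a b : BinaryTree Unit) (r : List Sym) :
    Transforms joinBelow (treeWord l ++ (treeWord a ++ (treeWord b ++ r)))
      (treeWord (.node () a b) ++ (treeWord l ++ r))
      (17 * (treeWord l).length + 17 * (treeWord a).length + 17 * (treeWord b).length + 40) := by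
  refine ⟨_, ?_, (runs_stash_spareA l _ []).seq ((Runs.push_of_eq ?_).seq
    ((runs_stash_spareB (.node () a b) r _).seq
    ((runs_fetch_spareA _ _ _).seq (runs_fetch_spareB _ _))))⟩
  · simp only [treeWord, List.length_cons, List.length_append]
    omega
  · simp [treeWord]

end Transforms

end TreeStacks

/-! ### Polynomial-time functions on tree-encoded data -/

section TreePolyTime

/-- Types whose elements are represented by trees, the data of our programs. -/
class TreeEncoding (α : Type) where
  /-- The tree representing an element. -/
  toTree : α → BinaryTree Unit

open TreeEncoding

instance : TreeEncoding Bool where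
  toTree b := bif b then .node () .nil .nil else .nil

instance {α β : Type} [TreeEncoding α] [TreeEncoding β] : TreeEncoding (α × β) where
  toTree x := .node () (toTree x.1) (toTree x.2)

instance {α : Type} [TreeEncoding α] : TreeEncoding (List α) where
  toTree := List.foldr (fun a t => .node () (toTree a) t) .nil

instance : TreeEncoding ℕ where
  toTree n := toTree (Computability.encodeNat n)

/-- The word representing an element. -/
def codeWord {α : Type} [TreeEncoding α] (x : α) : List Sym := treeWord (toTree x)

/-- The length of the word representing an element. -/
def codeSize {α : Type} [TreeEncoding α] (x : α) : ℕ := (codeWord x).length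

section codeSize

variable {α β : Type} [TreeEncoding α] [TreeEncoding β]

theorem codeWord_pair (x : α × β) :
    codeWord x = Sym.bit true :: (codeWord x.1 ++ codeWord x.2) := rfl

theorem codeWord_nil : codeWord ([] : List α) = [Sym.bit false] := rfl

theorem codeWord_cons (a : α) (l : List α) :
    codeWord (a :: l) = Sym.bit true :: (codeWord a ++ codeWord l) := rfl

theorem length_treeWord_toTree (x : α) : (treeWord (toTree x)).length = codeSize x := rfl

@[simp] theorem codeSize_pair (x : α) (y : β) :
    codeSize (x, y) = codeSize x + codeSize y + 1 := by
  simp [codeSize, codeWord_pair]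

@[simp] theorem codeSize_nil : codeSize ([] : List α) = 1 := rfl

@[simp] theorem codeSize_cons (a : α) (l : List α) :
    codeSize (a :: l) = codeSize a + codeSize l + 1 := by
  simp [codeSize, codeWord_cons]

theorem codeSize_bool_le (b : Bool) : codeSize b ≤ 3 := by cases b <;> decide

theorem length_le_codeSize (l : List α) : l.length ≤ codeSize l := by
  induction l with
  | nil => exact Nat.zero_le _
  | cons a l ih => rw [List.length_cons, codeSize_cons]; omega

theorem codeSize_le_of_mem {a : α} {l : List α} (h : a ∈ l) : codeSize a ≤ codeSize l := by
  induction h with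
  | head l => rw [codeSize_cons]; omega
  | tail b _ ih => rw [codeSize_cons]; omega

theorem codeSize_append (l l' : List α) :
    codeSize (l ++ l') + 1 = codeSize l + codeSize l' := by
  induction l with
  | nil => rw [List.nil_append, codeSize_nil, add_comm]
  | cons a l ih => rw [List.cons_append, codeSize_cons, codeSize_cons]; omega

theorem codeSize_le_of_forall_mem {l : List α} {B : ℕ} (h : ∀ a ∈ l, codeSize a ≤ B) :
    codeSize l ≤ l.length * (B + 1) + 1 := by
  induction l with
  | nil => simp
  | cons a l ih =>
    have hd := h a List.mem_cons_self
    have tl := ih fun b hb => h b (List.mem_cons_of_mem a hb)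
    rw [codeSize_cons, List.length_cons, Nat.succ_mul]
    omega

end codeSize

/-- `f` is computed by a program in polynomial time. -/
def TreePolyTime {α β : Type} [TreeEncoding α] [TreeEncoding β] (f : α → β) : Prop :=
  ∃ (p : TreeProg) (q : Polynomial ℕ), ∀ x r,
    Transforms p (codeWord x ++ r) (codeWord (f x) ++ r) (q.eval (codeSize x))

theorem monotone_polynomial_eval {R : Type*} [CommSemiring R] [PartialOrder R]
    [CanonicallyOrderedAdd R] [IsOrderedRing R] (q : Polynomial R) :
    Monotone fun n => q.eval n := by
  intro m n h
  induction q using Polynomial.induction_on' with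
  | add p q hp hq => simpa only [Polynomial.eval_add] using add_le_add hp hq
  | monomial k c =>
    simpa only [Polynomial.eval_monomial] using
      mul_le_mul_right (pow_le_pow_left₀ zero_le h k) c

namespace TreePolyTime

variable {α β γ : Type} [TreeEncoding α] [TreeEncoding β] [TreeEncoding γ]

theorem exists_codeSize_le {f : α → β} (h : TreePolyTime f) :
    ∃ q : Polynomial ℕ, ∀ x, codeSize (f x) ≤ q.eval (codeSize x) := by
  obtain ⟨p, q, h⟩ := h
  refine ⟨Polynomial.X + q, fun x => ?_⟩
  simpa [codeSize] using (h x []).length_le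

protected theorem id : TreePolyTime (fun x : α => x) :=
  ⟨TreeProg.skip, 1, fun x r => by simpa using Transforms.skip (codeWord x ++ r)⟩

theorem of_codeWord_eq {f : α → β} {g : α → γ} (h : TreePolyTime f)
    (e : ∀ x, codeWord (f x) = codeWord (g x)) : TreePolyTime g := by
  obtain ⟨p, q, h⟩ := h
  exact ⟨p, q, fun x r => e x ▸ h x r⟩

theorem comp {g : β → γ} {f : α → β} (hg : TreePolyTime g) (hf : TreePolyTime f) :
    TreePolyTime (fun x => g (f x)) := by
  obtain ⟨s, hs⟩ := hf.exists_codeSize_le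
  obtain ⟨p₁, q₁, h₁⟩ := hg
  obtain ⟨p₂, q₂, h₂⟩ := hf
  refine ⟨.seq p₂ p₁, q₂ + q₁.comp s, fun x r => ((h₂ x r).seq (h₁ _ r)).mono ?_⟩
  rw [Polynomial.eval_add, Polynomial.eval_comp]
  exact Nat.add_le_add_left (monotone_polynomial_eval q₁ (hs x)) _

theorem const (b : β) : TreePolyTime (fun _ : α => b) := by
  refine ⟨.seq TreeProg.drop (TreeProg.pushWord (codeWord b)),
    7 * Polynomial.X + Polynomial.C (codeSize b + 4), fun x r =>
    ((Transforms.drop (toTree x) r).seq (Transforms.pushWord (codeWord b) r)).mono ?_⟩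
  simp only [Polynomial.eval_add, Polynomial.eval_mul, Polynomial.eval_X, Polynomial.eval_C,
    Polynomial.eval_ofNat, codeSize, codeWord]
  omega

theorem pair {f : α → β} {g : α → γ} (hf : TreePolyTime f) (hg : TreePolyTime g) :
    TreePolyTime (fun x => (f x, g x)) := by
  obtain ⟨sf, hsf⟩ := hf.exists_codeSize_le
  obtain ⟨sg, hsg⟩ := hg.exists_codeSize_le
  obtain ⟨p₁, q₁, h₁⟩ := hf
  obtain ⟨p₂, q₂, h₂⟩ := hg
  refine ⟨.seq TreeProg.dup (.seq p₁ (.seq TreeProg.swap (.seq p₂ (.seq TreeProg.swap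
    (.push .main (Sym.bit true)))))),
    q₁ + q₂ + 40 * (Polynomial.X + sf + sg + 1), fun x r => ?_⟩
  rw [codeWord_pair, List.cons_append, List.append_assoc]
  refine ((Transforms.dup (toTree x) r).seq ((h₁ x _).seq
    ((Transforms.swap (toTree (f x)) (toTree x) r).seq ((h₂ x _).seq
    ((Transforms.swap (toTree (g x)) (toTree (f x)) r).seq (Transforms.push _ _)))))).mono ?_
  have := hsf x
  have := hsg x
  simp only [Polynomial.eval_add, Polynomial.eval_mul, Polynomial.eval_X, Polynomial.eval_one,
    Polynomial.eval_ofNat, length_treeWord_toTree]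
  omega

theorem fst : TreePolyTime (fun x : α × β => x.1) := by
  refine ⟨.seq (.pop .main) (.seq TreeProg.swap TreeProg.drop), 40 * (Polynomial.X + 1),
    fun ⟨a, b⟩ r => ?_⟩
  rw [codeWord_pair, List.cons_append, List.append_assoc]
  refine ((Transforms.pop _ _).seq ((Transforms.swap (toTree a) (toTree b) r).seq
    (Transforms.drop (toTree b) _))).mono ?_
  simp only [Polynomial.eval_add, Polynomial.eval_mul, Polynomial.eval_X, Polynomial.eval_one,
    Polynomial.eval_ofNat, length_treeWord_toTree, codeSize_pair]
  omega

theorem snd : TreePolyTime (fun x : α × β => x.2) := by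
  refine ⟨.seq (.pop .main) TreeProg.drop, 40 * (Polynomial.X + 1), fun ⟨a, b⟩ r => ?_⟩
  rw [codeWord_pair, List.cons_append, List.append_assoc]
  refine ((Transforms.pop _ _).seq (Transforms.drop (toTree a) _)).mono ?_
  simp only [Polynomial.eval_add, Polynomial.eval_mul, Polynomial.eval_X, Polynomial.eval_one,
    Polynomial.eval_ofNat, length_treeWord_toTree, codeSize_pair]
  omega

theorem cond {c : α → Bool} {f g : α → β} (hc : TreePolyTime c) (hf : TreePolyTime f)
    (hg : TreePolyTime g) : TreePolyTime (fun x => bif c x then f x else g x) := by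
  obtain ⟨p₀, q₀, h₀⟩ := hc
  obtain ⟨p₁, q₁, h₁⟩ := hf
  obtain ⟨p₂, q₂, h₂⟩ := hg
  let continuation : Option Sym → TreeProg := fun
    | some (Sym.bit true) => .seq (.pop .main) (.seq (.pop .main) (.seq (.pop .main) p₁))
    | _ => .seq (.pop .main) p₂
  have choose (x : α) (r : List Sym) : Transforms (.branch .main continuation)
      (codeWord (c x) ++ (codeWord x ++ r)) (codeWord (bif c x then f x else g x) ++ r)
      (q₁.eval (codeSize x) + q₂.eval (codeSize x) + 4) := by
    cases c x
    · exact .mono (.branch ((Transforms.pop _ _).seq (h₂ x r))) (by omega)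
    · exact .mono (.branch ((Transforms.pop _ _).seq ((Transforms.pop _ _).seq
        ((Transforms.pop _ _).seq (h₁ x r))))) (by omega)
  refine ⟨.seq TreeProg.dup (.seq p₀ (.branch .main continuation)),
    q₀ + q₁ + q₂ + 40 * (Polynomial.X + 1), fun x r =>
    ((Transforms.dup (toTree x) r).seq ((h₀ x _).seq (choose x r))).mono ?_⟩
  simp only [Polynomial.eval_add, Polynomial.eval_mul, Polynomial.eval_X, Polynomial.eval_one,
    Polynomial.eval_ofNat, length_treeWord_toTree]
  omega

theorem cons {f : α → β} {g : α → List β} (hf : TreePolyTime f) (hg : TreePolyTime g) :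
    TreePolyTime (fun x => f x :: g x) :=
  (hf.pair hg).of_codeWord_eq fun _ => rfl

theorem list_casesOn {l : α → List β} {f : α → γ} {g : α × β × List β → γ} (hl : TreePolyTime l)
    (hf : TreePolyTime f) (hg : TreePolyTime g) :
    TreePolyTime (fun x => match l x with
      | [] => f x
      | a :: t => g (x, a, t)) := by
  obtain ⟨s, hs⟩ := hl.exists_codeSize_le
  obtain ⟨p₀, q₀, h₀⟩ := hl
  obtain ⟨p₁, q₁, h₁⟩ := hf
  obtain ⟨p₂, q₂, h₂⟩ := hg
  let continuation : Option Sym → TreeProg := fun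
    | some (Sym.bit true) => .seq TreeProg.swap (.seq (.push .main (Sym.bit true)) p₂)
    | _ => .seq (.pop .main) p₁
  have choose (x : α) (l : List β) (r : List Sym) : Transforms (.branch .main continuation)
      (codeWord l ++ (codeWord x ++ r))
      (codeWord (match l with
        | [] => f x
        | a :: t => g (x, a, t)) ++ r)
      (q₁.eval (codeSize x) + q₂.eval (codeSize x + codeSize l + 1)
        + 17 * (codeSize x + codeSize l) + 13) := by
    rcases l with _ | ⟨a, t⟩
    · exact .mono (.branch ((Transforms.pop _ _).seq (h₁ x r))) (by omega)
    · have arguments := h₂ (x, a, t) r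
      rw [codeWord_pair, List.cons_append, List.append_assoc] at arguments
      refine .mono (.branch ((Transforms.swap (toTree (a, t)) (toTree x) r).seq
        ((Transforms.push (Sym.bit true) _).seq arguments))) ?_
      simp only [length_treeWord_toTree, codeSize_pair, codeSize_cons]
      omega
  refine ⟨.seq TreeProg.dup (.seq p₀ (.branch .main continuation)),
    q₀ + q₁ + q₂.comp (Polynomial.X + s + 1) + 40 * (Polynomial.X + s + 1), fun x r =>
    ((Transforms.dup (toTree x) r).seq ((h₀ x _).seq (choose x (l x) r))).mono ?_⟩
  have hsx := hs x
  have hq₂ : q₂.eval (codeSize x + codeSize (l x) + 1) ≤ q₂.eval (codeSize x +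
    s.eval (codeSize x) + 1) := monotone_polynomial_eval q₂ (by omega)
  simp only [Polynomial.eval_add, Polynomial.eval_mul, Polynomial.eval_X, Polynomial.eval_one,
    Polynomial.eval_ofNat, Polynomial.eval_comp, length_treeWord_toTree]
  omega

end TreePolyTime

/-- The loop folding the program `p` over the list on top of the stack, starting with the tree
below it. -/
def TreeProg.foldLoop (p : TreeProg) : TreeProg :=
  .loop .main (fun o => o == some (Sym.bit true))
    (.seq (.pop .main) (.seq TreeProg.swap (.seq TreeProg.joinBelow (.seq p TreeProg.swap))))

theorem Transforms.foldLoop {β γ : Type} [TreeEncoding β] [TreeEncoding γ] {g : β × γ → γ}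
    {p : TreeProg} {q : Polynomial ℕ}
    (hp : ∀ x r, Transforms p (codeWord x ++ r) (codeWord (g x) ++ r) (q.eval (codeSize x)))
    (B : ℕ) (l : List β) (s : γ) (r : List Sym) (hl : codeSize l ≤ B)
    (hB : ∀ n, codeSize ((l.take n).foldl (fun s a => g (a, s)) s) ≤ B) :
    Transforms p.foldLoop (codeWord l ++ (codeWord s ++ r))
      (Sym.bit false :: (codeWord (l.foldl (fun s a => g (a, s)) s) ++ r))
      (l.length * (q.eval (2 * B + 1) + 200 * B + 200) + 1) := by
  induction l generalizing s with
  | nil => exact ⟨1, by simp, .loop_done rfl⟩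
  | cons a l ih =>
    rw [codeSize_cons] at hl
    have hs : codeSize s ≤ B := hB 0
    have hg : codeSize (g (a, s)) ≤ B := by simpa using hB 1
    have hq : q.eval (codeSize (a, s)) ≤ q.eval (2 * B + 1) :=
      monotone_polynomial_eval q (by rw [codeSize_pair]; omega)
    obtain ⟨t, ht, rest⟩ := ih (g (a, s)) (by omega) fun n => by simpa using hB (n + 1)
    obtain ⟨t', ht', body⟩ :=
      (Transforms.pop (Sym.bit true) (codeWord a ++ (codeWord l ++ (codeWord s ++ r)))).seq
        ((Transforms.swap (toTree a) (toTree l) (codeWord s ++ r)).seq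
        ((Transforms.joinBelow (toTree l) (toTree a) (toTree s) r).seq
        ((hp (a, s) (codeWord l ++ r)).seq
        (Transforms.swap (toTree (g (a, s))) (toTree l) r))))
    rw [codeWord_cons, List.cons_append, List.append_assoc]
    refine ⟨_, ?_, .loop_step rfl body rest⟩
    simp only [length_treeWord_toTree] at ht'
    rw [List.length_cons, Nat.succ_mul]
    omega

theorem foldl_prod_mk {α β γ : Type*} {f : α × γ × β → γ} (x : α) (s : γ) (l : List β) :
    l.foldl (fun (s : α × γ) a => (s.1, f (s.1, s.2, a))) (x, s) =
      (x, l.foldl (fun s a => f (x, s, a)) s) := by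
  induction l generalizing s with
  | nil => rfl
  | cons a _ ih => exact ih _

theorem codeSize_foldl_le {β γ : Type} [TreeEncoding γ] {g : γ → β → γ} {B : ℕ} (l : List β)
    (h : ∀ s, ∀ a ∈ l, codeSize (g s a) ≤ codeSize s + B) (s : γ) :
    codeSize (l.foldl g s) ≤ codeSize s + l.length * B := by
  induction l generalizing s with
  | nil => exact Nat.le_add_right _ _
  | cons a l ih =>
    have first := h s a List.mem_cons_self
    have rest := ih (fun s b hb => h s b (List.mem_cons_of_mem a hb)) (g s a)
    rw [List.length_cons, Nat.succ_mul, List.foldl_cons]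
    omega

namespace TreePolyTime

variable {α β γ : Type} [TreeEncoding α] [TreeEncoding β] [TreeEncoding γ]

theorem foldl_of_codeSize_le {l : α → List β} {i : α → γ} {f : α × γ × β → γ}
    (hl : TreePolyTime l) (hi : TreePolyTime i) (hf : TreePolyTime f) (B : Polynomial ℕ)
    (hB : ∀ x n, codeSize (((l x).take n).foldl (fun s a => f (x, s, a)) (i x)) ≤
      B.eval (codeSize x)) :
    TreePolyTime (fun x => (l x).foldl (fun s a => f (x, s, a)) (i x)) := by
  have hg : TreePolyTime (fun y : β × α × γ => (y.2.1, f (y.2.1, y.2.2, y.1))) :=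
    (fst.comp snd).pair (hf.comp ((fst.comp snd).pair ((snd.comp snd).pair fst)))
  obtain ⟨p, q, h⟩ := hg
  obtain ⟨s, hs⟩ := hl.exists_codeSize_le
  obtain ⟨p₀, q₀, h₀⟩ := hl.pair (TreePolyTime.id.pair hi)
  suffices TreePolyTime (fun x => (x, (l x).foldl (fun s a => f (x, s, a)) (i x))) from
    snd.comp this
  let R : Polynomial ℕ := s + Polynomial.X + B + 1
  refine ⟨.seq p₀ (.seq (.pop .main) (.seq p.foldLoop (.pop .main))),
    q₀ + 1 + (s * (q.comp (2 * R + 1) + 200 * R + 200) + 2), fun x r => ?_⟩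
  have hsx := hs x
  have hR : R.eval (codeSize x) =
      s.eval (codeSize x) + codeSize x + B.eval (codeSize x) + 1 := by simp [R]
  have fold := Transforms.foldLoop h (R.eval (codeSize x)) (l x) (x, i x) r (by omega) fun n => by
    have hBx := hB x n
    rw [foldl_prod_mk, codeSize_pair, hR]
    omega
  rw [foldl_prod_mk] at fold
  have start := h₀ x r
  rw [codeWord_pair, List.cons_append, List.append_assoc] at start
  refine (start.seq ((Transforms.pop _ _).seq (fold.seq (Transforms.pop _ _)))).mono ?_
  have hmul := Nat.mul_le_mul_right
    (q.eval (2 * R.eval (codeSize x) + 1) + 200 * R.eval (codeSize x) + 200)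
    ((length_le_codeSize _).trans hsx)
  simp only [Polynomial.eval_add, Polynomial.eval_mul, Polynomial.eval_one,
    Polynomial.eval_ofNat, Polynomial.eval_comp]
  omega

theorem foldl {l : α → List β} {i : α → γ} {f : α × γ × β → γ} (hl : TreePolyTime l)
    (hi : TreePolyTime i) (hf : TreePolyTime f) (P : Polynomial ℕ)
    (hP : ∀ x s, ∀ a ∈ l x, codeSize (f (x, s, a)) ≤ codeSize s + P.eval (codeSize x)) :
    TreePolyTime (fun x => (l x).foldl (fun s a => f (x, s, a)) (i x)) := by
  obtain ⟨ql, hql⟩ := hl.exists_codeSize_le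
  obtain ⟨qi, hqi⟩ := hi.exists_codeSize_le
  refine foldl_of_codeSize_le hl hi hf (qi + ql * P) fun x n => ?_
  rw [Polynomial.eval_add, Polynomial.eval_mul]
  have hlen : ((l x).take n).length ≤ ql.eval (codeSize x) :=
    (List.length_take_le' _ _).trans ((length_le_codeSize _).trans (hql x))
  exact (codeSize_foldl_le _ (fun s a ha => hP x s a (List.mem_of_mem_take ha)) _).trans
    (add_le_add (hqi x) (Nat.mul_le_mul_right _ hlen))

theorem not {f : α → Bool} (hf : TreePolyTime f) : TreePolyTime (fun x => !f x) :=
  (hf.cond (const false) (const true)).of_codeWord_eq fun x => by cases f x <;> rfl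

theorem and {f g : α → Bool} (hf : TreePolyTime f) (hg : TreePolyTime g) :
    TreePolyTime (fun x => f x && g x) :=
  (hf.cond hg (const false)).of_codeWord_eq fun x => by cases f x <;> rfl

theorem beq_bool {f g : α → Bool} (hf : TreePolyTime f) (hg : TreePolyTime g) :
    TreePolyTime (fun x => f x == g x) :=
  (hf.cond hg hg.not).of_codeWord_eq fun x => by cases f x <;> cases g x <;> rfl

theorem reverseAppend {l m : α → List β} (hl : TreePolyTime l) (hm : TreePolyTime m) :
    TreePolyTime (fun x => (l x).reverse ++ m x) := by
  obtain ⟨ql, hql⟩ := hl.exists_codeSize_le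
  have fold := hl.foldl hm (f := fun y : α × List β × β => y.2.2 :: y.2.1)
    ((snd.comp snd).cons (fst.comp snd)) (ql + 1) fun x s a ha => by
      have := (codeSize_le_of_mem ha).trans (hql x)
      simp only [codeSize_cons, Polynomial.eval_add, Polynomial.eval_one]
      omega
  exact fold.of_codeWord_eq fun x => by rw [List.foldl_flip_cons_eq_append']

theorem append {l m : α → List β} (hl : TreePolyTime l) (hm : TreePolyTime m) :
    TreePolyTime (fun x => l x ++ m x) :=
  ((hl.reverseAppend (const [])).reverseAppend hm).of_codeWord_eq fun x => by
    rw [List.append_nil, List.reverse_reverse]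

theorem flatMap {l : α → List β} {f : α × β → List γ} (hl : TreePolyTime l)
    (hf : TreePolyTime f) : TreePolyTime (fun x => (l x).flatMap fun a => f (x, a)) := by
  obtain ⟨ql, hql⟩ := hl.exists_codeSize_le
  obtain ⟨qf, hqf⟩ := hf.exists_codeSize_le
  have fold := hl.foldl (const []) (f := fun y : α × List γ × β => y.2.1 ++ f (y.1, y.2.2))
    ((fst.comp snd).append (hf.comp (fst.pair (snd.comp snd))))
    (qf.comp (Polynomial.X + ql + 1)) fun x s a ha => by
      have hsplit := codeSize_append s (f (x, a))
      have hmono : qf.eval (codeSize (x, a)) ≤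
          qf.eval (codeSize x + ql.eval (codeSize x) + 1) :=
        monotone_polynomial_eval qf (by
          rw [codeSize_pair]
          exact Nat.add_le_add_right
            (Nat.add_le_add_left ((codeSize_le_of_mem ha).trans (hql x)) _) 1)
      have := (hqf (x, a)).trans hmono
      simp only [Polynomial.eval_add, Polynomial.eval_one, Polynomial.eval_X, Polynomial.eval_comp]
      omega
  refine fold.of_codeWord_eq fun x => ?_
  rw [List.flatMap_eq_foldl]

theorem map {l : α → List β} {f : α × β → γ} (hl : TreePolyTime l) (hf : TreePolyTime f) :
    TreePolyTime (fun x => (l x).map fun a => f (x, a)) :=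
  (hl.flatMap (hf.cons (const []))).of_codeWord_eq fun x => by
    rw [← List.flatMap_singleton' (List.map _ _), List.flatMap_map]

theorem filter {l : α → List β} {f : α × β → Bool} (hl : TreePolyTime l) (hf : TreePolyTime f) :
    TreePolyTime (fun x => (l x).filter fun a => f (x, a)) :=
  (hl.flatMap (hf.cond (snd.cons (const [])) (const []))).of_codeWord_eq fun x => by
    congr 1
    induction l x with
    | nil => rfl
    | cons a m ih => cases h : f (x, a) <;> simp [h, ih]

theorem isEmpty {l : α → List β} (hl : TreePolyTime l) : TreePolyTime (fun x => (l x).isEmpty) :=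
  (hl.list_casesOn (const true) (const false)).of_codeWord_eq fun x => by cases l x <;> rfl

theorem any {l : α → List β} {f : α × β → Bool} (hl : TreePolyTime l) (hf : TreePolyTime f) :
    TreePolyTime (fun x => (l x).any fun a => f (x, a)) :=
  (hl.filter hf).isEmpty.not.of_codeWord_eq fun x => by
    congr 1
    rw [Bool.eq_iff_iff]
    simp

theorem headD {l : α → List β} {f : α → β} (hl : TreePolyTime l) (hf : TreePolyTime f) :
    TreePolyTime (fun x => (l x).headD (f x)) :=
  (hl.list_casesOn hf (fst.comp snd)).of_codeWord_eq fun x => by cases l x <;> rfl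

end TreePolyTime

/-- One step of the comparison of two lists: compare the next element with the head of the
remaining list. -/
def beqStep {α : Type*} [BEq α] (s : List α × Bool) (a : α) : List α × Bool :=
  match s.1 with
  | [] => ([], false)
  | b :: t => (t, s.2 && a == b)

theorem foldl_beqStep {α : Type*} [BEq α] (l m : List α) (c : Bool) :
    ((l.foldl beqStep (m, c)).1.isEmpty && (l.foldl beqStep (m, c)).2) = (c && l == m) := by
  induction l generalizing m c with
  | nil => cases m <;> cases c <;> rfl
  | cons a l ih =>
    cases m with
    | nil => rw [List.foldl_cons]; simp [beqStep, ih]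
    | cons b m => rw [List.foldl_cons]; simp [beqStep, ih, Bool.and_assoc]

namespace TreePolyTime

variable {α β : Type} [TreeEncoding α] [TreeEncoding β]

theorem beqStep {f : α → List Bool × Bool} {a : α → Bool} (hf : TreePolyTime f)
    (ha : TreePolyTime a) : TreePolyTime (fun x => beqStep (f x) (a x)) :=
  ((fst.comp hf).list_casesOn (f := fun _ => (([], false) : List Bool × Bool))
    (g := fun y : α × Bool × List Bool => (y.2.2, (f y.1).2 && a y.1 == y.2.1)) (const _)
    ((snd.comp snd).pair (((snd.comp hf).comp fst).and
      ((ha.comp fst).beq_bool (fst.comp snd))))).of_codeWord_eq fun x => by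
    unfold KBase.beqStep
    rcases (f x).1 with _ | _ <;> rfl

theorem beq_listBool {f g : α → List Bool} (hf : TreePolyTime f) (hg : TreePolyTime g) :
    TreePolyTime (fun x => f x == g x) := by
  have fold := hf.foldl (hg.pair (const true))
    (f := fun y : α × (List Bool × Bool) × Bool => KBase.beqStep y.2.1 y.2.2)
    ((fst.comp snd).beqStep (snd.comp snd)) 10 fun x s a _ => by
      rcases s with ⟨_ | ⟨b, t⟩, c⟩
      · have := codeSize_bool_le false
        simp only [KBase.beqStep, codeSize_pair, Polynomial.eval_ofNat]
        omega
      · have := codeSize_bool_le (c && a == b)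
        simp only [KBase.beqStep, codeSize_pair, codeSize_cons, Polynomial.eval_ofNat]
        omega
  refine ((fst.comp fold).isEmpty.and (snd.comp fold)).of_codeWord_eq fun x => ?_
  rw [foldl_beqStep, Bool.true_and]

theorem encodeNat {f : α → ℕ} (hf : TreePolyTime f) :
    TreePolyTime (fun x => Computability.encodeNat (f x)) :=
  hf.of_codeWord_eq fun _ => rfl

theorem compl {f : α → Literal} (hf : TreePolyTime f) : TreePolyTime (fun x => compl (f x)) :=
  (fst.comp hf).pair (snd.comp hf).not

end TreePolyTime

end TreePolyTime

/-! ### Reading and writing formulas -/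

/-- The digits representing a symbol as a tree; a sign is told from a binary digit by the first of
them. -/
def symCode : Sym → List Bool
  | .bit b => [false, b]
  | .sign b => [true, b]
  | .endClause => []

instance : TreeEncoding Sym where
  toTree x := TreeEncoding.toTree (symCode x)

theorem codeSize_sym_le (x : Sym) : codeSize x ≤ 9 := by
  rcases x with (_ | _) | (_ | _) | _ <;> decide

namespace TreeProg

open StackProg

/-- Move a symbol from `port` to the list on the main stack. -/
def readSym : TreeProg :=
  .branch .port fun
    | some x => .seq (.pop .port) (.seq (pushWord (codeWord x)) (.push .main (Sym.bit true)))
    | none => .pop .port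

/-- Turn the word in `port` into a list on the main stack, in reverse order. -/
def readPort : TreeProg :=
  .seq (.push .main (Sym.bit false)) (.loop .port Option.isSome readSym)

/-- Remove a Boolean from the main stack and continue with the program it selects. -/
def withBool (f : Bool → TreeProg) : TreeProg :=
  .branch .main fun
    | some (Sym.bit true) => .seq (.pop .main) (.seq (.pop .main) (.seq (.pop .main) (f true)))
    | _ => .seq (.pop .main) (f false)

/-- Move a symbol from the main stack to `port`. -/
def emit : TreeProg :=
  .branch .main fun
    | some (Sym.bit true) => .seq (.pop .main) (withBool fun s => .seq (.pop .main)
        (withBool fun b => .seq (.pop .main) (.push .port (bif s then Sym.sign b else Sym.bit b))))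
    | _ => .seq (.pop .main) (.push .port Sym.endClause)

/-- Turn the list on the main stack into a word in `port`, in reverse order. -/
def writePort : TreeProg :=
  .seq (.loop .main (fun o => o == some (Sym.bit true)) (.seq (.pop .main) emit)) (.pop .main)

theorem runs_pushWord (w : List Sym) (s : Store) :
    Runs (pushWord w) s.get { s with main := w ++ s.main }.get (w.length + 1) := by
  induction w with
  | nil => exact .loop_done rfl
  | cons x w ih =>
    exact (ih.seq (.push_of_eq (s' := Store.get { s with main := x :: w ++ s.main })
      (by simp))).of_eq rfl rfl

theorem runs_readSym (x : Sym) (u v : List Sym) :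
    ∃ t ≤ 13, Runs readSym (Store.get { port := x :: u, main := codeWord v })
      (Store.get { port := u, main := codeWord (x :: v) }) t := by
  have hx : (codeWord x).length ≤ 9 := codeSize_sym_le x
  exact ⟨_, by omega, .branch (.seq (.pop_of_eq (Store.update_get_port _ _))
    (.seq (runs_pushWord _ _) (.push_of_eq (by simp [codeWord_cons]))))⟩

theorem runs_readPort (u : List Sym) :
    ∃ t ≤ 20 * u.length + 2, Runs readPort (Store.get { port := u })
      (Store.get { main := codeWord u.reverse }) t := by
  suffices h : ∀ v : List Sym, ∃ t ≤ 20 * u.length + 1, Runs (.loop .port Option.isSome readSym)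
      (Store.get { port := u, main := codeWord v })
      (Store.get { main := codeWord (u.reverse ++ v) }) t by
    obtain ⟨t, ht, runs⟩ := h []
    rw [List.append_nil] at runs
    exact ⟨_, by omega, .seq (.push_of_eq (by simp [codeWord_nil])) runs⟩
  induction u with
  | nil => exact fun v => ⟨1, le_add_self, .loop_done rfl⟩
  | cons x u ih =>
    intro v
    obtain ⟨t, ht, runs⟩ := ih (x :: v)
    obtain ⟨t₁, ht₁, reads⟩ := runs_readSym x u v
    refine ⟨_, ?_, (Runs.loop_step rfl reads runs).of_eq (by simp) rfl⟩
    simp only [List.length_cons]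
    omega

theorem runs_withBool {f : Bool → TreeProg} (b : Bool) {s : Store} {s' : StackId → List Sym} {t : ℕ}
    (h : Runs (f b) s.get s' t) :
    ∃ t' ≤ t + 4, Runs (withBool f) { s with main := codeWord b ++ s.main }.get s' t' := by
  cases b
  · exact ⟨_, by omega, .branch (.seq (.pop_of_eq (Store.update_get_main _ _)) h)⟩
  · exact ⟨_, by omega, .branch (.seq (.pop_of_eq (Store.update_get_main _ _))
      (.seq (.pop_of_eq (Store.update_get_main _ _))
        (.seq (.pop_of_eq (Store.update_get_main _ _)) h)))⟩

theorem runs_emit (x : Sym) (u r : List Sym) :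
    ∃ t ≤ 20, Runs emit (Store.get { port := u, main := codeWord x ++ r })
      (Store.get { port := x :: u, main := r }) t := by
  have readTwo (s b : Bool) : ∃ t ≤ 20, Runs emit
      (Store.get { port := u, main := codeWord [s, b] ++ r })
      (Store.get { port := (bif s then Sym.sign b else Sym.bit b) :: u, main := r }) t := by
    obtain ⟨t₁, ht₁, inner⟩ := runs_withBool (s := { port := u, main := Sym.bit false :: r }) b
      (f := fun b => .seq (.pop .main) (.push .port (bif s then Sym.sign b else Sym.bit b)))
      (.seq (.pop_of_eq (Store.update_get_main _ _)) (.push_of_eq (Store.update_get_port _ _)))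
    obtain ⟨t₂, ht₂, outer⟩ := runs_withBool (s := { port := u, main := codeWord [b] ++ r }) s
      (f := fun s => .seq (.pop .main) (withBool fun b =>
        .seq (.pop .main) (.push .port (bif s then Sym.sign b else Sym.bit b))))
      (.seq (.pop_of_eq (by simp [codeWord_cons, codeWord_nil])) inner)
    exact ⟨_, by omega, .branch (.seq (.pop_of_eq (by simp [codeWord_cons])) outer)⟩
  rcases x with b | b | _
  · exact readTwo false b
  · exact readTwo true b
  · exact ⟨_, by decide, .branch (.seq (.pop_of_eq (Store.update_get_main _ _))
      (.push_of_eq (Store.update_get_port _ _)))⟩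

theorem runs_writePort (l : List Sym) :
    ∃ t ≤ 22 * l.length + 2, Runs writePort (Store.get { main := codeWord l })
      (Store.get { port := l.reverse }) t := by
  suffices h : ∀ u : List Sym, ∃ t ≤ 22 * l.length + 1,
      Runs (.loop .main (fun o => o == some (Sym.bit true)) (.seq (.pop .main) emit))
        (Store.get { port := u, main := codeWord l })
        (Store.get { port := l.reverse ++ u, main := [Sym.bit false] }) t by
    obtain ⟨t, ht, runs⟩ := h []
    rw [List.append_nil] at runs
    exact ⟨_, by omega, runs.seq (.pop_of_eq (by simp))⟩
  induction l with
  | nil => exact fun u => ⟨1, le_add_self, .loop_done rfl⟩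
  | cons x l ih =>
    intro u
    obtain ⟨t, ht, runs⟩ := ih (x :: u)
    obtain ⟨t₁, ht₁, emits⟩ := runs_emit x u (codeWord l)
    refine ⟨_, ?_, (Runs.loop_step rfl
      (.seq (.pop_of_eq (k := StackId.main) ?_) emits) runs).of_eq ?_ rfl⟩
    · simp only [List.length_cons]; omega
    · simp [codeWord_cons]
    · simp

end TreeProg

/-- Formulas whose variables are given by their binary digits. -/
abbrev DigitFormula : Type := List (List (List Bool × Bool))

/-- The digits of the variable of a literal, and its sign. -/
def literalDigits (x : Literal) : List Bool × Bool := (Computability.encodeNat x.1, x.2)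

/-- A formula with the digits of its variables. -/
def toDigits (L : Formula) : DigitFormula := L.map (List.map literalDigits)

/-- One step of reading a formula from right to left; the argument `s` codes the symbol read. -/
def parseStep (F : DigitFormula) (s : List Bool) : DigitFormula :=
  match s with
  | [] => [] :: F
  | k :: t =>
    match F with
    | [] => []
    | C :: G =>
      bif k then (([], t.headD false) :: C) :: G else
        match C with
        | [] => C :: G
        | x :: D => ((t.headD false :: x.1, x.2) :: D) :: G

/-- Reading a formula from right to left. -/
def parse (w : List Sym) : DigitFormula := w.foldr (fun x F => parseStep F (symCode x)) []

theorem foldr_parseStep_bits (l d : List Bool) (b : Bool) (C : List (List Bool × Bool))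
    (G : DigitFormula) :
    (l.map Sym.bit).foldr (fun x F => parseStep F (symCode x)) (((d, b) :: C) :: G) =
      ((l ++ d, b) :: C) :: G := by
  induction l with
  | nil => rfl
  | cons a l ih =>
    rw [List.map_cons, List.foldr_cons, ih]
    rfl

theorem foldr_parseStep_literals (C : List Literal) (G : DigitFormula) :
    (C.flatMap encodeLiteral).foldr (fun x F => parseStep F (symCode x)) ([] :: G) =
      C.map literalDigits :: G := by
  induction C with
  | nil => rfl
  | cons x C ih =>
    have bits := foldr_parseStep_bits (Computability.encodeNat x.1) [] x.2 (C.map literalDigits) G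
    rw [List.append_nil] at bits
    rw [List.flatMap_cons, List.foldr_append, ih, encodeLiteral, List.foldr_append]
    exact bits

theorem parse_encodeFormula (L : Formula) : parse (encodeFormula L) = toDigits L := by
  induction L with
  | nil => rfl
  | cons C L ih =>
    rw [parse, encodeFormula, List.flatMap_cons, List.foldr_append, ← encodeFormula, ← parse, ih,
      encodeClause, List.foldr_append]
    exact foldr_parseStep_literals C (toDigits L)

theorem codeWord_map_literalDigits (C : List Literal) :
    codeWord (C.map literalDigits) = codeWord C := by
  induction C with
  | nil => rfl
  | cons x C ih =>
    rw [List.map_cons, codeWord_cons, codeWord_cons, ih]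
    rfl

theorem codeWord_toDigits (L : Formula) : codeWord (toDigits L) = codeWord L := by
  induction L with
  | nil => rfl
  | cons C L ih =>
    rw [toDigits, List.map_cons, codeWord_cons, codeWord_cons, ← toDigits, ih,
      codeWord_map_literalDigits]

theorem codeWord_map_symCode (w : List Sym) : codeWord (w.map symCode) = codeWord w := by
  induction w with
  | nil => rfl
  | cons x w ih =>
    rw [List.map_cons, codeWord_cons, codeWord_cons, ih]
    rfl

theorem codeSize_parseStep_le (F : DigitFormula) (s : List Bool) :
    codeSize (parseStep F s) ≤ codeSize F + 20 := by
  rcases s with _ | ⟨_ | _, t⟩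
  · simp only [parseStep, codeSize_cons, codeSize_nil]; omega
  · have := codeSize_bool_le (t.head?.getD false)
    rcases F with _ | ⟨_ | ⟨⟨_, _⟩, _⟩, _⟩ <;>
      simp only [parseStep, List.headD_eq_head?_getD, cond_false, codeSize_cons, codeSize_pair,
        codeSize_nil] <;> omega
  · have := codeSize_bool_le (t.head?.getD false)
    rcases F with _ | ⟨C, _⟩ <;>
      simp only [parseStep, List.headD_eq_head?_getD, cond_true, codeSize_cons, codeSize_pair,
        codeSize_nil] <;> omega

namespace TreePolyTime

theorem parseStep :
    TreePolyTime (fun y : DigitFormula × List Bool => KBase.parseStep y.1 y.2) := by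
  have head : TreePolyTime fun z : ((DigitFormula × List Bool) × Bool × List Bool) ×
      List (List Bool × Bool) × DigitFormula => z.1.2.2.headD false :=
    (snd.comp (snd.comp fst)).headD (const false)
  have newLiteral := (((const []).pair head).cons (fst.comp snd)).cons (snd.comp snd)
  have newDigit := ((((head.comp fst).cons (fst.comp (fst.comp snd))).pair
    (snd.comp (fst.comp snd))).cons (snd.comp snd)).cons (snd.comp (snd.comp fst))
  refine (snd.list_casesOn ((const []).cons fst) ((fst.comp fst).list_casesOn (const [])
    ((fst.comp (snd.comp fst)).cond newLiteral ((fst.comp snd).list_casesOn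
      ((fst.comp snd).cons (snd.comp snd)) newDigit)))).of_codeWord_eq fun y => ?_
  rcases y with ⟨_ | ⟨_ | _, _⟩, _ | ⟨_ | _, _⟩⟩ <;> rfl

theorem parse : TreePolyTime KBase.parse := by
  have fold : TreePolyTime (fun w : List (List Bool) => w.foldl KBase.parseStep []) :=
    foldl TreePolyTime.id (const []) (parseStep.comp snd) 20 fun w F s _ => by
      simpa only [Polynomial.eval_ofNat] using codeSize_parseStep_le F s
  have codes : TreePolyTime (fun w : List Sym => w.map symCode) :=
    TreePolyTime.id.of_codeWord_eq fun w => (codeWord_map_symCode w).symm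
  have rev : TreePolyTime (fun w : List Sym => w.reverse) :=
    (TreePolyTime.id.reverseAppend (const [])).of_codeWord_eq fun w => by rw [List.append_nil]
  exact (fold.comp (codes.comp rev)).of_codeWord_eq fun w => by
    rw [List.foldl_map, List.foldl_reverse, KBase.parse]

theorem encodeLiteral : TreePolyTime KBase.encodeLiteral := by
  have bits : TreePolyTime fun x : Literal => (Computability.encodeNat x.1).map Sym.bit :=
    fst.encodeNat.map (f := fun y : Literal × Bool => Sym.bit y.2)
      (((const false).cons (snd.cons (const []))).of_codeWord_eq fun _ => rfl)
  have sign : TreePolyTime fun x : Literal => Sym.sign x.2 :=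
    ((const true).cons (snd.cons (const []))).of_codeWord_eq fun _ => rfl
  exact bits.append (sign.cons (const []))

theorem encodeFormula : TreePolyTime KBase.encodeFormula := by
  have clause : TreePolyTime fun C : List Literal => encodeClause C :=
    (TreePolyTime.id.flatMap (encodeLiteral.comp snd)).append (const [Sym.endClause])
  exact TreePolyTime.id.flatMap (clause.comp snd)

end TreePolyTime

theorem codeSize_listSym_le (w : List Sym) : codeSize w ≤ 10 * w.length + 1 := by
  have := codeSize_le_of_forall_mem (l := w) fun x _ => codeSize_sym_le x
  omega

theorem exists_codeSize_formula_le :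
    ∃ q : Polynomial ℕ, ∀ L : Formula, codeSize L ≤ q.eval (encodeFormula L).length := by
  obtain ⟨q, hq⟩ := TreePolyTime.parse.exists_codeSize_le
  refine ⟨q.comp (10 * Polynomial.X + 1), fun L => ?_⟩
  have digits := hq (encodeFormula L)
  rw [parse_encodeFormula, codeSize, codeWord_toDigits, ← codeSize] at digits
  refine digits.trans ?_
  simpa using monotone_polynomial_eval q (codeSize_listSym_le (encodeFormula L))

theorem TreePolyTime.polyTime {f : Formula → Formula} (hf : TreePolyTime f) : PolyTime f := by
  have write : TreePolyTime fun L => (KBase.encodeFormula (f L)).reverse :=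
    ((encodeFormula.comp hf).reverseAppend (const [])).of_codeWord_eq fun L => by
      rw [List.append_nil]
  have read : TreePolyTime fun w : List Sym => KBase.parse w.reverse :=
    parse.comp ((TreePolyTime.id.reverseAppend (const [])).of_codeWord_eq fun w => by
      rw [List.append_nil])
  obtain ⟨sizeIn, hSizeIn⟩ := exists_codeSize_formula_le
  obtain ⟨sizeOut, hSizeOut⟩ := write.exists_codeSize_le
  obtain ⟨p₁, q₁, h₁⟩ := read
  obtain ⟨p₂, q₂, h₂⟩ := write
  refine StackProg.nonempty_computableInPolyTime
    (.seq TreeProg.readPort (.seq p₁ (.seq p₂ TreeProg.writePort))) StackId.port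
    (20 * Polynomial.X + 2 + (q₁.comp (10 * Polynomial.X + 1) +
      (q₂.comp sizeIn + (22 * sizeOut.comp sizeIn + 2)))) fun L => ?_
  obtain ⟨t₁, ht₁, reads⟩ := TreeProg.runs_readPort (KBase.encodeFormula L)
  obtain ⟨t₂, ht₂, parses⟩ := h₁ (KBase.encodeFormula L).reverse []
  obtain ⟨t₃, ht₃, computes⟩ := h₂ L []
  obtain ⟨t₄, ht₄, writes⟩ := TreeProg.runs_writePort (KBase.encodeFormula (f L)).reverse
  simp only [List.append_nil] at parses computes
  rw [List.reverse_reverse, parse_encodeFormula, codeWord_toDigits] at parses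
  rw [List.reverse_reverse] at writes
  have onPort (u : List Sym) : Function.update (fun _ => []) StackId.port u =
      Store.get { port := u } := by
    funext k
    cases k <;> rfl
  simp only [formulaEncoding, onPort]
  refine ⟨_, ?_, reads.seq (parses.seq (computes.seq writes))⟩
  have parseTime := monotone_polynomial_eval q₁
    (codeSize_listSym_le (KBase.encodeFormula L).reverse)
  have computeTime := monotone_polynomial_eval q₂ (hSizeIn L)
  have writeTime := (length_le_codeSize _).trans
    ((hSizeOut L).trans (monotone_polynomial_eval sizeOut (hSizeIn L)))
  simp only [List.length_reverse, Polynomial.eval_add, Polynomial.eval_mul, Polynomial.eval_X,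
    Polynomial.eval_one, Polynomial.eval_ofNat, Polynomial.eval_comp] at *
  omega

/-! ### A choice-free description of the reductions -/

theorem compl_involutive : Function.Involutive compl := fun x => by simp [compl]

@[simp] theorem compl_compl (x : Literal) : compl (compl x) = x := compl_involutive x

@[simp] theorem compl_inj {x y : Literal} : compl x = compl y ↔ x = y :=
  compl_involutive.injective.eq_iff

theorem compl_ne_self (x : Literal) : compl x ≠ x := fun h => by
  simpa [compl] using congrArg Prod.snd h

/-- The total assignment `v` satisfies the literal `x`. -/
def SatLit (v : ℕ → Bool) (x : Literal) : Prop := v x.1 = x.2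

theorem satLit_compl {v : ℕ → Bool} {x : Literal} : SatLit v (compl x) ↔ ¬ SatLit v x := by
  simp only [SatLit, compl]
  cases v x.1 <;> cases x.2 <;> simp

theorem mem_image_compl {A : Finset Literal} {x : Literal} : x ∈ A.image compl ↔ compl x ∈ A := by
  rw [Finset.mem_image]
  exact ⟨fun ⟨y, hy, e⟩ => e ▸ (compl_compl y).symm ▸ hy, fun h => ⟨_, h, compl_compl x⟩⟩

theorem IsClause.subset {C D : Finset Literal} (h : IsClause D) (hCD : C ⊆ D) : IsClause C :=
  fun x hx hx' => h x (hCD hx) (hCD hx')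

theorem isClause_empty : IsClause ∅ := fun _ h => absurd h (Finset.notMem_empty _)

theorem IsClause.insert {x : Literal} {A : Finset Literal} (hA : IsClause A) (hx : compl x ∉ A) :
    IsClause (insert x A) := by
  intro y hy hc
  rcases Finset.mem_insert.1 hy with rfl | hy
  · exact (Finset.mem_insert.1 hc).elim (compl_ne_self _) hx
  · rcases Finset.mem_insert.1 hc with rfl | hc
    · exact hx (by rwa [compl_compl])
    · exact hA y hy hc

theorem isClause_singleton (x : Literal) : IsClause {x} :=
  isClause_empty.insert (Finset.notMem_empty _)

theorem IsClause.exists_falsifying {A : Finset Literal} (hA : IsClause A) :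
    ∃ v : ℕ → Bool, ∀ x ∈ A, ¬ SatLit v x := by
  refine ⟨fun n => decide ((n, false) ∈ A), fun x hx h => ?_⟩
  rcases x with ⟨n, _ | _⟩
  · simp [SatLit, hx] at h
  · exact hA _ hx (of_decide_eq_true h)

/-- `Refutes F k A`: a splitting tree over `F`, one branch of each node having smaller level, shows
at level `k` that the literals in `A` cannot all be false. This is what `rk k` decides; the clauses
of `F` stay untouched and no literal has to be chosen. -/
inductive Refutes (F : ClauseSet) : ℕ → Finset Literal → Prop
  | clause {k A C} : C ∈ F → C ⊆ A → Refutes F k A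
  | split {k A} (x : Literal) : Refutes F k (insert x A) → Refutes F (k + 1) (insert (compl x) A) →
      Refutes F (k + 1) A

section Refutes

variable {F G : ClauseSet} {k m : ℕ} {A B : Finset Literal}

theorem Refutes.superset (h : Refutes F k A) (hAB : A ⊆ B) : Refutes F k B := by
  induction h generalizing B with
  | clause hC hA => exact .clause hC (hA.trans hAB)
  | split x _ _ ih₁ ih₂ =>
    exact .split x (ih₁ (Finset.insert_subset_insert x hAB))
      (ih₂ (Finset.insert_subset_insert _ hAB))

theorem Refutes.mono_clauses (h : Refutes F k A) (hFG : ∀ C ∈ F, ∃ D ∈ G, D ⊆ C) :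
    Refutes G k A := by
  induction h with
  | clause hC hA =>
    obtain ⟨D, hD, hDC⟩ := hFG _ hC
    exact .clause hD (hDC.trans hA)
  | split x _ _ ih₁ ih₂ => exact .split x ih₁ ih₂

theorem Refutes.succ (h : Refutes F k A) : Refutes F (k + 1) A := by
  induction h with
  | clause hC hA => exact .clause hC hA
  | split x _ _ ih₁ ih₂ => exact .split x ih₁ ih₂

theorem Refutes.mono_level (h : Refutes F k A) (hkm : k ≤ m) : Refutes F m A :=
  Nat.le_induction h (fun _ _ => Refutes.succ) m hkm

theorem Refutes.not_satCNF (h : Refutes F k A) {v : ℕ → Bool} (hv : ∀ x ∈ A, ¬ SatLit v x) :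
    ¬ SatCNF v F := by
  induction h with
  | clause hC hA =>
    intro hs
    obtain ⟨x, hx, hvx⟩ := hs _ hC
    exact hv x (hA hx) hvx
  | split x _ _ ih₁ ih₂ =>
    by_cases hx : SatLit v x
    · exact ih₂ (Finset.forall_mem_insert .. |>.2 ⟨by rwa [satLit_compl, not_not], hv⟩)
    · exact ih₁ (Finset.forall_mem_insert .. |>.2 ⟨hx, hv⟩)

theorem refutes_zero_iff : Refutes F 0 A ↔ ∃ C ∈ F, C ⊆ A :=
  ⟨fun h => by cases h with | clause hC hCA => exact ⟨_, hC, hCA⟩,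
    fun ⟨_, hC, hCA⟩ => .clause hC hCA⟩

end Refutes

section falsify

variable {F G : ClauseSet} {A C D : Finset Literal} {x : Literal}

theorem mem_falsify : D ∈ falsify A F ↔ ∃ C ∈ F, (∀ x ∈ C, compl x ∉ A) ∧ C \ A = D := by
  simp only [falsify, assign, Finset.mem_image (s := F.filter _), Finset.mem_filter, and_assoc,
    Finset.disjoint_left, mem_image_compl, compl_compl, Finset.filter_notMem_eq_sdiff]

theorem mem_setFalse : D ∈ setFalse x G ↔ ∃ C ∈ G, compl x ∉ C ∧ C.erase x = D := by
  simp only [setFalse, assign, Finset.mem_image, Finset.mem_filter, and_assoc,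
    Finset.disjoint_singleton_right, Finset.mem_singleton, compl_inj, Finset.filter_ne']

theorem setTrue_eq (x : Literal) (G : ClauseSet) : setTrue x G = setFalse (compl x) G := by
  rw [setTrue, setFalse, compl_compl]

theorem mem_lits : x ∈ lits G ↔ ∃ C ∈ G, x ∈ C ∨ compl x ∈ C := by
  simp only [lits, Finset.mem_biUnion, Finset.mem_union, mem_image_compl]

theorem notMem_lits : x ∉ lits G ↔ ∀ C ∈ G, x ∉ C ∧ compl x ∉ C := by
  simp only [mem_lits, not_exists, not_and, not_or]

theorem setFalse_falsify (hx : compl x ∉ A) :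
    setFalse x (falsify A F) = falsify (insert x A) F := by
  ext D
  simp only [mem_setFalse, mem_falsify]
  constructor
  · rintro ⟨_, ⟨C, hC, hCA, rfl⟩, hxC, rfl⟩
    refine ⟨C, hC, fun y hy hyA => ?_, Finset.sdiff_insert ..⟩
    rcases Finset.mem_insert.1 hyA with rfl | hyA
    · rw [compl_compl] at hx hxC
      exact hxC (Finset.mem_sdiff.2 ⟨hy, hx⟩)
    · exact hCA y hy hyA
  · rintro ⟨C, hC, hCA, rfl⟩
    refine ⟨C \ A, ⟨C, hC, fun y hy hyA => hCA y hy (Finset.mem_insert_of_mem hyA), rfl⟩,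
      fun hxC => hCA _ (Finset.mem_sdiff.1 hxC).1 ?_, (Finset.sdiff_insert ..).symm⟩
    rw [compl_compl]
    exact Finset.mem_insert_self _ _

theorem notMem_of_mem_lits_falsify (hx : x ∈ lits (falsify A F)) : x ∉ A ∧ compl x ∉ A := by
  obtain ⟨D, hD, hxD⟩ := mem_lits.1 hx
  obtain ⟨C, _, hCA, rfl⟩ := mem_falsify.1 hD
  rcases hxD with hxD | hxD
  · exact ⟨(Finset.mem_sdiff.1 hxD).2, hCA x (Finset.mem_sdiff.1 hxD).1⟩
  · exact ⟨by simpa using hCA _ (Finset.mem_sdiff.1 hxD).1, (Finset.mem_sdiff.1 hxD).2⟩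

theorem setFalse_of_notMem_lits (hx : x ∉ lits G) : setFalse x G = G := by
  have h := notMem_lits.1 hx
  ext D
  rw [mem_setFalse]
  constructor
  · rintro ⟨C, hC, _, rfl⟩
    rwa [Finset.erase_eq_of_notMem (h C hC).1]
  · exact fun hD => ⟨D, hD, (h D hD).2, Finset.erase_eq_of_notMem (h D hD).1⟩

theorem empty_mem_falsify (hA : IsClause A) : ∅ ∈ falsify A F ↔ ∃ C ∈ F, C ⊆ A := by
  rw [mem_falsify]
  refine exists_congr fun C => and_congr_right fun _ => ?_
  rw [Finset.sdiff_eq_empty_iff_subset]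
  exact ⟨fun h => h.2, fun h => ⟨fun x hx => hA x (h hx), h⟩⟩

theorem Refutes.falsify_eq_of_lits_eq_empty {k : ℕ} (hA : IsClause A) (h : Refutes F k A)
    (hl : lits (falsify A F) = ∅) : falsify A F = {∅} := by
  have eq_empty : ∀ C ∈ falsify A F, C = ∅ := fun C hC =>
    Finset.eq_empty_of_forall_notMem fun x hx =>
      Finset.eq_empty_iff_forall_notMem.1 hl x (mem_lits.2 ⟨C, hC, .inl hx⟩)
  refine Finset.eq_singleton_iff_unique_mem.2 ⟨?_, eq_empty⟩
  by_contra hne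
  obtain ⟨v, hv⟩ := hA.exists_falsifying
  refine h.not_satCNF hv fun C hC => ?_
  by_contra hvC
  have hmem : C \ A ∈ falsify A F := by
    refine mem_falsify.2 ⟨C, hC, fun x hx hxA => hvC ⟨x, hx, ?_⟩, rfl⟩
    by_contra hvx
    exact hv _ hxA (satLit_compl.2 hvx)
  exact hne (eq_empty _ hmem ▸ hmem)

end falsify

section rk

variable {F G : ClauseSet} {k : ℕ} {A : Finset Literal}

theorem rk_zero_eq_iff : rk 0 G = {∅} ↔ ∅ ∈ G := by
  rw [rk]
  split_ifs with h
  · simp only [h]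
  · exact ⟨fun e => e ▸ Finset.mem_singleton_self ∅, fun e => absurd e h⟩

theorem exists_rk_succ_eq (h : ∃ x ∈ lits G, rk k (setFalse x G) = {∅}) :
    ∃ x ∈ lits G, rk k (setFalse x G) = {∅} ∧ rk (k + 1) G = rk (k + 1) (setTrue x G) :=
  ⟨h.choose, h.choose_spec.1, h.choose_spec.2, by
    rw [rk, propagate, dif_pos h, rk]⟩

theorem rk_succ_of_forall_ne (h : ∀ x ∈ lits G, rk k (setFalse x G) ≠ {∅}) : rk (k + 1) G = G := by
  rw [rk, propagate, dif_neg]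
  simpa only [not_exists, not_and] using h

-- If no literal can be propagated, then only the second branches of a splitting tree matter.
theorem Refutes.of_succ (ih : ∀ B, IsClause B → (rk k (falsify B F) = {∅} ↔ Refutes F k B))
    (hA : IsClause A) (hno : ∀ x ∈ lits (falsify A F), ¬ Refutes F k (insert x A))
    (h : Refutes F (k + 1) A) : Refutes F k A := by
  generalize hj : k + 1 = j at h
  induction h with
  | clause hC hCA => exact .clause hC hCA
  | @split i B x h₁ _ _ ih₂ =>
    obtain rfl : k = i := Nat.succ_injective hj
    by_cases hx : x ∈ B
    · rwa [Finset.insert_eq_of_mem hx] at h₁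
    by_cases hx' : compl x ∈ B
    · rw [Finset.insert_eq_of_mem hx'] at ih₂
      exact ih₂ hA hno rfl
    have hxl : x ∉ lits (falsify B F) := fun hxl => hno x hxl h₁
    rwa [← ih _ (hA.insert hx'), ← setFalse_falsify hx', setFalse_of_notMem_lits hxl, ih _ hA] at h₁

theorem rk_succ_falsify_eq_iff
    (ih : ∀ B, IsClause B → (rk k (falsify B F) = {∅} ↔ Refutes F k B)) (hA : IsClause A) :
    rk (k + 1) (falsify A F) = {∅} ↔ Refutes F (k + 1) A := by
  generalize hn : (vars (falsify A F)).card = n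
  induction n using Nat.strong_induction_on generalizing A with
  | _ n ihn =>
  by_cases h : ∃ x ∈ lits (falsify A F), rk k (setFalse x (falsify A F)) = {∅}
  · obtain ⟨x, hx, hrk, hsucc⟩ := exists_rk_succ_eq h
    obtain ⟨hxA, hxA'⟩ := notMem_of_mem_lits_falsify hx
    have hcxA : compl (compl x) ∉ A := by rwa [compl_compl]
    have hlt := vars_setTrue_card_lt hx
    rw [setTrue_eq, setFalse_falsify hcxA] at hlt hsucc
    rw [setFalse_falsify hxA', ih _ (hA.insert hxA')] at hrk
    rw [hsucc, ihn _ (hn ▸ hlt) (hA.insert hcxA) rfl]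
    exact ⟨fun hr => .split x hrk hr, fun hr => hr.superset (Finset.subset_insert _ _)⟩
  · push Not at h
    have hno : ∀ x ∈ lits (falsify A F), ¬ Refutes F k (insert x A) := fun x hx hr => by
      obtain ⟨_, hxA'⟩ := notMem_of_mem_lits_falsify hx
      exact h x hx (by rwa [setFalse_falsify hxA', ih _ (hA.insert hxA')])
    rw [rk_succ_of_forall_ne h]
    constructor
    · intro e
      obtain ⟨C, hC, hCA⟩ := (empty_mem_falsify hA).1 (e ▸ Finset.mem_singleton_self ∅)
      exact .clause hC hCA
    · intro hr
      refine hr.falsify_eq_of_lits_eq_empty hA (Finset.eq_empty_of_forall_notMem fun x hx => ?_)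
      exact hno x hx ((hr.of_succ ih hA hno).superset (Finset.subset_insert _ _))

theorem impliesK_iff_refutes (hA : IsClause A) : ImpliesK k F A ↔ Refutes F k A := by
  rw [ImpliesK]
  induction k generalizing A with
  | zero => rw [rk_zero_eq_iff, empty_mem_falsify hA, refutes_zero_iff]
  | succ k ih => exact rk_succ_falsify_eq_iff (fun B hB => ih hB) hA

theorem hardness_le_iff :
    hardness F ≤ k ↔ ∀ C, IsClause C → Implies F C → Refutes F k C := by
  refine ⟨fun h C hC hF => ?_,
    fun h => sInf_le ⟨k, rfl, fun C hC hF => (impliesK_iff_refutes hC).2 (h C hC hF)⟩⟩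
  have nonempty : {m : ℕ∞ | ∃ k : ℕ, m = k ∧
      ∀ C, IsClause C → Implies F C → ImpliesK k F C}.Nonempty := by
    by_contra hne
    rw [Set.not_nonempty_iff_eq_empty] at hne
    rw [hardness, hne, sInf_empty] at h
    exact absurd h (by simp)
  obtain ⟨j, hj, hr⟩ := csInf_mem nonempty
  rw [hardness, hj] at h
  exact ((impliesK_iff_refutes hC).1 (hr C hC hF)).mono_level (by exact_mod_cast h)

theorem hardness_le_zero_iff :
    hardness G ≤ 0 ↔ ∀ C, IsClause C → Implies G C → ∃ D ∈ G, D ⊆ C := by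
  rw [← Nat.cast_zero, hardness_le_iff]
  simp only [refutes_zero_iff]

theorem hardness_le_of_forall_nat (h : ∀ n : ℕ, hardness G ≤ n → hardness F ≤ n) {k : ℕ∞}
    (hk : hardness G ≤ k) : hardness F ≤ k := by
  induction k using ENat.recTopCoe with
  | top => exact le_top
  | coe n => exact h n hk

end rk

/-! ### `k`-bases and prime implicates -/

section PrimeImplicates

variable {F G H : ClauseSet} {C D : Finset Literal} {v : ℕ → Bool} {x : Literal} {k : ℕ∞}

theorem Equivalent.symm (h : Equivalent F G) : Equivalent G F := fun v => (h v).symm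

theorem Equivalent.trans (h : Equivalent F G) (h' : Equivalent G H) : Equivalent F H :=
  fun v => (h v).trans (h' v)

theorem Equivalent.implies_iff (h : Equivalent F G) : Implies F C ↔ Implies G C :=
  forall_congr' fun v => by rw [h v]

theorem Equivalent.satisfiable (h : Equivalent F G) (hF : Satisfiable F) : Satisfiable G :=
  hF.imp fun v => (h v).1

theorem Equivalent.isPrimeImplicate_iff (h : Equivalent F G) :
    IsPrimeImplicate F C ↔ IsPrimeImplicate G C := by
  simp only [IsPrimeImplicate, h.implies_iff]

theorem SatClause.mono (h : SatClause v C) (hCD : C ⊆ D) : SatClause v D :=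
  let ⟨x, hx, hv⟩ := h
  ⟨x, hCD hx, hv⟩

theorem Implies.mono (h : Implies F C) (hCD : C ⊆ D) : Implies F D :=
  fun v hv => (h v hv).mono hCD

theorem implies_of_mem (h : C ∈ F) : Implies F C := fun _ hv => hv C h

theorem exists_primeImplicate_subset (hC : IsClause C) (h : Implies F C) :
    ∃ D ⊆ C, IsPrimeImplicate F D := by
  induction C using Finset.strongInduction with
  | H C ih =>
  by_cases hp : ∀ D, D ⊂ C → ¬ Implies F D
  · exact ⟨C, subset_rfl, hC, h, hp⟩
  · push Not at hp
    obtain ⟨D, hD, hF⟩ := hp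
    obtain ⟨E, hE, hE'⟩ := ih D hD (hC.subset hD.subset) hF
    exact ⟨E, hE.trans hD.subset, hE'⟩

theorem equivalent_insert_erase (hDC : D ⊆ C) (hD : Implies G D) :
    Equivalent (insert D (G.erase C)) G := by
  refine fun v => ⟨fun hv E hE => ?_, fun hv E hE => ?_⟩
  · by_cases hEC : E = C
    · exact hEC ▸ (hv D (Finset.mem_insert_self _ _)).mono hDC
    · exact hv E (Finset.mem_insert_of_mem (Finset.mem_erase.2 ⟨hEC, hE⟩))
  · rcases Finset.mem_insert.1 hE with rfl | hE
    · exact hD v hv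
    · exact hv E (Finset.mem_of_mem_erase hE)

theorem hardness_insert_erase_le (hDC : D ⊆ C) (hD : Implies G D) (hk : hardness G ≤ k) :
    hardness (insert D (G.erase C)) ≤ k := by
  refine hardness_le_of_forall_nat (fun n hn => ?_) hk
  rw [hardness_le_iff] at hn ⊢
  intro E hE hGE
  refine (hn E hE ((equivalent_insert_erase hDC hD).implies_iff.1 hGE)).mono_clauses fun A hA => ?_
  by_cases hAC : A = C
  · exact ⟨D, Finset.mem_insert_self _ _, hAC ▸ hDC⟩
  · exact ⟨A, Finset.mem_insert_of_mem (Finset.mem_erase.2 ⟨hAC, hA⟩), subset_rfl⟩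

theorem IsEquivKBase.isPrimeImplicate (h : IsEquivKBase k F G) (hC : C ∈ G) :
    IsPrimeImplicate F C := by
  obtain ⟨⟨hG, hk, hr⟩, he⟩ := h
  rw [← he.isPrimeImplicate_iff]
  refine ⟨hG C hC, implies_of_mem hC, fun D hD hGD => ?_⟩
  obtain ⟨x, hx, hxD⟩ := Finset.exists_of_ssubset hD
  have hGx : Implies G (C.erase x) := hGD.mono (Finset.subset_erase.2 ⟨hD.subset, hxD⟩)
  rcases hr _ (.inr ⟨C, hC, x, hx, rfl⟩) with h | h
  · exact h (equivalent_insert_erase (Finset.erase_subset x C) hGx)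
  · exact h.not_ge (hardness_insert_erase_le (Finset.erase_subset x C) hGx hk)

theorem IsEquivKBase.isEquivPrimeSubset (h : IsEquivKBase k F G) : IsEquivPrimeSubset F G :=
  ⟨fun _ hC => h.isPrimeImplicate hC, h.2⟩

theorem IsPrimeImplicate.not_equivalent_insert_erase (hC : IsPrimeImplicate F C)
    (he : Equivalent G F) (hx : x ∈ C) : ¬ Equivalent (insert (C.erase x) (G.erase C)) G :=
  fun h => hC.2.2 _ (Finset.erase_ssubset hx)
    ((h.trans he).implies_iff.1 (implies_of_mem (Finset.mem_insert_self _ _)))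

theorem IsEquivKBase.mem_iff_isPrimeImplicate (h : IsEquivKBase 0 F G) :
    C ∈ G ↔ IsPrimeImplicate F C := by
  refine ⟨fun hC => h.isPrimeImplicate hC, fun hC => ?_⟩
  obtain ⟨D, hD, hDC⟩ := hardness_le_zero_iff.1 h.1.2.1 C hC.1 (h.2.implies_iff.2 hC.2.1)
  rcases hDC.eq_or_ssubset with rfl | hDC
  · exact hD
  · exact absurd (h.2.implies_iff.1 (implies_of_mem hD)) (hC.2.2 D hDC)

theorem equivalent_of_forall_mem_iff (hF : IsClauseSet F) (h : ∀ C, C ∈ G ↔ IsPrimeImplicate F C) :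
    Equivalent G F := by
  refine fun v => ⟨fun hv C hC => ?_, fun hv C hC => ((h C).1 hC).2.1 v hv⟩
  obtain ⟨D, hDC, hD⟩ := exists_primeImplicate_subset (hF C hC) (implies_of_mem hC)
  exact (hv D ((h D).2 hD)).mono hDC

theorem isEquivKBase_zero_of_forall_mem_iff (hF : IsClauseSet F)
    (h : ∀ C, C ∈ G ↔ IsPrimeImplicate F C) : IsEquivKBase 0 F G := by
  have he : Equivalent G F := equivalent_of_forall_mem_iff hF h
  refine ⟨⟨fun C hC => ((h C).1 hC).1, hardness_le_zero_iff.2 fun C hC hGC => ?_, ?_⟩, he⟩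
  · obtain ⟨D, hDC, hD⟩ := exists_primeImplicate_subset hC (he.implies_iff.1 hGC)
    exact ⟨D, (h D).2 hD, hDC⟩
  · rintro H (⟨C, hC, rfl⟩ | ⟨C, hC, x, hx, rfl⟩)
    · rw [← not_le, or_iff_not_imp_left, not_not]
      intro he' hk
      have hp := (h C).1 hC
      obtain ⟨D, hD, hDC⟩ := hardness_le_zero_iff.1 hk C hp.1 ((he'.trans he).implies_iff.2 hp.2.1)
      obtain ⟨hne, hDG⟩ := Finset.mem_erase.1 hD
      exact hp.2.2 D (hDC.ssubset_of_ne hne) ((h D).1 hDG).2.1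
    · exact .inl (((h C).1 hC).not_equivalent_insert_erase he hx)

theorem isEquivKBase_zero_iff (hF : IsClauseSet F) :
    IsEquivKBase 0 F G ↔ ∀ C, C ∈ G ↔ IsPrimeImplicate F C :=
  ⟨fun h _ => h.mem_iff_isPrimeImplicate, isEquivKBase_zero_of_forall_mem_iff hF⟩

end PrimeImplicates

/-! ### Forced literals -/

section UnitClauses

variable {F G H : ClauseSet} {A C D : Finset Literal} {v : ℕ → Bool} {x y : Literal} {k : ℕ∞}

/-- The total assignment `v`, changed so that it satisfies the literal `x`. -/
def makeTrue (x : Literal) (v : ℕ → Bool) : ℕ → Bool := Function.update v x.1 x.2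

theorem satLit_makeTrue_self (x : Literal) (v : ℕ → Bool) : SatLit (makeTrue x v) x :=
  Function.update_self ..

theorem SatLit.makeTrue_eq (h : SatLit v x) : makeTrue x v = v := by
  rw [makeTrue, ← (show v x.1 = x.2 from h), Function.update_eq_self]

theorem makeTrue_compl_makeTrue (x : Literal) (v : ℕ → Bool) :
    makeTrue x (makeTrue (compl x) v) = makeTrue x v := Function.update_idem ..

theorem eq_or_eq_compl (h : y.1 = x.1) : y = x ∨ y = compl x := by
  rcases eq_or_ne y.2 x.2 with h' | h'
  · exact .inl (Prod.ext h h')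
  · exact .inr (Prod.ext h (Bool.eq_not_of_ne h'))

theorem satLit_makeTrue : SatLit (makeTrue x v) y ↔ y = x ∨ y ≠ compl x ∧ SatLit v y := by
  by_cases h : y.1 = x.1
  · rcases eq_or_eq_compl h with rfl | rfl
    · simp only [satLit_makeTrue_self, true_or]
    · simp only [satLit_compl, satLit_makeTrue_self, compl_ne_self, not_true, ne_eq, false_and,
        or_false]
  · have hne : y ≠ x := fun e => h (congrArg Prod.fst e)
    have hne' : y ≠ compl x := fun e => h (e ▸ rfl)
    simp only [SatLit, makeTrue, Function.update_of_ne h, hne, false_or, ne_eq, hne',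
      not_false_eq_true, true_and]

theorem satClause_makeTrue :
    SatClause (makeTrue x v) C ↔ x ∈ C ∨ SatClause v (C.erase (compl x)) := by
  have h (y : Literal) : makeTrue x v y.1 = y.2 ↔ y = x ∨ y ≠ compl x ∧ v y.1 = y.2 :=
    satLit_makeTrue
  simp only [SatClause, h, Finset.mem_erase]
  constructor
  · rintro ⟨y, hy, rfl | ⟨hne, hvy⟩⟩
    · exact .inl hy
    · exact .inr ⟨y, ⟨hne, hy⟩, hvy⟩
  · rintro (hx | ⟨y, ⟨hne, hy⟩, hvy⟩)
    · exact ⟨x, hx, .inl rfl⟩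
    · exact ⟨y, hy, .inr ⟨hne, hvy⟩⟩

theorem satCNF_setTrue : SatCNF v (setTrue x F) ↔ SatCNF (makeTrue x v) F := by
  simp only [SatCNF, satClause_makeTrue, setTrue_eq, mem_setFalse, compl_compl, forall_exists_index,
    and_imp, or_iff_not_imp_left]
  exact ⟨fun h C hC hx => h _ C hC hx rfl, by rintro h _ C hC hx rfl; exact h C hC hx⟩

theorem compl_mem_lits : compl x ∈ lits G ↔ x ∈ lits G := by
  simp only [mem_lits, compl_compl, or_comm]

theorem satCNF_makeTrue (hx : x ∉ lits G) : SatCNF (makeTrue x v) G ↔ SatCNF v G :=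
  forall₂_congr fun C hC => by
    obtain ⟨hxC, hxC'⟩ := notMem_lits.1 hx C hC
    rw [satClause_makeTrue, Finset.erase_eq_of_notMem hxC', or_iff_right hxC]

theorem satCNF_makeTrue_compl (hx : x ∉ lits G) : SatCNF (makeTrue (compl x) v) G ↔ SatCNF v G :=
  satCNF_makeTrue (compl_mem_lits.not.2 hx)

theorem satCNF_insert_unit : SatCNF v (insert {x} G) ↔ SatLit v x ∧ SatCNF v G := by
  simp only [SatCNF, Finset.forall_mem_insert, SatClause, Finset.mem_singleton, SatLit,
    exists_eq_left]

theorem satCNF_makeTrue_insert_unit (hx : x ∉ lits G) :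
    SatCNF (makeTrue x v) (insert {x} G) ↔ SatCNF v G := by
  rw [satCNF_insert_unit, satCNF_makeTrue hx, and_iff_right (satLit_makeTrue_self x v)]

theorem equivalent_insert_unit_iff (hG : x ∉ lits G) (hH : x ∉ lits H) :
    Equivalent (insert {x} G) (insert {x} H) ↔ Equivalent G H := by
  refine ⟨fun h v => ?_, fun h v => ?_⟩
  · rw [← satCNF_makeTrue_insert_unit hG, h, satCNF_makeTrue_insert_unit hH]
  · rw [satCNF_insert_unit, satCNF_insert_unit, h]

theorem Refutes.of_insert_unit (hG : x ∉ lits G) {n : ℕ} (h : Refutes (insert {x} G) n A)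
    (hx : x ∉ A) : Refutes G n (A.erase (compl x)) := by
  induction h with
  | clause hC hCA =>
    rcases Finset.mem_insert.1 hC with rfl | hC
    · exact absurd (hCA (Finset.mem_singleton_self x)) hx
    · exact .clause hC (Finset.subset_erase.2 ⟨hCA, (notMem_lits.1 hG _ hC).2⟩)
  | @split n A y _ _ ih₁ ih₂ =>
    have notMem {z : Literal} (hz : z ≠ x) : x ∉ insert z A := by
      rw [Finset.mem_insert, not_or]
      exact ⟨hz.symm, hx⟩
    by_cases hyx : y = x
    · subst hyx
      rw [← Finset.erase_insert_eq_erase]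
      exact ih₂ (notMem (compl_ne_self y))
    by_cases hyx' : y = compl x
    · subst hyx'
      rw [← Finset.erase_insert_eq_erase]
      exact (ih₁ (notMem hyx)).succ
    have h₁ := ih₁ (notMem hyx)
    have h₂ := ih₂ (notMem fun e => hyx' (e ▸ (compl_compl y).symm))
    rw [Finset.erase_insert_of_ne hyx'] at h₁
    rw [Finset.erase_insert_of_ne (compl_inj.not.2 hyx)] at h₂
    exact .split y h₁ h₂

theorem Implies.erase_of_insert_unit (hG : x ∉ lits G) (hC : IsClause C) (h : Implies G C) :
    Implies (insert {x} G) (C.erase x) := by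
  intro v hv
  obtain ⟨_, hvG⟩ := satCNF_insert_unit.1 hv
  by_cases hx : x ∈ C
  · have := satClause_makeTrue.1 (h _ ((satCNF_makeTrue_compl hG).2 hvG))
    rw [compl_compl] at this
    exact this.resolve_left (hC x hx)
  · rw [Finset.erase_eq_of_notMem hx]
    exact h v hvG

theorem Implies.erase_compl_of_insert_unit (hG : x ∉ lits G) (h : Implies (insert {x} G) C)
    (hx : x ∉ C) : Implies G (C.erase (compl x)) := fun _ hv =>
  (satClause_makeTrue.1 (h _ ((satCNF_makeTrue_insert_unit hG).2 hv))).resolve_left hx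

theorem hardness_insert_unit_le_iff (hG : x ∉ lits G) :
    hardness (insert {x} G) ≤ k ↔ hardness G ≤ k := by
  refine ⟨hardness_le_of_forall_nat fun n hn => ?_, hardness_le_of_forall_nat fun n hn => ?_⟩
  all_goals
    rw [hardness_le_iff] at hn ⊢
    intro C hC hGC
  · have himp := hGC.erase_of_insert_unit hG hC
    exact ((hn _ (hC.subset (Finset.erase_subset ..)) himp).of_insert_unit hG
      (Finset.notMem_erase _ _)).superset ((Finset.erase_subset ..).trans (Finset.erase_subset ..))
  · by_cases hx : x ∈ C
    · exact .clause (Finset.mem_insert_self ..) (Finset.singleton_subset_iff.2 hx)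
    · have himp := hGC.erase_compl_of_insert_unit hG hx
      exact ((hn _ (hC.subset (Finset.erase_subset ..)) himp).superset
        (Finset.erase_subset ..)).mono_clauses fun D hD =>
          ⟨D, Finset.mem_insert_of_mem hD, subset_rfl⟩

theorem IsRemoval.notMem_lits (h : IsRemoval G H) (hG : x ∉ lits G) : x ∉ lits H := by
  rw [KBase.notMem_lits] at hG ⊢
  rcases h with ⟨C, -, rfl⟩ | ⟨C, hC, y, -, rfl⟩
  · exact fun D hD => hG D (Finset.mem_of_mem_erase hD)
  · refine Finset.forall_mem_insert .. |>.2 ⟨?_, fun D hD => hG D (Finset.mem_of_mem_erase hD)⟩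
    exact (hG C hC).imp (mt Finset.mem_of_mem_erase) (mt Finset.mem_of_mem_erase)

theorem unit_notMem (hG : x ∉ lits G) : {x} ∉ G :=
  fun h => (notMem_lits.1 hG _ h).1 (Finset.mem_singleton_self x)

theorem erase_insert_unit (hG : x ∉ lits G) (hC : C ∈ G) :
    (insert {x} G : ClauseSet).erase C = insert {x} (G.erase C) :=
  Finset.erase_insert_of_ne fun e => unit_notMem hG (e ▸ hC)

theorem IsRemoval.insert_unit (h : IsRemoval G H) (hG : x ∉ lits G) :
    IsRemoval (insert {x} G) (insert {x} H) := by
  rcases h with ⟨C, hC, rfl⟩ | ⟨C, hC, y, hy, rfl⟩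
  · exact .inl ⟨C, Finset.mem_insert_of_mem hC, (erase_insert_unit hG hC).symm⟩
  · exact .inr ⟨C, Finset.mem_insert_of_mem hC, y, hy, by
      rw [erase_insert_unit hG hC, Finset.insert_comm]⟩

theorem IsRemoval.of_insert_unit (h : IsRemoval (insert {x} G) H) (hG : x ∉ lits G) :
    H = G ∨ H = insert ∅ G ∨ ∃ H', IsRemoval G H' ∧ H = insert {x} H' := by
  have hx : (insert {x} G : ClauseSet).erase {x} = G := Finset.erase_insert (unit_notMem hG)
  rcases h with ⟨C, hC, rfl⟩ | ⟨C, hC, y, hy, rfl⟩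
  · rcases Finset.mem_insert.1 hC with rfl | hC
    · exact .inl hx
    · exact .inr (.inr ⟨_, .inl ⟨C, hC, rfl⟩, erase_insert_unit hG hC⟩)
  · rcases Finset.mem_insert.1 hC with rfl | hC
    · rw [Finset.mem_singleton] at hy
      rw [hx, hy, Finset.erase_singleton]
      exact .inr (.inl rfl)
    · exact .inr (.inr ⟨_, .inr ⟨C, hC, y, hy, rfl⟩, by
        rw [erase_insert_unit hG hC, Finset.insert_comm]⟩)

theorem not_satCNF_of_empty_mem (h : ∅ ∈ G) : ¬ SatCNF v G := fun hv =>
  let ⟨_, hx, _⟩ := hv ∅ h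
  Finset.notMem_empty _ hx

theorem isKBase_insert_unit_iff (hG : x ∉ lits G) (hs : Satisfiable G) :
    IsKBase k (insert {x} G) ↔ IsKBase k G := by
  obtain ⟨v, hv⟩ := hs
  have isClauseSet_iff : IsClauseSet (insert {x} G) ↔ IsClauseSet G := by
    rw [IsClauseSet, Finset.forall_mem_insert, and_iff_right (isClause_singleton x), IsClauseSet]
  have removal_iff (H : ClauseSet) (hH : IsRemoval G H) :
      (¬ Equivalent (insert {x} H) (insert {x} G) ∨ k < hardness (insert {x} H)) ↔
        (¬ Equivalent H G ∨ k < hardness H) := by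
    have hxH := hH.notMem_lits hG
    rw [equivalent_insert_unit_iff hxH hG, ← not_le, ← not_le, hardness_insert_unit_le_iff hxH]
  rw [IsKBase, IsKBase, isClauseSet_iff, hardness_insert_unit_le_iff hG]
  refine and_congr_right fun _ => and_congr_right fun _ => ⟨fun h H hH => ?_, fun h H hH => ?_⟩
  · exact (removal_iff H hH).1 (h _ (hH.insert_unit hG))
  · rcases hH.of_insert_unit hG with rfl | rfl | ⟨H', hH', rfl⟩
    · refine .inl fun he => ?_
      have hvx := (satCNF_insert_unit.1 ((he _).1 ((satCNF_makeTrue_compl hG).2 hv))).1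
      exact satLit_compl.1 (satLit_makeTrue_self (compl x) v) hvx
    · exact .inl fun he => not_satCNF_of_empty_mem (Finset.mem_insert_self ..)
        ((he _).2 ((satCNF_makeTrue_insert_unit hG).2 hv))
    · exact (removal_iff H' hH').2 (h H' hH')

theorem IsPrimeImplicate.notMem_of_indep (hD : IsPrimeImplicate F D)
    (hF : ∀ v, SatCNF v F → SatCNF (makeTrue (compl x) v) F) : x ∉ D := by
  intro hx
  refine hD.2.2 _ (Finset.erase_ssubset hx) fun v hv => ?_
  have h := satClause_makeTrue.1 (hD.2.1 _ (hF v hv))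
  rw [compl_compl] at h
  exact h.resolve_left (hD.1 x hx)

theorem Forced.satLit (hx : Forced F x) (hv : SatCNF v F) : SatLit v x := by
  obtain ⟨y, hy, hvy⟩ := hx v hv
  rwa [Finset.mem_singleton.1 hy] at hvy

theorem Forced.isPrimeImplicate (hx : Forced F x) (hs : Satisfiable F) :
    IsPrimeImplicate F {x} := by
  refine ⟨isClause_singleton x, hx, fun D hD hF => ?_⟩
  obtain ⟨v, hv⟩ := hs
  obtain ⟨y, hy, _⟩ := hF v hv
  rw [Finset.ssubset_singleton_iff.1 hD] at hy
  exact Finset.notMem_empty y hy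

theorem IsPrimeImplicate.eq_of_forced (hD : IsPrimeImplicate F D) (hx : Forced F x) (hxD : x ∈ D) :
    D = {x} := by
  by_contra hne
  exact hD.2.2 {x} ((Finset.singleton_subset_iff.2 hxD).ssubset_of_ne (Ne.symm hne)) hx

theorem IsPrimeImplicate.compl_notMem_of_forced (hD : IsPrimeImplicate F D) (hx : Forced F x) :
    compl x ∉ D := by
  intro hxD
  refine hD.2.2 _ (Finset.erase_ssubset hxD) fun v hv => ?_
  obtain ⟨y, hy, hvy⟩ := hD.2.1 v hv
  refine ⟨y, Finset.mem_erase.2 ⟨?_, hy⟩, hvy⟩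
  rintro rfl
  exact satLit_compl.1 hvy (hx.satLit hv)

theorem IsEquivPrimeSubset.notMem_lits_erase (hG : IsEquivPrimeSubset F G) (hx : Forced F x) :
    x ∉ lits (G.erase {x}) := by
  refine notMem_lits.2 fun C hC => ?_
  obtain ⟨hne, hC⟩ := Finset.mem_erase.1 hC
  exact ⟨fun h => hne ((hG.1 C hC).eq_of_forced hx h), (hG.1 C hC).compl_notMem_of_forced hx⟩

theorem IsEquivPrimeSubset.unit_mem_of_forced (hG : IsEquivPrimeSubset F G)
    (hs : Satisfiable F) (hx : Forced F x) : {x} ∈ G := by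
  by_contra hne
  have hxG := hG.notMem_lits_erase hx
  rw [Finset.erase_eq_of_notMem hne] at hxG
  obtain ⟨v, hv⟩ := hs
  have hvF := (hG.2 _).1 ((satCNF_makeTrue_compl hxG).2 ((hG.2 v).2 hv))
  exact satLit_compl.1 (satLit_makeTrue_self (compl x) v) (hx.satLit hvF)

theorem Forced.equivalent_insert_unit_iff (hx : Forced F x) (hG : x ∉ lits G) :
    Equivalent (insert {x} G) F ↔ Equivalent G (setTrue x F) := by
  refine ⟨fun h v => ?_, fun h v => ?_⟩
  · rw [satCNF_setTrue, ← h, satCNF_makeTrue_insert_unit hG]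
  · rw [satCNF_insert_unit, h, satCNF_setTrue]
    refine ⟨fun ⟨hvx, hv⟩ => hvx.makeTrue_eq ▸ hv, fun hv => ?_⟩
    have hvx := hx.satLit hv
    exact ⟨hvx, by rwa [hvx.makeTrue_eq]⟩

theorem Forced.isEquivKBase_insert_unit_iff (hx : Forced F x) (hs : Satisfiable F)
    (hG : x ∉ lits G) : IsEquivKBase k F (insert {x} G) ↔ IsEquivKBase k (setTrue x F) G := by
  rw [IsEquivKBase, IsEquivKBase, hx.equivalent_insert_unit_iff hG]
  refine and_congr_left fun h => isKBase_insert_unit_iff hG ?_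
  obtain ⟨v, hv⟩ := hs
  refine ⟨v, (h v).2 ?_⟩
  rwa [satCNF_setTrue, (hx.satLit hv).makeTrue_eq]

theorem IsEquivKBase.notMem_lits (h : IsEquivKBase k (setTrue x F) G) : x ∉ lits G := by
  refine KBase.notMem_lits.2 fun C hC =>
    ⟨(h.isPrimeImplicate hC).notMem_of_indep fun v hv => ?_,
      (h.isPrimeImplicate hC).notMem_of_indep fun v hv => ?_⟩
  all_goals rw [satCNF_setTrue] at hv ⊢
  · rwa [makeTrue_compl_makeTrue]
  · rwa [compl_compl, (satLit_makeTrue_self x v).makeTrue_eq]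

theorem Forced.isShortestKBase_insert_unit (hx : Forced F x) (hs : Satisfiable F)
    {μ : ClauseSet → ℕ} (hμ : ∀ G, {x} ∉ G → μ (insert {x} G) = μ G + 1)
    (h : IsShortestKBase μ k (setTrue x F) G) : IsShortestKBase μ k F (insert {x} G) := by
  have hG : x ∉ lits G := h.1.notMem_lits
  refine ⟨(hx.isEquivKBase_insert_unit_iff hs hG).2 h.1, fun H hH => ?_⟩
  have hxH := hH.isEquivPrimeSubset.notMem_lits_erase hx
  obtain ⟨H', hH', rfl⟩ : ∃ H', x ∉ lits H' ∧ H = insert {x} H' :=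
    ⟨_, hxH, (Finset.insert_erase (hH.isEquivPrimeSubset.unit_mem_of_forced hs hx)).symm⟩
  rw [hμ _ (unit_notMem hG), hμ _ (unit_notMem hH')]
  exact Nat.succ_le_succ (h.2 _ ((hx.isEquivKBase_insert_unit_iff hs hH').1 hH))

theorem numClauses_insert_unit (h : {x} ∉ G) : numClauses (insert {x} G) = numClauses G + 1 :=
  Finset.card_insert_of_notMem h

theorem numLitOcc_insert_unit (h : {x} ∉ G) : numLitOcc (insert {x} G) = numLitOcc G + 1 := by
  rw [numLitOcc, Finset.sum_insert h, Finset.card_singleton, add_comm, numLitOcc]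

end UnitClauses

section Degenerate

variable {F : ClauseSet} {v : ℕ → Bool}

theorem satCNF_empty (v : ℕ → Bool) : SatCNF v ∅ := fun C hC => absurd hC (Finset.notMem_empty C)

theorem not_satCNF_singleton_empty : ¬ SatCNF v {∅} :=
  not_satCNF_of_empty_mem (Finset.mem_singleton_self ∅)

theorem isKBase_singleton_empty (k : ℕ∞) : IsKBase k {∅} := by
  refine ⟨fun C hC => ?_, ?_, ?_⟩
  · rw [Finset.mem_singleton.1 hC]
    exact isClause_empty
  · exact (hardness_le_zero_iff.2 fun C _ _ =>
      ⟨∅, Finset.mem_singleton_self _, Finset.empty_subset _⟩).trans zero_le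
  · rintro G (⟨C, hC, rfl⟩ | ⟨C, hC, x, hx, rfl⟩)
    · rw [Finset.mem_singleton.1 hC, Finset.erase_singleton]
      exact .inl fun h => not_satCNF_singleton_empty ((h fun _ => true).1 (satCNF_empty _))
    · rw [Finset.mem_singleton.1 hC] at hx
      exact absurd hx (Finset.notMem_empty x)

theorem isShortestKBase_of_unsatisfiable (hF : ¬ Satisfiable F) (k : ℕ∞) :
    IsShortestKBase numClauses k F {∅} ∧ IsShortestKBase numLitOcc k F {∅} := by
  have hb : IsEquivKBase k F {∅} := ⟨isKBase_singleton_empty k,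
    fun v => iff_of_false not_satCNF_singleton_empty fun h => hF ⟨v, h⟩⟩
  refine ⟨⟨hb, fun H hH => ?_⟩, ⟨hb, fun H _ => ?_⟩⟩
  · rw [numClauses, Finset.card_singleton, numClauses, Nat.one_le_iff_ne_zero, Finset.card_ne_zero,
      Finset.nonempty_iff_ne_empty]
    rintro rfl
    exact hF (hH.2.satisfiable ⟨fun _ => true, satCNF_empty _⟩)
  · rw [numLitOcc, Finset.sum_singleton, Finset.card_empty]
    exact Nat.zero_le _

theorem isKBase_empty (k : ℕ∞) : IsKBase k ∅ := by
  refine ⟨fun C hC => absurd hC (Finset.notMem_empty C), ?_, ?_⟩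
  · refine (hardness_le_zero_iff.2 fun C hC h => ?_).trans zero_le
    obtain ⟨v, hv⟩ := hC.exists_falsifying
    obtain ⟨x, hx, hvx⟩ := h v (satCNF_empty v)
    exact absurd hvx (hv x hx)
  · rintro G (⟨C, hC, rfl⟩ | ⟨C, hC, -, -, rfl⟩) <;> exact absurd hC (Finset.notMem_empty C)

theorem isShortestKBase_empty (k : ℕ∞) :
    IsShortestKBase numClauses k ∅ ∅ ∧ IsShortestKBase numLitOcc k ∅ ∅ := by
  have hb : IsEquivKBase k ∅ ∅ := ⟨isKBase_empty k, fun v => Iff.rfl⟩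
  exact ⟨⟨hb, fun H _ => Nat.zero_le _⟩, ⟨hb, fun H _ => Nat.zero_le _⟩⟩

end Degenerate

/-! ### The implication digraph of a 2-CNF -/

section ImplicationDigraph

/-- The arc `p → q` of the implication digraph of `F`: the clause `{¬p, q}` is in `F`. A unit clause
`{q}` is the arc `¬q → q`. -/
def Arc (F : ClauseSet) (p q : Literal) : Prop := {compl p, q} ∈ F

/-- Reachability in the implication digraph of `F`. -/
def Reach (F : ClauseSet) : Literal → Literal → Prop := Relation.ReflTransGen (Arc F)

/-- No cycle of the implication digraph of `F` passes through a literal and its complement. -/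
def NoClash (F : ClauseSet) : Prop := ∀ x, ¬ (Reach F x (compl x) ∧ Reach F (compl x) x)

/-- A set of literals which is closed under reachability and contains no complementary pair: a
partial model of `F`. -/
structure IsPartialModel (F : ClauseSet) (T : Set Literal) : Prop where
  mem_of_reach {p q : Literal} : p ∈ T → Reach F p q → q ∈ T
  compl_notMem {p : Literal} : p ∈ T → compl p ∉ T

/-- The assignment satisfies the implications between literals given by a relation. -/
def Respects (v : ℕ → Bool) (r : Literal → Literal → Prop) : Prop :=
  ∀ ⦃p q⦄, r p q → SatLit v p → SatLit v q

variable {F G H : ClauseSet} {C : Finset Literal} {v : ℕ → Bool} {p q r x : Literal} {k : ℕ∞}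

section Reach

theorem Arc.compl (h : Arc F p q) : Arc F (compl q) (compl p) := by
  rw [Arc, compl_compl, Finset.pair_comm]
  exact h

theorem Reach.trans (h : Reach F p q) (h' : Reach F q r) : Reach F p r :=
  Relation.ReflTransGen.trans h h'

theorem Reach.compl (h : Reach F p q) : Reach F (compl q) (compl p) := by
  induction h with
  | refl => exact .refl
  | tail _ h ih => exact .head h.compl ih

theorem reach_compl_compl : Reach F (compl p) (compl q) ↔ Reach F q p :=
  ⟨fun h => by simpa only [compl_compl] using h.compl, Reach.compl⟩

theorem satClause_pair (hv : SatLit v p → SatLit v q) : SatClause v {compl p, q} := by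
  by_cases hp : SatLit v p
  · exact ⟨q, Finset.mem_insert_of_mem (Finset.mem_singleton_self q), hv hp⟩
  · exact ⟨compl p, Finset.mem_insert_self _ _, satLit_compl.2 hp⟩

theorem Arc.satLit (h : Arc F p q) (hv : SatCNF v F) (hp : SatLit v p) : SatLit v q := by
  obtain ⟨x, hx, hvx⟩ := hv _ h
  rcases Finset.mem_insert.1 hx with rfl | hx
  · exact absurd hp (satLit_compl.1 hvx)
  · exact Finset.mem_singleton.1 hx ▸ hvx

theorem Reach.satLit (h : Reach F p q) (hv : SatCNF v F) (hp : SatLit v p) : SatLit v q := by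
  induction h with
  | refl => exact hp
  | tail _ h ih => exact h.satLit hv ih

theorem Reach.implies (h : Reach F p q) : Implies F {KBase.compl p, q} :=
  fun _ hv => satClause_pair (h.satLit hv)

end Reach

section PartialModel

variable {T M : Set Literal}

theorem IsPartialModel.sUnion {c : Set (Set Literal)} (hc : IsChain (· ⊆ ·) c)
    (h : ∀ T ∈ c, IsPartialModel F T) : IsPartialModel F (⋃₀ c) where
  mem_of_reach := fun ⟨T, hT, hp⟩ hpq => ⟨T, hT, (h T hT).mem_of_reach hp hpq⟩
  compl_notMem := fun ⟨T, hT, hp⟩ ⟨T', hT', hp'⟩ => by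
    rcases hc.total hT hT' with hTT' | hTT'
    · exact (h T' hT').compl_notMem (hTT' hp) hp'
    · exact (h T hT).compl_notMem hp (hTT' hp')

theorem IsPartialModel.union_reach (hT : IsPartialModel F T) (hx : ¬ Reach F x (compl x))
    (hxT : compl x ∉ T) : IsPartialModel F (T ∪ {y | Reach F x y}) := by
  have not_reach_compl {p : Literal} (hp : p ∈ T) : ¬ Reach F x (compl p) := fun h =>
    hxT (hT.mem_of_reach hp (by simpa only [compl_compl] using h.compl))
  refine ⟨fun hp hpq => hp.imp (hT.mem_of_reach · hpq) (Reach.trans · hpq), ?_⟩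
  rintro p (hp | hp) (hp' | hp')
  · exact hT.compl_notMem hp hp'
  · exact not_reach_compl hp hp'
  · exact not_reach_compl hp' ((compl_compl p).symm ▸ hp)
  · exact hx (hp.trans (by simpa only [compl_compl] using Reach.compl hp'))

theorem mem_or_compl_mem_of_maximal (hF : NoClash F) (hM : Maximal (IsPartialModel F) M)
    (x : Literal) : x ∈ M ∨ compl x ∈ M := by
  have mem_of_not_reach {y : Literal} (hy : ¬ Reach F y (compl y)) (hyM : compl y ∉ M) : y ∈ M :=
    hM.le_of_ge (hM.prop.union_reach hy hyM) Set.subset_union_left (.inr .refl)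
  by_contra! h
  refine hF x ⟨?_, ?_⟩
  · by_contra hx
    exact h.1 (mem_of_not_reach hx h.2)
  · by_contra hx
    exact h.2 (mem_of_not_reach (by rwa [compl_compl]) (by rw [compl_compl]; exact h.1))

theorem IsPartialModel.exists_assignment (hF : NoClash F) (hT : IsPartialModel F T) :
    ∃ v : ℕ → Bool, (∀ x ∈ T, SatLit v x) ∧ Respects v (Reach F) := by
  classical
  obtain ⟨M, hTM, hM⟩ := zorn_subset_nonempty {T | IsPartialModel F T}
    (fun c hc hchain _ => ⟨⋃₀ c, .sUnion hchain hc, fun _ => Set.subset_sUnion_of_mem⟩) T hT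
  have satLit_iff (x : Literal) : SatLit (fun n => decide ((n, true) ∈ M)) x ↔ x ∈ M := by
    rcases x with ⟨n, _ | _⟩
    · have mem_or := mem_or_compl_mem_of_maximal hF hM (n, false)
      exact decide_eq_false_iff_not.trans
        ⟨mem_or.resolve_right, fun h h' => hM.prop.compl_notMem h' h⟩
    · exact decide_eq_true_iff
  exact ⟨_, fun x hx => (satLit_iff x).2 (hTM hx),
    fun _ q h hp => (satLit_iff q).2 (hM.prop.mem_of_reach ((satLit_iff _).1 hp) h)⟩

theorem exists_eq_pair_compl (h0 : C ≠ ∅) (h2 : C.card ≤ 2) : ∃ p q, C = {compl p, q} := by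
  obtain ⟨a, ha⟩ := Finset.nonempty_iff_ne_empty.2 h0
  have hcard : (C.erase a).card ≤ 1 := by
    rw [Finset.card_erase_of_mem ha]
    omega
  obtain ⟨b, hb⟩ := Finset.card_le_one_iff_subset_singleton.1 hcard
  rcases Finset.subset_singleton_iff.1 hb with h | h
  · exact ⟨compl a, a, by
      rw [compl_compl, Finset.pair_eq_singleton, ← Finset.insert_erase ha, h, insert_empty_eq]⟩
  · exact ⟨compl a, b, by rw [compl_compl, ← Finset.insert_erase ha, h]⟩

theorem satCNF_of_respects (hF : IsTwoCNF F) (h0 : ∅ ∉ F) (h : Respects v (Arc F)) :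
    SatCNF v F := by
  intro C hC
  obtain ⟨p, q, rfl⟩ := exists_eq_pair_compl (fun e => h0 (e ▸ hC)) (hF.2 C hC)
  exact satClause_pair (h hC)

theorem satisfiable_iff_noClash (hF : IsTwoCNF F) : Satisfiable F ↔ ∅ ∉ F ∧ NoClash F := by
  constructor
  · rintro ⟨v, hv⟩
    refine ⟨fun h => not_satCNF_of_empty_mem h hv, fun x ⟨h, h'⟩ => ?_⟩
    by_cases hx : SatLit v x
    · exact satLit_compl.1 (h.satLit hv hx) hx
    · exact hx (h'.satLit hv (satLit_compl.2 hx))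
  · rintro ⟨h0, h⟩
    have hempty : IsPartialModel F ∅ := ⟨fun h => absurd h (Set.notMem_empty _),
      fun h => absurd h (Set.notMem_empty _)⟩
    obtain ⟨v, -, hv⟩ := hempty.exists_assignment h
    exact ⟨v, satCNF_of_respects hF h0 fun _ _ hpq => hv (.single hpq)⟩

-- Otherwise, the literals reachable from complements of literals of `C` form a partial model.
theorem exists_reach_of_implies (hF : IsTwoCNF F) (hs : Satisfiable F) (h : Implies F C) :
    ∃ a ∈ C, ∃ b ∈ C, Reach F (compl a) b := by
  obtain ⟨h0, hcl⟩ := (satisfiable_iff_noClash hF).1 hs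
  by_contra hcon
  have hT : IsPartialModel F {y | ∃ a ∈ C, Reach F (compl a) y} :=
    ⟨fun ⟨a, ha, hp⟩ hpq => ⟨a, ha, hp.trans hpq⟩, fun ⟨a, ha, hp⟩ ⟨b, hb, hp'⟩ =>
      hcon ⟨a, ha, b, hb, hp.trans (reach_compl_compl.1 hp')⟩⟩
  obtain ⟨v, hvT, hv⟩ := hT.exists_assignment hcl
  obtain ⟨x, hx, hvx⟩ := h v (satCNF_of_respects hF h0 fun _ _ hpq => hv (.single hpq))
  exact satLit_compl.1 (hvT (compl x) ⟨x, hx, .refl⟩) hvx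

end PartialModel

section PrimeImplicates

theorem forced_iff_reach (hF : IsTwoCNF F) (hs : Satisfiable F) :
    Forced F x ↔ Reach F (compl x) x := by
  refine ⟨fun h => ?_, fun h => ?_⟩
  · obtain ⟨a, ha, b, hb, h⟩ := exists_reach_of_implies hF hs h
    rwa [Finset.mem_singleton.1 ha, Finset.mem_singleton.1 hb] at h
  · have := h.implies
    rwa [compl_compl, Finset.pair_eq_singleton] at this

theorem reach_of_implies_pair (hF : IsTwoCNF F) (hs : Satisfiable F)
    (h : Implies F {compl p, q}) (hp : ¬ Forced F (compl p)) (hq : ¬ Forced F q) :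
    Reach F p q := by
  obtain ⟨a, ha, b, hb, hr⟩ := exists_reach_of_implies hF hs h
  rw [forced_iff_reach hF hs] at hp hq
  rw [Finset.mem_insert, Finset.mem_singleton] at ha hb
  rcases ha with rfl | rfl <;> rcases hb with rfl | rfl
  · exact absurd hr hp
  · rwa [compl_compl] at hr
  · exact reach_compl_compl.1 hr
  · exact absurd hr hq

theorem IsPrimeImplicate.eq_empty_of_unsatisfiable (hs : ¬ Satisfiable F)
    (hC : IsPrimeImplicate F C) : C = ∅ := by
  by_contra hne
  exact hC.2.2 ∅ (Finset.empty_ssubset.2 (Finset.nonempty_iff_ne_empty.2 hne))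
    fun v hv => absurd ⟨v, hv⟩ hs

theorem IsPrimeImplicate.nonempty (hs : Satisfiable F) (hC : IsPrimeImplicate F C) :
    C.Nonempty := by
  obtain ⟨v, hv⟩ := hs
  obtain ⟨x, hx, _⟩ := hC.2.1 v hv
  exact ⟨x, hx⟩

theorem IsPrimeImplicate.eq_of_reach (hC : IsPrimeImplicate F C) (hp : p ∈ C) (hq : q ∈ C)
    (h : Reach F (compl p) q) : C = {p, q} := by
  by_contra hne
  have hsub : {p, q} ⊆ C := Finset.insert_subset hp (Finset.singleton_subset_iff.2 hq)
  have himp := h.implies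
  rw [compl_compl] at himp
  exact hC.2.2 {p, q} (hsub.ssubset_of_ne (Ne.symm hne)) himp

theorem IsPrimeImplicate.card_le_two (hF : IsTwoCNF F) (hC : IsPrimeImplicate F C) :
    C.card ≤ 2 := by
  by_cases hs : Satisfiable F
  · obtain ⟨a, ha, b, hb, h⟩ := exists_reach_of_implies hF hs hC.2.1
    rw [hC.eq_of_reach ha hb h]
    exact Finset.card_le_two
  · rw [hC.eq_empty_of_unsatisfiable hs, Finset.card_empty]
    exact Nat.zero_le 2

theorem card_eq_two_of_implies (hs : Satisfiable F) (h : ∀ x, ¬ Forced F x) (hC : Implies F C)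
    (h2 : C.card ≤ 2) : C.card = 2 := by
  by_contra hne
  have h1 : C.card ≤ 1 := by omega
  obtain ⟨v, hv⟩ := hs
  obtain ⟨x, hx, _⟩ := hC v hv
  exact h x (hC.mono fun y hy => Finset.mem_singleton.2 (Finset.card_le_one.1 h1 y hy x hx))

theorem card_eq_two_of_not_forced (hF : IsTwoCNF F) (hs : Satisfiable F)
    (h : ∀ x, ¬ Forced F x) :
    (∀ C ∈ F, C.card = 2) ∧ ∀ C, IsPrimeImplicate F C → C.card = 2 :=
  ⟨fun C hC => card_eq_two_of_implies hs h (implies_of_mem hC) (hF.2 C hC),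
    fun _ hC => card_eq_two_of_implies hs h hC.2.1 (hC.card_le_two hF)⟩

end PrimeImplicates

section OneBase

-- Follow the path: each inner vertex is a splitting literal, and one arc closes its first branch.
theorem Reach.refutes_one (h : Reach F p q) (hne : p ≠ q) {A : Finset Literal}
    (hp : KBase.compl p ∈ A) (hq : q ∈ A) : Refutes F 1 A := by
  induction h using Relation.ReflTransGen.head_induction_on generalizing A with
  | refl => exact absurd rfl hne
  | @head p r hpr _ ih =>
    have pair_subset {B : Finset Literal} (hp : KBase.compl p ∈ B) (hr : r ∈ B) :
        {KBase.compl p, r} ⊆ B := Finset.insert_subset hp (Finset.singleton_subset_iff.2 hr)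
    by_cases e : r = q
    · subst e
      exact .clause hpr (pair_subset hp hq)
    · exact .split r (.clause hpr
        (pair_subset (Finset.mem_insert_of_mem hp) (Finset.mem_insert_self ..)))
        (ih e (Finset.mem_insert_self ..) (Finset.mem_insert_of_mem hq))

theorem IsEquivPrimeSubset.isTwoCNF (hF : IsTwoCNF F) (hG : IsEquivPrimeSubset F G) : IsTwoCNF G :=
  ⟨fun C hC => (hG.1 C hC).1, fun C hC => (hG.1 C hC).card_le_two hF⟩

theorem IsEquivPrimeSubset.eq_of_unsatisfiable (hG : IsEquivPrimeSubset F G)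
    (hs : ¬ Satisfiable F) : G = {∅} := by
  refine Finset.eq_singleton_iff_nonempty_unique_mem.2
    ⟨Finset.nonempty_iff_ne_empty.2 ?_, fun C hC => (hG.1 C hC).eq_empty_of_unsatisfiable hs⟩
  rintro rfl
  exact hs (hG.2.satisfiable ⟨fun _ => true, satCNF_empty _⟩)

theorem IsEquivPrimeSubset.hardness_le_one (hF : IsTwoCNF F) (hG : IsEquivPrimeSubset F G) :
    hardness G ≤ 1 := by
  rw [← Nat.cast_one, hardness_le_iff]
  intro C hC hGC
  by_cases hs : Satisfiable F
  · obtain ⟨a, ha, b, hb, hr⟩ := exists_reach_of_implies (hG.isTwoCNF hF)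
      (hG.2.symm.satisfiable hs) hGC
    exact hr.refutes_one (fun e => hC a ha (e ▸ hb)) (by rwa [compl_compl]) hb
  · rw [hG.eq_of_unsatisfiable hs]
    exact .clause (Finset.mem_singleton_self _) (Finset.empty_subset _)

theorem IsEquivKBase.isKBase_one (hF : IsTwoCNF F) (h : IsEquivKBase ⊤ F G) : IsKBase 1 G :=
  ⟨h.1.1, h.isEquivPrimeSubset.hardness_le_one hF, fun H hH =>
    .inl ((h.1.2.2 H hH).resolve_right not_top_lt)⟩

theorem IsSmallestPrimeSubset.isEquivKBase (hF : IsTwoCNF F) (hG : IsSmallestPrimeSubset F G)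
    (hk : 1 ≤ k) : IsEquivKBase k F G := by
  refine ⟨⟨fun C hC => (hG.1.1 C hC).1, (hG.1.hardness_le_one hF).trans hk, ?_⟩, hG.1.2⟩
  rintro H (⟨C, hC, rfl⟩ | ⟨C, hC, x, hx, rfl⟩)
  · refine .inl fun he => ?_
    have hle : numClauses G ≤ numClauses (G.erase C) :=
      hG.2 _ ⟨fun D hD => hG.1.1 D (Finset.mem_of_mem_erase hD), he.trans hG.1.2⟩
    exact (Finset.card_erase_lt_of_mem hC).not_ge hle
  · exact .inl ((hG.1.1 C hC).not_equivalent_insert_erase hG.1.2 hx)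

theorem IsEquivPrimeSubset.exists_smallest (hG : IsEquivPrimeSubset F G) :
    ∃ S, IsSmallestPrimeSubset F S := by
  obtain ⟨S, hS, hmin⟩ := (measure numClauses).wf.has_min {G | IsEquivPrimeSubset F G} ⟨G, hG⟩
  exact ⟨S, hS, fun H hH => not_lt.1 (hmin H hH)⟩

theorem isShortestKBase_iff_isSmallestPrimeSubset (hF : IsTwoCNF F) (hk : 1 ≤ k) :
    IsShortestKBase numClauses k F G ↔ IsSmallestPrimeSubset F G := by
  refine ⟨fun h => ⟨h.1.isEquivPrimeSubset, fun H hH => ?_⟩,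
    fun h => ⟨h.isEquivKBase hF hk, fun H hH => h.2 H hH.isEquivPrimeSubset⟩⟩
  obtain ⟨S, hS⟩ := hH.exists_smallest
  exact (h.2 S (hS.isEquivKBase hF hk)).trans (hS.2 H hH)

end OneBase

section NumLitOcc

theorem IsEquivPrimeSubset.filter_card_one_subset (hs : Satisfiable F)
    (hG : IsEquivPrimeSubset F G) (hH : IsEquivPrimeSubset F H) :
    G.filter (fun C => C.card = 1) ⊆ H.filter (fun C => C.card = 1) := by
  intro C hC
  obtain ⟨hC, h1⟩ := Finset.mem_filter.1 hC
  obtain ⟨x, rfl⟩ := Finset.card_eq_one.1 h1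
  exact Finset.mem_filter.2 ⟨hH.unit_mem_of_forced hs (hG.1 _ hC).2.1, h1⟩

theorem IsEquivPrimeSubset.numLitOcc_add (hF : IsTwoCNF F) (hs : Satisfiable F)
    (hG : IsEquivPrimeSubset F G) :
    numLitOcc G + (G.filter fun C => C.card = 1).card = 2 * numClauses G := by
  rw [numLitOcc, Finset.card_filter, ← Finset.sum_add_distrib, numClauses, mul_comm,
    ← smul_eq_mul, ← Finset.sum_const]
  refine Finset.sum_congr rfl fun C hC => ?_
  have h2 := (hG.1 C hC).card_le_two hF
  have h1 := Finset.card_pos.2 ((hG.1 C hC).nonempty hs)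
  split_ifs with h <;> omega

theorem isShortestKBase_numClauses_iff (hF : IsTwoCNF F) :
    IsShortestKBase numClauses k F G ↔ IsShortestKBase numLitOcc k F G := by
  refine and_congr_right fun hG => forall₂_congr fun H hH => ?_
  by_cases hs : Satisfiable F
  · have hG' := hG.isEquivPrimeSubset.numLitOcc_add hF hs
    have hH' := hH.isEquivPrimeSubset.numLitOcc_add hF hs
    have units_eq :=
      (hG.isEquivPrimeSubset.filter_card_one_subset hs hH.isEquivPrimeSubset).antisymm
        (hH.isEquivPrimeSubset.filter_card_one_subset hs hG.isEquivPrimeSubset)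
    rw [units_eq] at hG'
    omega
  · rw [hG.isEquivPrimeSubset.eq_of_unsatisfiable hs, hH.isEquivPrimeSubset.eq_of_unsatisfiable hs]
    exact iff_of_true le_rfl le_rfl

end NumLitOcc

end ImplicationDigraph

/-! ### A smallest equivalent set of prime implicates -/

section SmallestPrimeSubset

/-- `p` is a free literal: neither `p` nor its complement is forced, when `F` is a satisfiable
2-CNF. -/
def Free (F : ClauseSet) (p : Literal) : Prop := ¬ Reach F p (compl p) ∧ ¬ Reach F (compl p) p

/-- The clause `{¬p, q}` is a prime implicate, when `F` is a satisfiable 2-CNF. The pair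
`(¬q, q)` stands for the unit clause `{q}`. -/
def PrimeArc (F : ClauseSet) (p q : Literal) : Prop :=
  Reach F p q ∧ (p = compl q ∨ Free F p ∧ Free F q ∧ p ≠ q)

/-- `p` and `q` are in the same strong component of the implication digraph. -/
def SameComponent (F : ClauseSet) (p q : Literal) : Prop := Reach F p q ∧ Reach F q p

/-- No strong component lies strictly between those of `p` and `q`. -/
def Covers (F : ClauseSet) (p q : Literal) : Prop :=
  ∀ r, Reach F p r → Reach F r q → Reach F r p ∨ Reach F q r

/-- The ranking of the variables is injective on each strong component. -/
def SeparatesComponents (F : ClauseSet) (ρ : ℕ → ℕ) : Prop :=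
  ∀ p q, SameComponent F p q → ρ p.1 = ρ q.1 → p.1 = q.1

/-- `p` has the least rank in its strong component; it represents that component. -/
def IsLeast (F : ClauseSet) (ρ : ℕ → ℕ) (p : Literal) : Prop :=
  ∀ r, SameComponent F p r → ρ p.1 ≤ ρ r.1

/-- `p` has the greatest rank in its strong component. -/
def IsGreatest (F : ClauseSet) (ρ : ℕ → ℕ) (p : Literal) : Prop :=
  ∀ r, SameComponent F p r → ρ r.1 ≤ ρ p.1

/-- The representative of the strong component of `p` is a positive literal. This holds for exactly
one of the complementary components of `p` and `¬p`, if `p` is free. -/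
def HasPositiveLeast (F : ClauseSet) (ρ : ℕ → ℕ) (p : Literal) : Prop :=
  ∃ r, SameComponent F p r ∧ IsLeast F ρ r ∧ r.2 = true

/-- `q` follows `p` in the cyclic order by rank of the strong component of `p`. -/
def IsNext (F : ClauseSet) (ρ : ℕ → ℕ) (p q : Literal) : Prop :=
  (ρ p.1 < ρ q.1 ∧ ∀ r, SameComponent F p r → ¬ (ρ p.1 < ρ r.1 ∧ ρ r.1 < ρ q.1)) ∨
    (IsGreatest F ρ p ∧ IsLeast F ρ q)

/-- The arcs selected for a smallest equivalent set of prime implicates: the forced literals, a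
directed cycle through one of each two complementary strong components of free literals (the other
cycle consists of the same clauses), and one arc for each covering pair of such components. -/
def Selected (F : ClauseSet) (ρ : ℕ → ℕ) (p q : Literal) : Prop :=
  PrimeArc F p q ∧ (p = compl q ∨
    Reach F q p ∧ HasPositiveLeast F ρ p ∧ IsNext F ρ p q ∨
    ¬ Reach F q p ∧ Covers F p q ∧ IsLeast F ρ p ∧ IsLeast F ρ q)

variable {F G H : ClauseSet} {C D : Finset Literal} {ρ : ℕ → ℕ} {v : ℕ → Bool}
  {p q r p' q' p₁ q₁ p₂ q₂ : Literal}

section Components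

theorem SameComponent.refl : SameComponent F p p := ⟨.refl, .refl⟩

theorem SameComponent.symm (h : SameComponent F p q) : SameComponent F q p := ⟨h.2, h.1⟩

theorem SameComponent.trans (h : SameComponent F p q) (h' : SameComponent F q r) :
    SameComponent F p r :=
  ⟨h.1.trans h'.1, h'.2.trans h.2⟩

theorem SameComponent.compl (h : SameComponent F p q) : SameComponent F (compl p) (compl q) :=
  ⟨h.2.compl, h.1.compl⟩

theorem sameComponent_compl_left : SameComponent F (compl p) q ↔ SameComponent F p (compl q) :=
  ⟨fun h => by simpa only [compl_compl] using h.compl,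
    fun h => by simpa only [compl_compl] using h.compl⟩

theorem Free.compl (h : Free F p) : Free F (compl p) := by
  rw [Free, compl_compl]
  exact h.symm

theorem Free.of_between (hp : Free F p) (hq : Free F q) (h₁ : Reach F p r) (h₂ : Reach F r q) :
    Free F r :=
  ⟨fun h => hp.1 (h₁.trans (h.trans h₁.compl)), fun h => hq.2 (h₂.compl.trans (h.trans h₂))⟩

theorem SameComponent.free (h : SameComponent F p q) (hp : Free F p) : Free F q :=
  hp.of_between hp h.1 h.2

theorem PrimeArc.ne (h : PrimeArc F p q) : p ≠ q := by
  rcases h.2 with rfl | ⟨-, -, hne⟩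
  · exact compl_ne_self q
  · exact hne

theorem SameComponent.eq_of_rank_eq (hρ : SeparatesComponents F ρ) (hp : Free F p)
    (h : SameComponent F p q) (e : ρ p.1 = ρ q.1) : p = q := by
  rcases eq_or_eq_compl (hρ p q h e).symm with e | rfl
  · exact e.symm
  · exact absurd h.1 hp.1

theorem IsLeast.eq (hρ : SeparatesComponents F ρ) (hp : Free F p) (h : SameComponent F p q)
    (h₁ : IsLeast F ρ p) (h₂ : IsLeast F ρ q) : p = q :=
  h.eq_of_rank_eq hρ hp (le_antisymm (h₁ q h) (h₂ p h.symm))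

theorem IsLeast.compl (h : IsLeast F ρ p) : IsLeast F ρ (compl p) := fun r hr =>
  h (KBase.compl r) (sameComponent_compl_left.1 hr)

theorem Covers.compl (h : Covers F p q) : Covers F (compl q) (compl p) := fun r hqr hrp =>
  (h (KBase.compl r) (by simpa only [compl_compl] using hrp.compl)
    (by simpa only [compl_compl] using hqr.compl)).symm.imp
    (fun h => by simpa only [compl_compl] using h.compl)
    fun h => by simpa only [compl_compl] using h.compl

theorem Covers.of_sameComponent (h : Covers F p q) (hp : SameComponent F p p')
    (hq : SameComponent F q q') : Covers F p' q' := fun r h₁ h₂ =>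
  (h r (hp.1.trans h₁) (h₂.trans hq.2)).imp (fun h => h.trans hp.1) fun h => hq.2.trans h

theorem HasPositiveLeast.of_sameComponent (h : HasPositiveLeast F ρ p)
    (hpq : SameComponent F p q) : HasPositiveLeast F ρ q :=
  let ⟨r, hr, h'⟩ := h
  ⟨r, hpq.symm.trans hr, h'⟩

theorem exists_isLeast (F : ClauseSet) (ρ : ℕ → ℕ) (p : Literal) :
    ∃ l, SameComponent F p l ∧ IsLeast F ρ l := by
  obtain ⟨l, hl, hmin⟩ := WellFounded.has_min (measure fun l : Literal => ρ l.1).wf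
    {l | SameComponent F p l} ⟨p, SameComponent.refl⟩
  exact ⟨l, hl, fun r hr => not_lt.1 (hmin r (hl.trans hr))⟩

theorem hasPositiveLeast_or_compl (F : ClauseSet) (ρ : ℕ → ℕ) (p : Literal) :
    HasPositiveLeast F ρ p ∨ HasPositiveLeast F ρ (compl p) := by
  obtain ⟨l, hl, hmin⟩ := exists_isLeast F ρ p
  cases h : l.2
  · exact .inr ⟨compl l, hl.compl, hmin.compl, by rw [compl, h, Bool.not_false]⟩
  · exact .inl ⟨l, hl, hmin, h⟩

theorem HasPositiveLeast.not_compl (hρ : SeparatesComponents F ρ) (hp : Free F p)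
    (h : HasPositiveLeast F ρ p) : ¬ HasPositiveLeast F ρ (compl p) := by
  rintro ⟨s, hs, hsl, hs2⟩
  obtain ⟨r, hr, hrl, hr2⟩ := h
  have hrs : SameComponent F r (KBase.compl s) := hr.symm.trans (sameComponent_compl_left.1 hs)
  rw [hrl.eq hρ (hr.free hp) hrs hsl.compl, KBase.compl, hs2] at hr2
  exact Bool.false_ne_true hr2

theorem IsNext.unique (hρ : SeparatesComponents F ρ) (hp : Free F p) (hq : SameComponent F p q)
    (hr : SameComponent F p r) (h₁ : IsNext F ρ p q) (h₂ : IsNext F ρ p r) : q = r := by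
  have hqr := hq.symm.trans hr
  rcases h₁ with ⟨h₁, h₁'⟩ | ⟨h₁, h₁'⟩ <;> rcases h₂ with ⟨h₂, h₂'⟩ | ⟨h₂, h₂'⟩
  · refine hqr.eq_of_rank_eq hρ (hq.free hp) (le_antisymm ?_ ?_)
    · exact not_lt.1 fun h => h₁' r hr ⟨h₂, h⟩
    · exact not_lt.1 fun h => h₂' q hq ⟨h₁, h⟩
  · exact absurd (h₂ q hq) (not_le.2 h₁)
  · exact absurd (h₁ r hr) (not_le.2 h₂)
  · exact h₁'.eq hρ (hq.free hp) hqr h₂'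

theorem Arc.mem_lits (h : Arc F p q) : p ∈ lits F ∧ q ∈ lits F :=
  ⟨KBase.mem_lits.2 ⟨_, h, .inr (Finset.mem_insert_self _ _)⟩,
    KBase.mem_lits.2 ⟨_, h, .inl (Finset.mem_insert_of_mem (Finset.mem_singleton_self q))⟩⟩

theorem Reach.eq_or_mem_lits (h : Reach F p q) : p = q ∨ p ∈ lits F ∧ q ∈ lits F := by
  rcases Relation.ReflTransGen.cases_head h with e | ⟨r, hr, _⟩
  · exact .inl e
  · rcases Relation.ReflTransGen.cases_tail h with e | ⟨s, _, hs⟩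
    · exact .inl e.symm
    · exact .inr ⟨hr.mem_lits.1, hs.mem_lits.2⟩

theorem exists_greatest_sameComponent (F : ClauseSet) (ρ : ℕ → ℕ) {P : Literal → Prop}
    (hp : P p) :
    ∃ m, SameComponent F p m ∧ P m ∧ ∀ r, SameComponent F p r → P r → ρ r.1 ≤ ρ m.1 := by
  classical
  obtain ⟨m, hm, hmax⟩ := Finset.exists_max_image
    ((insert p (lits F)).filter fun r => SameComponent F p r ∧ P r) (fun r => ρ r.1)
    ⟨p, Finset.mem_filter.2 ⟨Finset.mem_insert_self _ _, .refl, hp⟩⟩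
  obtain ⟨-, hm, hPm⟩ := Finset.mem_filter.1 hm
  refine ⟨m, hm, hPm, fun r hr hPr => hmax r (Finset.mem_filter.2 ⟨?_, hr, hPr⟩)⟩
  rcases hr.1.eq_or_mem_lits with rfl | h
  · exact Finset.mem_insert_self _ _
  · exact Finset.mem_insert_of_mem h.2

end Components

section Respects

theorem Respects.satLit_of_reach_compl (hv : Respects v (Selected F ρ))
    (h : Reach F (compl q) q) : SatLit v q := by
  by_contra hq
  exact hq (hv ⟨⟨h, .inl rfl⟩, .inl rfl⟩ (satLit_compl.2 hq))

theorem Respects.satLit_of_rank_le (hρ : SeparatesComponents F ρ)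
    (hv : Respects v (Selected F ρ)) (hp : Free F p) (hpos : HasPositiveLeast F ρ p)
    (hvp : SatLit v p) (hr : SameComponent F p r) (hle : ρ p.1 ≤ ρ r.1) : SatLit v r := by
  generalize hn : ρ r.1 = n
  induction n using Nat.strong_induction_on generalizing r with
  | _ n ih =>
  rcases hle.eq_or_lt with e | hlt
  · rwa [← hr.eq_of_rank_eq hρ hp e]
  obtain ⟨s, hs, hsr, hmax⟩ :=
    exists_greatest_sameComponent F ρ (P := fun s => ρ s.1 < ρ r.1) hlt
  have hvs := ih _ (hn ▸ hsr) hs (hmax p .refl hlt) rfl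
  have hsim := hs.symm.trans hr
  have hnext : IsNext F ρ s r :=
    .inl ⟨hsr, fun t ht h => absurd h.1 (not_lt.2 (hmax t (hs.trans ht) h.2))⟩
  have hne : s ≠ r := fun e => lt_irrefl _ (e ▸ hsr)
  exact hv ⟨⟨hsim.1, .inr ⟨hs.free hp, hr.free hp, hne⟩⟩,
    .inr (.inl ⟨hsim.2, hpos.of_sameComponent hs, hnext⟩)⟩ hvs

theorem Respects.satLit_of_hasPositiveLeast (hρ : SeparatesComponents F ρ)
    (hv : Respects v (Selected F ρ)) (hp : Free F p) (hpos : HasPositiveLeast F ρ p)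
    (h : SameComponent F p q) (hvp : SatLit v p) : SatLit v q := by
  obtain ⟨m, hm, -, hmax⟩ := exists_greatest_sameComponent F ρ (p := p) (P := fun _ => True) trivial
  obtain ⟨l, hl, hmin⟩ := exists_isLeast F ρ p
  have hvm := hv.satLit_of_rank_le hρ hp hpos hvp hm (hmax p .refl trivial)
  have hml := hm.symm.trans hl
  have hvl : SatLit v l := by
    by_cases e : m = l
    · exact e ▸ hvm
    · exact hv ⟨⟨hml.1, .inr ⟨hm.free hp, hl.free hp, e⟩⟩, .inr (.inl ⟨hml.2,
        hpos.of_sameComponent hm, .inr ⟨fun r hr => hmax r (hm.trans hr) trivial, hmin⟩⟩)⟩ hvm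
  have hlq := hl.symm.trans h
  exact hv.satLit_of_rank_le hρ (hl.free hp) (hpos.of_sameComponent hl) hvl hlq (hmin q hlq)

theorem Respects.satLit_of_sameComponent (hρ : SeparatesComponents F ρ)
    (hv : Respects v (Selected F ρ)) (hp : Free F p) (h : SameComponent F p q)
    (hvp : SatLit v p) : SatLit v q := by
  rcases hasPositiveLeast_or_compl F ρ p with hpos | hpos
  · exact hv.satLit_of_hasPositiveLeast hρ hp hpos h hvp
  · by_contra hq
    exact satLit_compl.1 (hv.satLit_of_hasPositiveLeast hρ (h.free hp).compl
      (hpos.of_sameComponent h.compl) h.symm.compl (satLit_compl.2 hq)) hvp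

theorem Respects.satLit_of_covers (hρ : SeparatesComponents F ρ)
    (hv : Respects v (Selected F ρ)) (hp : Free F p) (hq : Free F q) (hcov : Covers F p q)
    (h : Reach F p q) (hn : ¬ Reach F q p) (hvp : SatLit v p) : SatLit v q := by
  obtain ⟨a, ha, hamin⟩ := exists_isLeast F ρ p
  obtain ⟨b, hb, hbmin⟩ := exists_isLeast F ρ q
  have hva := hv.satLit_of_sameComponent hρ hp ha hvp
  have hba : ¬ Reach F b a := fun h' => hn (hb.1.trans (h'.trans ha.2))
  have hab : Reach F a b := ha.2.trans (h.trans hb.1)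
  have hvb := hv ⟨⟨hab, .inr ⟨ha.free hp, hb.free hq, fun e => hba (e ▸ hab)⟩⟩,
    .inr (.inr ⟨hba, hcov.of_sameComponent ha hb, hamin, hbmin⟩)⟩ hva
  exact hv.satLit_of_sameComponent hρ (hb.free hq) hb.symm hvb

open scoped Classical in
/-- The interval of the literals of `F` between `p` and `q` in the reachability preorder. -/
noncomputable def interval (F : ClauseSet) (p q : Literal) : Finset Literal :=
  (lits F).filter fun r => Reach F p r ∧ Reach F r q

theorem mem_interval : r ∈ interval F p q ↔ r ∈ lits F ∧ Reach F p r ∧ Reach F r q := by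
  simp only [interval, Finset.mem_filter]

theorem interval_ssubset_interval (hp : Reach F p p') (hq : Reach F q' q)
    (hr : r ∈ interval F p q) (hr' : r ∉ interval F p' q') :
    interval F p' q' ⊂ interval F p q := by
  refine (Finset.ssubset_iff_of_subset fun s hs => ?_).2 ⟨r, hr, hr'⟩
  obtain ⟨hs, h₁, h₂⟩ := mem_interval.1 hs
  exact mem_interval.2 ⟨hs, hp.trans h₁, h₂.trans hq⟩

theorem Respects.satLit_of_not_reach (hρ : SeparatesComponents F ρ)
    (hv : Respects v (Selected F ρ)) (hp : Free F p) (hq : Free F q) (h : Reach F p q)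
    (hn : ¬ Reach F q p) (hvp : SatLit v p) : SatLit v q := by
  generalize hI : interval F p q = I
  induction I using Finset.strongInduction generalizing p q with
  | _ I ih =>
  subst hI
  by_cases hcov : Covers F p q
  · exact hv.satLit_of_covers hρ hp hq hcov h hn hvp
  simp only [Covers, not_forall, not_or] at hcov
  obtain ⟨r, hpr, hrq, hrp, hqr⟩ := hcov
  have hr := hp.of_between hq hpr hrq
  have mem_lits := h.eq_or_mem_lits.resolve_left fun e => hn (e ▸ h)
  have hvr := ih _ (interval_ssubset_interval .refl hrq (mem_interval.2 ⟨mem_lits.2, h, .refl⟩)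
    fun hmem => hqr (mem_interval.1 hmem).2.2) hp hr hpr hrp hvp rfl
  exact ih _ (interval_ssubset_interval hpr .refl (mem_interval.2 ⟨mem_lits.1, .refl, h⟩)
    fun hmem => hrp (mem_interval.1 hmem).2.1) hr hq hrq hqr hvr rfl

theorem Respects.respects_reach (hρ : SeparatesComponents F ρ) (hv : Respects v (Selected F ρ)) :
    Respects v (Reach F) := by
  intro p q h hvp
  have hp' : ¬ Reach F p (compl p) := fun h' =>
    satLit_compl.1 (hv.satLit_of_reach_compl (q := compl p) (by rwa [compl_compl])) hvp
  by_cases hq' : Reach F (compl q) q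
  · exact hv.satLit_of_reach_compl hq'
  have hp : Free F p := ⟨hp', fun h' => hq' (h.compl.trans (h'.trans h))⟩
  have hq : Free F q := ⟨fun h' => hp' (h.trans (h'.trans h.compl)), hq'⟩
  by_cases h' : Reach F q p
  · exact hv.satLit_of_sameComponent hρ hp ⟨h, h'⟩ hvp
  · exact hv.satLit_of_not_reach hρ hp hq h h' hvp

end Respects

section PrimeArc

theorem free_iff_not_forced (hF : IsTwoCNF F) (hs : Satisfiable F) :
    Free F p ↔ ¬ Forced F p ∧ ¬ Forced F (compl p) := by
  rw [forced_iff_reach hF hs, forced_iff_reach hF hs, compl_compl, and_comm, Free]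

theorem PrimeArc.isPrimeImplicate (hF : IsTwoCNF F) (hs : Satisfiable F) (h : PrimeArc F p q) :
    IsPrimeImplicate F {compl p, q} := by
  obtain ⟨h, rfl | ⟨hp, hq, hne⟩⟩ := h
  · rw [compl_compl, Finset.pair_eq_singleton]
    exact ((forced_iff_reach hF hs).2 h).isPrimeImplicate hs
  have hclause : IsClause {compl p, q} := (isClause_singleton q).insert (by
    rw [compl_compl, Finset.mem_singleton]
    exact hne)
  refine ⟨hclause, h.implies, fun D hD hFD => ?_⟩
  obtain ⟨E, hED, hE⟩ := exists_primeImplicate_subset (hclause.subset hD.subset) hFD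
  have card_le_one : E.card ≤ 1 := Nat.lt_succ_iff.1
    ((Finset.card_lt_card (hED.trans_ssubset hD)).trans_le Finset.card_le_two)
  obtain ⟨x, rfl⟩ := Finset.card_eq_one.1
    (card_le_one.antisymm (Finset.card_pos.2 (hE.nonempty hs)))
  have hx : Forced F x := hE.2.1
  rcases Finset.mem_insert.1 (hD.subset (hED (Finset.mem_singleton_self x))) with rfl | hxq
  · exact ((free_iff_not_forced hF hs).1 hp).2 hx
  · exact ((free_iff_not_forced hF hs).1 hq).1 (Finset.mem_singleton.1 hxq ▸ hx)

theorem IsPrimeImplicate.free_of_ne (hF : IsTwoCNF F) (hs : Satisfiable F)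
    (h : IsPrimeImplicate F C) (hp : p ∈ C) (hq : q ∈ C) (hne : p ≠ q) : Free F p := by
  refine (free_iff_not_forced hF hs).2 ⟨fun hf => hne ?_, fun hf => ?_⟩
  · exact (Finset.mem_singleton.1 (h.eq_of_forced hf hp ▸ hq)).symm
  · exact h.compl_notMem_of_forced hf (by rwa [compl_compl])

theorem isPrimeImplicate_iff_exists_primeArc (hF : IsTwoCNF F) (hs : Satisfiable F) :
    IsPrimeImplicate F C ↔ ∃ p q, PrimeArc F p q ∧ C = {compl p, q} := by
  constructor
  · intro h
    obtain ⟨a, ha, b, hb, hr⟩ := exists_reach_of_implies hF hs h.2.1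
    have hC := h.eq_of_reach ha hb hr
    refine ⟨compl a, b, ⟨hr, ?_⟩, by rwa [compl_compl]⟩
    rcases eq_or_ne a b with rfl | hab
    · exact .inl rfl
    · exact .inr ⟨(h.free_of_ne hF hs ha hb hab).compl, h.free_of_ne hF hs hb ha hab.symm,
        fun e => h.1 a ha (e ▸ hb)⟩
  · rintro ⟨p, q, h, rfl⟩
    exact h.isPrimeImplicate hF hs

theorem isEquivPrimeSubset_of_selected (hF : IsTwoCNF F) (hs : Satisfiable F)
    (hρ : SeparatesComponents F ρ)
    (hG : ∀ C, C ∈ G ↔ ∃ p q, Selected F ρ p q ∧ C = {compl p, q}) : IsEquivPrimeSubset F G := by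
  have hprime : ∀ C ∈ G, IsPrimeImplicate F C := fun C hC => by
    obtain ⟨p, q, h, rfl⟩ := (hG C).1 hC
    exact h.1.isPrimeImplicate hF hs
  refine ⟨hprime, fun v => ⟨fun hv => ?_, fun hv C hC => (hprime C hC).2.1 v hv⟩⟩
  have hselected : Respects v (Selected F ρ) := fun p q h =>
    Arc.satLit ((hG _).2 ⟨p, q, h, rfl⟩) hv
  exact satCNF_of_respects hF ((satisfiable_iff_noClash hF).1 hs).1 fun _ _ h =>
    hselected.respects_reach hρ (.single h)

end PrimeArc

section Minimality

theorem reach_of_between (hF : IsTwoCNF F) (hs : Satisfiable F) (he : Equivalent H F)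
    (hp : Free F p) (hq : Free F q) (h₁ : Reach H p r) (h₂ : Reach H r q) :
    Reach F p r ∧ Reach F r q := by
  have hpf := ((free_iff_not_forced hF hs).1 hp).2
  have hqf := ((free_iff_not_forced hF hs).1 hq).1
  have hrf : ¬ Forced F r := fun h => hqf fun v hv =>
    ⟨q, Finset.mem_singleton_self q, h₂.satLit ((he v).2 hv) (h.satLit hv)⟩
  have hrf' : ¬ Forced F (compl r) := fun h => hpf fun v hv =>
    ⟨compl p, Finset.mem_singleton_self _, satLit_compl.2 fun hvp =>
      satLit_compl.1 (h.satLit hv) (h₁.satLit ((he v).2 hv) hvp)⟩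
  exact ⟨reach_of_implies_pair hF hs (he.implies_iff.1 h₁.implies) hpf hrf,
    reach_of_implies_pair hF hs (he.implies_iff.1 h₂.implies) hrf' hqf⟩

theorem IsEquivPrimeSubset.reach (hF : IsTwoCNF F) (hs : Satisfiable F)
    (hH : IsEquivPrimeSubset F H) (hp : Free F p) (hq : Free F q) (h : Reach F p q) :
    Reach H p q :=
  reach_of_implies_pair (hH.isTwoCNF hF) (hH.2.symm.satisfiable hs)
    (hH.2.implies_iff.2 h.implies)
    (fun h => ((free_iff_not_forced hF hs).1 hp).2 (hH.2.implies_iff.1 h))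
    fun h => ((free_iff_not_forced hF hs).1 hq).1 (hH.2.implies_iff.1 h)

theorem exists_crossing_of_reflTransGen {α : Type*} {r : α → α → Prop} {a b : α}
    (h : Relation.ReflTransGen r a b) {P : α → Prop} (ha : P a) (hb : ¬ P b) :
    ∃ c d, Relation.ReflTransGen r a c ∧ r c d ∧ Relation.ReflTransGen r d b ∧ P c ∧ ¬ P d := by
  induction h using Relation.ReflTransGen.head_induction_on with
  | refl => exact absurd ha hb
  | @head a c hac hcb ih =>
    by_cases hc : P c
    · obtain ⟨c', d, h₁, h₂⟩ := ih hc
      exact ⟨c', d, .head hac h₁, h₂⟩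
    · exact ⟨a, c, .refl, hac, hcb, ha, hc⟩

/-- The clause `D` of an equivalent set of prime implicates does the work of the selected clause
`C`: it is the same unit clause, or an arc between the same strong components, leaving from the
same literal if the two components coincide. -/
inductive Matches (F : ClauseSet) (ρ : ℕ → ℕ) : Finset Literal → Finset Literal → Prop
  | unit (q : Literal) : Matches F ρ {q} {q}
  | arc {p q p' q' : Literal} (h : Selected F ρ p q) (hp : Free F p)
      (hpp' : SameComponent F p p') (hqq' : SameComponent F q q')
      (heq : Reach F q p → p = p') : Matches F ρ {compl p, q} {compl p', q'}

theorem Selected.exists_matches (hF : IsTwoCNF F) (hs : Satisfiable F)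
    (hH : IsEquivPrimeSubset F H) (h : Selected F ρ p q) :
    ∃ D ∈ H, Matches F ρ {compl p, q} D := by
  by_cases hpq : p = compl q
  · subst hpq
    rw [compl_compl, Finset.pair_eq_singleton]
    exact ⟨_, hH.unit_mem_of_forced hs ((forced_iff_reach hF hs).2 h.1.1), .unit q⟩
  obtain ⟨hp, hq, hne⟩ := h.1.2.resolve_left hpq
  have hr := hH.reach hF hs hp hq h.1.1
  rcases h.2.resolve_left hpq with ⟨hqp, -, -⟩ | ⟨hqp, hcov, -, -⟩
  · obtain ⟨s, hps, hsq⟩ := (Relation.ReflTransGen.cases_head hr).resolve_left hne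
    obtain ⟨hps', hsq'⟩ := reach_of_between hF hs hH.2 hp hq (.single hps) hsq
    exact ⟨_, hps, .arc h hp .refl ⟨hqp.trans hps', hsq'⟩ fun _ => rfl⟩
  · obtain ⟨c, d, hpc, hcd, hdq, hcp, hdp⟩ :=
      exists_crossing_of_reflTransGen hr (P := fun r => Reach F r p) .refl hqp
    obtain ⟨hpc', -⟩ := reach_of_between hF hs hH.2 hp hq hpc (.head hcd hdq)
    obtain ⟨hpd', hdq'⟩ := reach_of_between hF hs hH.2 hp hq (.tail hpc hcd) hdq
    exact ⟨_, hcd, .arc h hp ⟨hpc', hcp⟩ ⟨(hcov d hpd' hdq').resolve_left hdp, hdq'⟩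
      fun h' => absurd h' hqp⟩

theorem pair_eq_pair_iff {α : Type*} [DecidableEq α] {a b c d : α} :
    ({a, b} : Finset α) = {c, d} ↔ a = c ∧ b = d ∨ a = d ∧ b = c := by
  rw [← Finset.coe_inj, Finset.coe_pair, Finset.coe_pair]
  exact Set.pair_eq_pair_iff

theorem pair_ne_singleton_of_free (hp : Free F p) (h : Reach F p q) (a : Literal) :
    ({compl p, q} : Finset Literal) ≠ {a} := by
  intro e
  rw [← Finset.pair_eq_singleton a, pair_eq_pair_iff, or_self] at e
  exact hp.1 (e.1.trans e.2.symm ▸ h)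

theorem Selected.ne_compl_of_free (h : Selected F ρ p q) (hp : Free F p) : p ≠ compl q := by
  rintro rfl
  exact hp.1 (by rw [compl_compl]; exact h.1.1)

theorem Selected.compl_of_not_reach (h : Selected F ρ p q) (hp : Free F p) (hqp : ¬ Reach F q p) :
    Selected F ρ (compl q) (compl p) := by
  have hpq := h.ne_compl_of_free hp
  obtain ⟨-, hq, hne⟩ := h.1.2.resolve_left hpq
  obtain ⟨-, hcov, hpl, hql⟩ := (h.2.resolve_left hpq).resolve_left fun h' => hqp h'.1
  exact ⟨⟨h.1.1.compl, .inr ⟨hq.compl, hp.compl, compl_inj.not.2 hne.symm⟩⟩,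
    .inr (.inr ⟨fun h' => hqp (reach_compl_compl.1 h'), hcov.compl, hql.compl, hpl.compl⟩)⟩

theorem Selected.hasPositiveLeast (h : Selected F ρ p q) (hp : Free F p) (hqp : Reach F q p) :
    HasPositiveLeast F ρ p :=
  ((h.2.resolve_left (h.ne_compl_of_free hp)).resolve_right fun h' => h'.1 hqp).2.1

theorem Selected.eq_of_sameComponent (hρ : SeparatesComponents F ρ) (h₁ : Selected F ρ p₁ q₁)
    (h₂ : Selected F ρ p₂ q₂) (hp₁ : Free F p₁) (hp : SameComponent F p₁ p₂)
    (hq : SameComponent F q₁ q₂) (heq : Reach F q₁ p₁ → p₁ = p₂) : p₁ = p₂ ∧ q₁ = q₂ := by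
  have hq₁ := (h₁.1.2.resolve_left (h₁.ne_compl_of_free hp₁)).2.1
  rcases h₁.2.resolve_left (h₁.ne_compl_of_free hp₁) with ⟨r₁, -, hnext₁⟩ | ⟨r₁, -, hpl₁, hql₁⟩ <;>
  rcases h₂.2.resolve_left (h₂.ne_compl_of_free (hp.free hp₁)) with
    ⟨r₂, -, hnext₂⟩ | ⟨r₂, -, hpl₂, hql₂⟩
  · obtain rfl := heq r₁
    exact ⟨rfl, hnext₁.unique hρ hp₁ ⟨h₁.1.1, r₁⟩ ⟨h₂.1.1, r₂⟩ hnext₂⟩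
  · exact absurd (hq.2.trans (r₁.trans hp.1)) r₂
  · exact absurd (hq.1.trans (r₂.trans hp.2)) r₁
  · exact ⟨hpl₁.eq hρ hp₁ hp hpl₂, hql₁.eq hρ hq₁ hq hql₂⟩

theorem Selected.eq_compl_of_sameComponent (hρ : SeparatesComponents F ρ)
    (h₁ : Selected F ρ p₁ q₁) (h₂ : Selected F ρ p₂ q₂) (hp₁ : Free F p₁) (hp₂ : Free F p₂)
    (hp : SameComponent F p₁ (compl q₂)) (hq : SameComponent F q₁ (compl p₂)) :
    p₁ = compl q₂ ∧ q₁ = compl p₂ := by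
  by_cases r₁ : Reach F q₁ p₁
  · have r₂ : Reach F q₂ p₂ := reach_compl_compl.1 (hq.2.trans (r₁.trans hp.1))
    have hp₁p₂ : SameComponent F p₁ (KBase.compl p₂) := .trans ⟨h₁.1.1, r₁⟩ hq
    exact absurd ((h₁.hasPositiveLeast hp₁ r₁).of_sameComponent hp₁p₂)
      ((h₂.hasPositiveLeast hp₂ r₂).not_compl hρ hp₂)
  · have r₂ : ¬ Reach F q₂ p₂ := fun r₂ => r₁ (hq.1.trans (r₂.compl.trans hp.2))
    exact h₁.eq_of_sameComponent hρ (h₂.compl_of_not_reach hp₂ r₂) hp₁ hp hq fun h => absurd h r₁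

theorem Matches.unique (hρ : SeparatesComponents F ρ) {C₁ C₂ : Finset Literal}
    (h₁ : Matches F ρ C₁ D) (h₂ : Matches F ρ C₂ D) : C₁ = C₂ := by
  generalize hD : D = D₂ at h₂
  rcases h₁ with ⟨a⟩ | @⟨p₁, q₁, p₁', q₁', h₁, hp₁, hpp₁, hqq₁, heq₁⟩ <;>
  rcases h₂ with ⟨b⟩ | @⟨p₂, q₂, p₂', q₂', h₂, hp₂, hpp₂, hqq₂, heq₂⟩
  · exact hD
  · exact absurd hD.symm (pair_ne_singleton_of_free (hpp₂.free hp₂)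
      (hpp₂.2.trans (h₂.1.1.trans hqq₂.1)) a)
  · exact absurd hD (pair_ne_singleton_of_free (hpp₁.free hp₁)
      (hpp₁.2.trans (h₁.1.1.trans hqq₁.1)) b)
  rcases pair_eq_pair_iff.1 hD with ⟨hpp, rfl⟩ | ⟨rfl, rfl⟩
  · obtain rfl := compl_inj.1 hpp
    have hp := hpp₁.trans hpp₂.symm
    have hq := hqq₁.trans hqq₂.symm
    obtain ⟨rfl, rfl⟩ := h₁.eq_of_sameComponent hρ h₂ hp₁ hp hq fun r =>
      (heq₁ r).trans (heq₂ (hq.2.trans (r.trans hp.1))).symm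
    rfl
  · obtain ⟨rfl, rfl⟩ := h₁.eq_compl_of_sameComponent hρ h₂ hp₁ hp₂
      (hpp₁.trans (sameComponent_compl_left.1 hqq₂.symm)) (hqq₁.trans hpp₂.symm.compl)
    rw [compl_compl, Finset.pair_comm]

theorem isSmallestPrimeSubset_of_selected (hF : IsTwoCNF F) (hs : Satisfiable F)
    (hρ : SeparatesComponents F ρ)
    (hG : ∀ C, C ∈ G ↔ ∃ p q, Selected F ρ p q ∧ C = {compl p, q}) :
    IsSmallestPrimeSubset F G := by
  refine ⟨isEquivPrimeSubset_of_selected hF hs hρ hG, fun H hH => ?_⟩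
  refine Finset.card_le_card_of_forall_subsingleton (Matches F ρ) (fun C hC => ?_) fun D _ => ?_
  · obtain ⟨p, q, h, rfl⟩ := (hG C).1 hC
    exact h.exists_matches hF hs hH
  · rintro C₁ ⟨-, h₁⟩ C₂ ⟨-, h₂⟩
    exact h₁.unique hρ h₂

end Minimality

end SmallestPrimeSubset

/-! ### Polynomial-time decidable predicates -/

/-- `P` is decided by a program in polynomial time. -/
def TreePolyDecidable {α : Type} [TreeEncoding α] (P : α → Prop) : Prop :=
  ∃ c : α → Bool, TreePolyTime c ∧ ∀ x, c x = true ↔ P x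

theorem headD_filter_eq_iff {α : Type*} [DecidableEq α] {U : List α} {m n : α} :
    (U.filter fun k => k = m ∨ k = n).headD m = m ↔ U.idxOf m ≤ U.idxOf n := by
  induction U with
  | nil => simp
  | cons k U ih =>
    by_cases hm : k = m
    · simp [hm]
    by_cases hn : k = n
    · simp [hn, hn ▸ hm]
    · simpa [hm, hn, List.idxOf_cons_ne] using ih

theorem codeSize_filter_le {α : Type} [TreeEncoding α] (l : List α) (p : α → Bool) :
    codeSize (l.filter p) ≤ codeSize l := by
  induction l with
  | nil => exact le_rfl
  | cons a l ih =>
    rw [List.filter_cons]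
    split_ifs
    · simpa only [codeSize_cons, add_le_add_iff_right, add_le_add_iff_left] using ih
    · rw [codeSize_cons]; omega

theorem TreePolyTime.product {α β γ : Type} [TreeEncoding α] [TreeEncoding β] [TreeEncoding γ]
    {l : α → List β} {m : α → List γ} (hl : TreePolyTime l) (hm : TreePolyTime m) :
    TreePolyTime fun x => l x ×ˢ m x :=
  hl.flatMap (f := fun y : α × β => (m y.1).map fun b => (y.2, b))
    ((hm.comp fst).map (f := fun z : (α × β) × γ => (z.1.2, z.2)) ((snd.comp fst).pair snd))

namespace TreePolyDecidable

open TreePolyTime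

variable {α β γ : Type} [TreeEncoding α] [TreeEncoding β] [TreeEncoding γ] {P Q : α → Prop}

theorem of_iff (hP : TreePolyDecidable P) (h : ∀ x, P x ↔ Q x) : TreePolyDecidable Q :=
  let ⟨c, hc, hcP⟩ := hP
  ⟨c, hc, fun x => (hcP x).trans (h x)⟩

theorem not (hP : TreePolyDecidable P) : TreePolyDecidable fun x => ¬ P x :=
  let ⟨_, hc, hcP⟩ := hP
  ⟨_, hc.not, fun x => by simp only [Bool.not_eq_true', ← hcP, Bool.not_eq_true]⟩

theorem and (hP : TreePolyDecidable P) (hQ : TreePolyDecidable Q) :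
    TreePolyDecidable fun x => P x ∧ Q x :=
  let ⟨_, hc, hcP⟩ := hP
  let ⟨_, hd, hdQ⟩ := hQ
  ⟨_, hc.and hd, fun x => by rw [Bool.and_eq_true, hcP, hdQ]⟩

theorem or (hP : TreePolyDecidable P) (hQ : TreePolyDecidable Q) :
    TreePolyDecidable fun x => P x ∨ Q x :=
  (hP.not.and hQ.not).not.of_iff fun x => by rw [not_and_or, not_not, not_not]

theorem imp (hP : TreePolyDecidable P) (hQ : TreePolyDecidable Q) :
    TreePolyDecidable fun x => P x → Q x :=
  (hP.not.or hQ).of_iff fun _ => imp_iff_not_or.symm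

theorem exists_mem {l : α → List β} {R : α → β → Prop} (hl : TreePolyTime l)
    (hR : TreePolyDecidable fun y : α × β => R y.1 y.2) :
    TreePolyDecidable fun x => ∃ a ∈ l x, R x a :=
  let ⟨_, hc, hcR⟩ := hR
  ⟨_, hl.any hc, fun x => by simp only [List.any_eq_true, hcR]⟩

theorem forall_mem {l : α → List β} {R : α → β → Prop} (hl : TreePolyTime l)
    (hR : TreePolyDecidable fun y : α × β => R y.1 y.2) :
    TreePolyDecidable fun x => ∀ a ∈ l x, R x a :=
  (exists_mem (R := fun x a => ¬ R x a) hl hR.not).not.of_iff fun x => by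
    simp only [not_exists, not_and, not_not]

theorem filter {l : α → List β} {R : α → β → Prop} [∀ x a, Decidable (R x a)]
    (hR : TreePolyDecidable fun y : α × β => R y.1 y.2) (hl : TreePolyTime l) :
    TreePolyTime fun x => (l x).filter fun a => R x a := by
  obtain ⟨c, hc, hcR⟩ := hR
  refine (hl.filter hc).of_codeWord_eq fun x => congrArg _ (List.filter_congr fun a _ => ?_)
  rw [Bool.eq_iff_iff, hcR, decide_eq_true_iff]

theorem ite [∀ x, Decidable (P x)] (hP : TreePolyDecidable P) {f g : α → β}
    (hf : TreePolyTime f) (hg : TreePolyTime g) :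
    TreePolyTime fun x => if P x then f x else g x := by
  obtain ⟨c, hc, hcP⟩ := hP
  refine (hc.cond hf hg).of_codeWord_eq fun x => ?_
  rw [Bool.cond_eq_ite, if_congr (hcP x) rfl rfl]

theorem eq_true {f : α → Bool} (hf : TreePolyTime f) : TreePolyDecidable fun x => f x = true :=
  ⟨f, hf, fun _ => Iff.rfl⟩

theorem eq_nat {f g : α → ℕ} (hf : TreePolyTime f) (hg : TreePolyTime g) :
    TreePolyDecidable fun x => f x = g x :=
  ⟨_, hf.encodeNat.beq_listBool hg.encodeNat, fun x => by
    rw [beq_iff_eq, (Function.LeftInverse.injective Computability.decode_encodeNat).eq_iff]⟩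

theorem eq_literal {f g : α → Literal} (hf : TreePolyTime f) (hg : TreePolyTime g) :
    TreePolyDecidable fun x => f x = g x :=
  ((eq_nat (fst.comp hf) (fst.comp hg)).and
    ⟨_, (snd.comp hf).beq_bool (snd.comp hg), fun _ => beq_iff_eq⟩).of_iff fun _ =>
    Prod.ext_iff.symm

theorem mem_literals {f : α → Literal} {l : α → List Literal} (hf : TreePolyTime f)
    (hl : TreePolyTime l) : TreePolyDecidable fun x => f x ∈ l x :=
  (exists_mem (R := fun x a => a = f x) hl (eq_literal snd (hf.comp fst))).of_iff fun _ =>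
    exists_eq_right

theorem mem_literalPairs {f g : α → Literal} {l : α → List (Literal × Literal)}
    (hf : TreePolyTime f) (hg : TreePolyTime g) (hl : TreePolyTime l) :
    TreePolyDecidable fun x => (f x, g x) ∈ l x :=
  (exists_mem (R := fun x a => a.1 = f x ∧ a.2 = g x) hl
    ((eq_literal (fst.comp snd) (hf.comp fst)).and
      (eq_literal (snd.comp snd) (hg.comp fst)))).of_iff fun x => by
    simp only [← Prod.mk_inj, Prod.eta, exists_eq_right]

theorem idxOf_le_idxOf {U : α → List ℕ} {m n : α → ℕ} (hU : TreePolyTime U) (hm : TreePolyTime m)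
    (hn : TreePolyTime n) :
    TreePolyDecidable fun x => (U x).idxOf (m x) ≤ (U x).idxOf (n x) :=
  (eq_nat (((eq_nat snd (hm.comp fst)).or (eq_nat snd (hn.comp fst))).filter hU |>.headD hm)
    hm).of_iff fun _ => headD_filter_eq_iff

end TreePolyDecidable

/-! ### Transitive closure -/

section Warshall

variable {α : Type*} [DecidableEq α] {V l : List α} {R : List (α × α)} {p q v w : α}

/-- One round of Warshall's algorithm on the vertices `V`: join the pairs meeting in `v`. -/
def pivotStep (V : List α) (R : List (α × α)) (v : α) : List (α × α) :=
  (V ×ˢ V).filter fun a => a ∈ R ∨ (a.1, v) ∈ R ∧ (v, a.2) ∈ R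

/-- The transitive closure of a relation on the vertices `V`, by Warshall's algorithm. -/
def warshall (V : List α) (R : List (α × α)) : List (α × α) := V.foldl (pivotStep V) R

theorem mem_pivotStep :
    (p, q) ∈ pivotStep V R v ↔
      (p ∈ V ∧ q ∈ V) ∧ ((p, q) ∈ R ∨ (p, v) ∈ R ∧ (v, q) ∈ R) := by
  rw [pivotStep, List.mem_filter, decide_eq_true_iff]
  exact and_congr_left' List.pair_mem_product

theorem pivotStep_subset_product : pivotStep V R v ⊆ V ×ˢ V := List.filter_subset_self _

theorem subset_foldl_pivotStep (hR : R ⊆ V ×ˢ V) : R ⊆ l.foldl (pivotStep V) R := by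
  induction l generalizing R with
  | nil => exact List.Subset.refl R
  | cons v l ih =>
    refine List.Subset.trans (fun ⟨p, q⟩ h => ?_) (ih pivotStep_subset_product)
    exact mem_pivotStep.2 ⟨List.pair_mem_product.1 (hR h), .inl h⟩

theorem transGen_of_mem_foldl_pivotStep (h : (p, q) ∈ l.foldl (pivotStep V) R) :
    Relation.TransGen (fun a b => (a, b) ∈ R) p q := by
  induction l generalizing R with
  | nil => exact .single h
  | cons v l ih =>
    refine (ih h).lift' id fun a b hab => ?_
    rcases (mem_pivotStep.1 hab).2 with h | ⟨h₁, h₂⟩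
    · exact .single h
    · exact .tail (.single h₁) h₂

/-- `R` is transitive at the intermediate vertex `v`. -/
def TransitiveAt (R : List (α × α)) (v : α) : Prop :=
  ∀ p q, (p, v) ∈ R → (v, q) ∈ R → (p, q) ∈ R

theorem transitiveAt_pivotStep_self : TransitiveAt (pivotStep V R v) v := fun p q hpv hvq => by
  obtain ⟨⟨hp, -⟩, hpv⟩ := mem_pivotStep.1 hpv
  obtain ⟨⟨-, hq⟩, hvq⟩ := mem_pivotStep.1 hvq
  exact mem_pivotStep.2 ⟨⟨hp, hq⟩, .inr ⟨hpv.elim id And.left, hvq.elim id And.right⟩⟩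

theorem TransitiveAt.pivotStep (h : TransitiveAt R v) : TransitiveAt (pivotStep V R w) v := by
  intro p q hpv hvq
  obtain ⟨⟨hp, -⟩, hpv⟩ := mem_pivotStep.1 hpv
  obtain ⟨⟨-, hq⟩, hvq⟩ := mem_pivotStep.1 hvq
  refine mem_pivotStep.2 ⟨⟨hp, hq⟩, ?_⟩
  rcases hpv with hpv | ⟨hpw, hwv⟩ <;> rcases hvq with hvq | ⟨hvw, hwq⟩
  · exact .inl (h p q hpv hvq)
  · exact .inr ⟨h p w hpv hvw, hwq⟩
  · exact .inr ⟨hpw, h w q hwv hvq⟩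
  · exact .inr ⟨hpw, hwq⟩

theorem transitiveAt_foldl_pivotStep (h : v ∈ l ∨ TransitiveAt R v) :
    TransitiveAt (l.foldl (pivotStep V) R) v := by
  induction l generalizing R with
  | nil => exact h.resolve_left List.not_mem_nil
  | cons w l ih =>
    refine ih ?_
    rcases h with h | h
    · exact (List.mem_cons.1 h).symm.imp_right fun (e : v = w) =>
        e ▸ transitiveAt_pivotStep_self
    · exact .inr h.pivotStep

theorem mem_warshall (hR : R ⊆ V ×ˢ V) :
    (p, q) ∈ warshall V R ↔ Relation.TransGen (fun a b => (a, b) ∈ R) p q := by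
  refine ⟨transGen_of_mem_foldl_pivotStep, fun h => ?_⟩
  induction h with
  | single h => exact subset_foldl_pivotStep hR h
  | @tail r q _ hrq ih =>
    exact transitiveAt_foldl_pivotStep (.inl (List.pair_mem_product.1 (hR hrq)).1) p q ih
      (subset_foldl_pivotStep hR hrq)

end Warshall

theorem TreePolyTime.warshall {α : Type} [TreeEncoding α] {V : α → List Literal}
    {R : α → List (Literal × Literal)} (hV : TreePolyTime V) (hR : TreePolyTime R) :
    TreePolyTime fun x => warshall (V x) (R x) := by
  have old : TreePolyTime fun y : (α × List (Literal × Literal) × Literal) × Literal × Literal =>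
      y.1.2.1 := fst.comp (snd.comp fst)
  have vertex : TreePolyTime fun y : (α × List (Literal × Literal) × Literal) × Literal × Literal =>
      y.1.2.2 := snd.comp (snd.comp fst)
  have joined : TreePolyDecidable
      fun y : (α × List (Literal × Literal) × Literal) × Literal × Literal =>
        (y.2.1, y.2.2) ∈ y.1.2.1 ∨ (y.2.1, y.1.2.2) ∈ y.1.2.1 ∧ (y.1.2.2, y.2.2) ∈ y.1.2.1 :=
    (TreePolyDecidable.mem_literalPairs (fst.comp snd) (snd.comp snd) old).or
      ((TreePolyDecidable.mem_literalPairs (fst.comp snd) vertex old).and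
        (.mem_literalPairs vertex (snd.comp snd) old))
  have pivot : TreePolyTime fun y : α × List (Literal × Literal) × Literal =>
      pivotStep (V y.1) y.2.1 y.2.2 := by
    unfold pivotStep
    convert joined.filter
      (R := fun (y : α × List (Literal × Literal) × Literal) (a : Literal × Literal) =>
        a ∈ y.2.1 ∨ (a.1, y.2.2) ∈ y.2.1 ∧ (y.2.2, a.2) ∈ y.2.1)
      ((hV.comp fst).product (hV.comp fst))
  obtain ⟨q, hq⟩ := (hV.product hV).exists_codeSize_le
  exact hV.foldl hR pivot q fun x s v _ =>
    (codeSize_filter_le _ _).trans ((hq x).trans le_add_self)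

/-! ### The algorithm -/

/-- The variables occurring in `L`, with repetitions. -/
def varList (L : Formula) : List ℕ := L.flatMap fun C => C.map Prod.fst

/-- The literals whose variable occurs in `L`, with repetitions. -/
def litList (L : Formula) : List Literal := (varList L).flatMap fun n => [(n, true), (n, false)]

/-- The variables of `L` are ranked by their first occurrence. -/
def rank (L : Formula) (n : ℕ) : ℕ := (varList L).idxOf n

open scoped Classical in
/-- The arcs of the implication digraph of `L`. -/
noncomputable def arcList (L : Formula) : List (Literal × Literal) :=
  (litList L ×ˢ litList L).filter fun a => Arc (toClauseSet L) a.1 a.2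

open scoped Classical in
/-- The clauses `{¬p, q}` with `P L p q` if the 2-CNF `L` is satisfiable, and `{⊥}` otherwise. -/
noncomputable def selectBase (P : Formula → Literal → Literal → Prop) (L : Formula) : Formula :=
  if ∅ ∉ toClauseSet L ∧ NoClash (toClauseSet L) then
    ((litList L ×ˢ litList L).filter fun a => P L a.1 a.2).map fun a => [compl a.1, a.2]
  else [[]]

/-- The algorithm for all `k`; it does not depend on `k` if `1 ≤ k`. -/
noncomputable def shortestKBase (k : ℕ∞) : Formula → Formula :=
  if k = 0 then selectBase fun L => PrimeArc (toClauseSet L)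
  else selectBase fun L => Selected (toClauseSet L) (rank L)

theorem shortestKBase_eq_shortestKBase_one {k : ℕ∞} (hk : 1 ≤ k) :
    shortestKBase k = shortestKBase 1 := by
  rw [shortestKBase, shortestKBase, if_neg (Order.one_le_iff_ne_zero.1 hk), if_neg one_ne_zero]

section Correctness

variable {L : Formula} {p q : Literal} {C : Finset Literal}

theorem mem_toClauseSet : C ∈ toClauseSet L ↔ ∃ l ∈ L, l.toFinset = C := by
  rw [toClauseSet, List.mem_toFinset, List.mem_map]

theorem mem_varList {n : ℕ} : n ∈ varList L ↔ ∃ C ∈ L, ∃ x ∈ C, x.1 = n := by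
  simp only [varList, List.mem_flatMap, List.mem_map]

theorem mem_litList_iff_mem_varList : p ∈ litList L ↔ p.1 ∈ varList L := by
  simp only [litList, List.mem_flatMap, List.mem_cons, List.not_mem_nil, or_false]
  constructor
  · rintro ⟨n, hn, rfl | rfl⟩ <;> exact hn
  · rcases p with ⟨n, _ | _⟩
    · exact fun h => ⟨n, h, .inr rfl⟩
    · exact fun h => ⟨n, h, .inl rfl⟩

theorem mem_litList : p ∈ litList L ↔ p ∈ lits (toClauseSet L) := by
  simp only [mem_litList_iff_mem_varList, mem_varList, mem_lits, mem_toClauseSet,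
    exists_exists_and_eq_and, List.mem_toFinset]
  refine exists_congr fun C => and_congr_right fun _ => ⟨?_, ?_⟩
  · rintro ⟨x, hx, e⟩
    rcases eq_or_eq_compl e with rfl | rfl
    · exact .inl hx
    · exact .inr hx
  · rintro (h | h)
    · exact ⟨p, h, rfl⟩
    · exact ⟨compl p, h, rfl⟩

theorem arc_toClauseSet_iff : Arc (toClauseSet L) p q ↔
    ∃ C ∈ L, compl p ∈ C ∧ q ∈ C ∧ ∀ x ∈ C, x = compl p ∨ x = q := by
  rw [Arc, mem_toClauseSet]
  refine exists_congr fun C => and_congr_right fun _ => ?_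
  rw [Finset.Subset.antisymm_iff, and_comm, ← and_assoc, Finset.insert_subset_iff,
    Finset.singleton_subset_iff]
  simp only [Finset.subset_iff, List.mem_toFinset, Finset.mem_insert, Finset.mem_singleton]

theorem mem_arcList : (p, q) ∈ arcList L ↔ Arc (toClauseSet L) p q := by
  simp only [arcList, List.mem_filter, decide_eq_true_iff, and_iff_right_iff_imp]
  exact fun h => List.pair_mem_product.2 (h.mem_lits.imp mem_litList.2 mem_litList.2)

theorem reach_toClauseSet_iff : Reach (toClauseSet L) p q ↔
    q = p ∨ (p, q) ∈ warshall (litList L) (arcList L) := by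
  rw [Reach, Relation.reflTransGen_iff_eq_or_transGen, arcList,
    mem_warshall (List.filter_subset_self _), ← arcList]
  simp only [mem_arcList]

theorem separatesComponents_rank : SeparatesComponents (toClauseSet L) (rank L) := by
  intro p q h e
  rcases h.1.eq_or_mem_lits with rfl | ⟨hp, -⟩
  · rfl
  · exact (List.idxOf_inj (mem_litList_iff_mem_varList.1 (mem_litList.2 hp))).1 e

variable {P : Formula → Literal → Literal → Prop}

theorem mem_selectBase (hL : IsTwoCNF (toClauseSet L)) (hs : Satisfiable (toClauseSet L))
    (hP : ∀ p q, P L p q → PrimeArc (toClauseSet L) p q) :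
    C ∈ toClauseSet (selectBase P L) ↔ ∃ p q, P L p q ∧ C = {compl p, q} := by
  rw [selectBase, if_pos ((satisfiable_iff_noClash hL).1 hs), mem_toClauseSet]
  simp only [List.mem_map, List.mem_filter, decide_eq_true_iff]
  constructor
  · rintro ⟨_, ⟨⟨p, q⟩, ⟨-, h⟩, rfl⟩, rfl⟩
    exact ⟨p, q, h, by simp⟩
  · rintro ⟨p, q, h, rfl⟩
    have mem_lits := (hP p q h).1.eq_or_mem_lits.resolve_left (hP p q h).ne
    exact ⟨_, ⟨(p, q), ⟨List.pair_mem_product.2 (mem_lits.imp mem_litList.2 mem_litList.2), h⟩,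
      rfl⟩, by simp⟩

theorem isShortestKBase_selectBase_of_unsatisfiable (hL : IsTwoCNF (toClauseSet L))
    (hs : ¬ Satisfiable (toClauseSet L)) (k : ℕ∞) :
    IsShortestKBase numClauses k (toClauseSet L) (toClauseSet (selectBase P L)) := by
  rw [selectBase, if_neg fun h => hs ((satisfiable_iff_noClash hL).2 h)]
  exact (isShortestKBase_of_unsatisfiable hs k).1

theorem isShortestKBase_selectBase_primeArc (hL : IsTwoCNF (toClauseSet L)) :
    IsShortestKBase numClauses 0 (toClauseSet L)
      (toClauseSet (selectBase (fun L => PrimeArc (toClauseSet L)) L)) := by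
  by_cases hs : Satisfiable (toClauseSet L)
  · have isEquivKBase := (isEquivKBase_zero_iff hL.1).2 fun C =>
      (mem_selectBase (P := fun L => PrimeArc (toClauseSet L)) hL hs fun _ _ h => h).trans
        (isPrimeImplicate_iff_exists_primeArc hL hs).symm
    refine ⟨isEquivKBase, fun H hH => le_of_eq (congrArg _ (Finset.ext fun C => ?_))⟩
    rw [(isEquivKBase_zero_iff hL.1).1 isEquivKBase, (isEquivKBase_zero_iff hL.1).1 hH]
  · exact isShortestKBase_selectBase_of_unsatisfiable hL hs 0

theorem isShortestKBase_selectBase_selected (hL : IsTwoCNF (toClauseSet L)) {k : ℕ∞} (hk : 1 ≤ k) :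
    IsShortestKBase numClauses k (toClauseSet L)
      (toClauseSet (selectBase (fun L => Selected (toClauseSet L) (rank L)) L)) := by
  by_cases hs : Satisfiable (toClauseSet L)
  · exact (isShortestKBase_iff_isSmallestPrimeSubset hL hk).2 <|
      isSmallestPrimeSubset_of_selected hL hs separatesComponents_rank fun C =>
        mem_selectBase hL hs fun _ _ h => h.1
  · exact isShortestKBase_selectBase_of_unsatisfiable hL hs k

theorem isShortestKBase_shortestKBase (hL : IsTwoCNF (toClauseSet L)) (k : ℕ∞) :
    IsShortestKBase numClauses k (toClauseSet L) (toClauseSet (shortestKBase k L)) := by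
  rw [shortestKBase]
  split_ifs with hk
  · exact hk ▸ isShortestKBase_selectBase_primeArc hL
  · exact isShortestKBase_selectBase_selected hL (Order.one_le_iff_ne_zero.2 hk)

end Correctness

section Complexity

open TreePolyTime

variable {α : Type} [TreeEncoding α] {L : α → Formula} {p q : α → Literal}

theorem TreePolyTime.varList (hL : TreePolyTime L) : TreePolyTime fun x => varList (L x) :=
  hL.flatMap (f := fun y : α × List Literal => y.2.map Prod.fst) <|
    snd.map (f := fun y : (α × List Literal) × Literal => y.2.1) (fst.comp snd)

theorem TreePolyTime.litList (hL : TreePolyTime L) : TreePolyTime fun x => litList (L x) :=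
  hL.varList.flatMap (f := fun y : α × ℕ => [(y.2, true), (y.2, false)]) <|
    (snd.pair (const true)).cons ((snd.pair (const false)).cons (const []))

namespace TreePolyDecidable

theorem arc (hL : TreePolyTime L) (hp : TreePolyTime p) (hq : TreePolyTime q) :
    TreePolyDecidable fun x => Arc (toClauseSet (L x)) (p x) (q x) := by
  have only : TreePolyDecidable fun y : α × List Literal =>
      ∀ c ∈ y.2, c = KBase.compl (p y.1) ∨ c = q y.1 :=
    forall_mem (R := fun y c => c = KBase.compl (p y.1) ∨ c = q y.1) snd
      ((eq_literal snd (hp.compl.comp (fst.comp fst))).or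
        (eq_literal snd (hq.comp (fst.comp fst))))
  exact (exists_mem (R := fun x C => KBase.compl (p x) ∈ C ∧ q x ∈ C ∧
      ∀ c ∈ C, c = KBase.compl (p x) ∨ c = q x) hL
    ((mem_literals (hp.compl.comp fst) snd).and
      ((mem_literals (hq.comp fst) snd).and only))).of_iff fun _ => arc_toClauseSet_iff.symm

end TreePolyDecidable

open scoped Classical in
theorem TreePolyTime.arcList (hL : TreePolyTime L) : TreePolyTime fun x => arcList (L x) :=
  (TreePolyDecidable.arc (hL.comp fst) (fst.comp snd) (snd.comp snd)).filter
    (R := fun x (a : Literal × Literal) => Arc (toClauseSet (L x)) a.1 a.2)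
    (hL.litList.product hL.litList)

namespace TreePolyDecidable

theorem reach (hL : TreePolyTime L) (hp : TreePolyTime p) (hq : TreePolyTime q) :
    TreePolyDecidable fun x => Reach (toClauseSet (L x)) (p x) (q x) :=
  ((eq_literal hq hp).or (mem_literalPairs hp hq (hL.litList.warshall hL.arcList))).of_iff
    fun _ => reach_toClauseSet_iff.symm

theorem exists_reach {R : α → Literal → Prop} (hL : TreePolyTime L) (hp : TreePolyTime p)
    (hR : TreePolyDecidable fun y : α × Literal => R y.1 y.2) :
    TreePolyDecidable fun x => ∃ r, Reach (toClauseSet (L x)) (p x) r ∧ R x r := by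
  refine (exists_mem (R := fun x r => Reach (toClauseSet (L x)) (p x) r ∧ R x r)
    (hp.cons hL.litList) ((reach (hL.comp fst) (hp.comp fst) snd).and hR)).of_iff fun x => ?_
  refine exists_congr fun r => and_iff_right_of_imp fun h => List.mem_cons.2 ?_
  exact h.1.eq_or_mem_lits.imp Eq.symm fun h => mem_litList.2 h.2

theorem forall_reach {R : α → Literal → Prop} (hL : TreePolyTime L) (hp : TreePolyTime p)
    (hR : TreePolyDecidable fun y : α × Literal => R y.1 y.2) :
    TreePolyDecidable fun x => ∀ r, Reach (toClauseSet (L x)) (p x) r → R x r :=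
  (exists_reach (R := fun x r => ¬ R x r) hL hp hR.not).not.of_iff fun _ => by
    simp only [not_exists, not_and, not_not]

theorem noClash (hL : TreePolyTime L) : TreePolyDecidable fun x => NoClash (toClauseSet (L x)) := by
  refine (forall_mem (R := fun x r => ¬ (Reach (toClauseSet (L x)) r (compl r) ∧
    Reach (toClauseSet (L x)) (compl r) r)) hL.litList
    ((reach (hL.comp fst) snd snd.compl).and (reach (hL.comp fst) snd.compl snd)).not).of_iff
    fun x => forall_congr' fun r => ⟨fun h hr => h (mem_litList.2 ?_) hr, fun h _ => h⟩
  exact (hr.1.eq_or_mem_lits.resolve_left (compl_ne_self r).symm).1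

theorem free (hL : TreePolyTime L) (hp : TreePolyTime p) :
    TreePolyDecidable fun x => Free (toClauseSet (L x)) (p x) :=
  (reach hL hp hp.compl).not.and (reach hL hp.compl hp).not

theorem primeArc (hL : TreePolyTime L) (hp : TreePolyTime p) (hq : TreePolyTime q) :
    TreePolyDecidable fun x => PrimeArc (toClauseSet (L x)) (p x) (q x) :=
  (reach hL hp hq).and ((eq_literal hp hq.compl).or
    ((free hL hp).and ((free hL hq).and (eq_literal hp hq).not)))

theorem covers (hL : TreePolyTime L) (hp : TreePolyTime p) (hq : TreePolyTime q) :
    TreePolyDecidable fun x => Covers (toClauseSet (L x)) (p x) (q x) :=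
  forall_reach hL hp ((reach (hL.comp fst) snd (hq.comp fst)).imp
    ((reach (hL.comp fst) snd (hp.comp fst)).or (reach (hL.comp fst) (hq.comp fst) snd)))

theorem rank_le_rank (hL : TreePolyTime L) (hp : TreePolyTime p) (hq : TreePolyTime q) :
    TreePolyDecidable fun x => rank (L x) (p x).1 ≤ rank (L x) (q x).1 :=
  idxOf_le_idxOf hL.varList (fst.comp hp) (fst.comp hq)

theorem rank_lt_rank (hL : TreePolyTime L) (hp : TreePolyTime p) (hq : TreePolyTime q) :
    TreePolyDecidable fun x => rank (L x) (p x).1 < rank (L x) (q x).1 :=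
  (rank_le_rank hL hq hp).not.of_iff fun _ => not_le

theorem forall_sameComponent {R : α → Literal → Prop} (hL : TreePolyTime L) (hp : TreePolyTime p)
    (hR : TreePolyDecidable fun y : α × Literal => R y.1 y.2) :
    TreePolyDecidable fun x => ∀ r, SameComponent (toClauseSet (L x)) (p x) r → R x r :=
  (forall_reach (R := fun x r => Reach (toClauseSet (L x)) r (p x) → R x r) hL hp
    ((reach (hL.comp fst) snd (hp.comp fst)).imp hR)).of_iff fun _ =>
    forall_congr' fun _ => and_imp.symm

theorem isLeast (hL : TreePolyTime L) (hp : TreePolyTime p) :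
    TreePolyDecidable fun x => IsLeast (toClauseSet (L x)) (rank (L x)) (p x) :=
  forall_sameComponent hL hp (rank_le_rank (hL.comp fst) (hp.comp fst) snd)

theorem isGreatest (hL : TreePolyTime L) (hp : TreePolyTime p) :
    TreePolyDecidable fun x => IsGreatest (toClauseSet (L x)) (rank (L x)) (p x) :=
  forall_sameComponent hL hp (rank_le_rank (hL.comp fst) snd (hp.comp fst))

theorem hasPositiveLeast (hL : TreePolyTime L) (hp : TreePolyTime p) :
    TreePolyDecidable fun x => HasPositiveLeast (toClauseSet (L x)) (rank (L x)) (p x) :=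
  (exists_reach (R := fun x r => Reach (toClauseSet (L x)) r (p x) ∧
      IsLeast (toClauseSet (L x)) (rank (L x)) r ∧ r.2 = true) hL hp
    ((reach (hL.comp fst) snd (hp.comp fst)).and
      ((isLeast (hL.comp fst) snd).and (eq_true (snd.comp snd))))).of_iff fun _ =>
    exists_congr fun _ => and_assoc.symm

theorem isNext (hL : TreePolyTime L) (hp : TreePolyTime p) (hq : TreePolyTime q) :
    TreePolyDecidable fun x => IsNext (toClauseSet (L x)) (rank (L x)) (p x) (q x) :=
  ((rank_lt_rank hL hp hq).and (forall_sameComponent hL hp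
    ((rank_lt_rank (hL.comp fst) (hp.comp fst) snd).and
      (rank_lt_rank (hL.comp fst) snd (hq.comp fst))).not)).or
    ((isGreatest hL hp).and (isLeast hL hq))

theorem selected (hL : TreePolyTime L) (hp : TreePolyTime p) (hq : TreePolyTime q) :
    TreePolyDecidable fun x => Selected (toClauseSet (L x)) (rank (L x)) (p x) (q x) :=
  (primeArc hL hp hq).and ((eq_literal hp hq.compl).or
    (((reach hL hq hp).and ((hasPositiveLeast hL hp).and (isNext hL hp hq))).or
      ((reach hL hq hp).not.and ((covers hL hp hq).and ((isLeast hL hp).and (isLeast hL hq))))))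

theorem empty_mem (hL : TreePolyTime L) :
    TreePolyDecidable fun x => ∅ ∈ toClauseSet (L x) :=
  (exists_mem (R := fun _ C => C.isEmpty = true) hL (eq_true snd.isEmpty)).of_iff fun _ => by
    simp only [mem_toClauseSet, List.isEmpty_iff, List.toFinset_eq_empty_iff]

end TreePolyDecidable

theorem polyTime_selectBase {P : Formula → Literal → Literal → Prop}
    (hP : TreePolyDecidable fun y : Formula × Literal × Literal => P y.1 y.2.1 y.2.2) :
    PolyTime (selectBase P) := by
  classical
  have selected : TreePolyTime fun L : Formula =>
      ((litList L ×ˢ litList L).filter fun a => P L a.1 a.2).map fun a => [compl a.1, a.2] :=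
    (TreePolyDecidable.filter (R := fun L a => P L a.1 a.2) hP
      (TreePolyTime.id.litList.product TreePolyTime.id.litList)).map
      (f := fun y : Formula × Literal × Literal => [KBase.compl y.2.1, y.2.2])
      ((fst.comp snd).compl.cons ((snd.comp snd).cons (const [])))
  exact TreePolyTime.polyTime <|
    ((TreePolyDecidable.empty_mem .id).not.and (.noClash .id)).ite selected (const [[]])

theorem polyTime_shortestKBase (k : ℕ∞) : PolyTime (shortestKBase k) := by
  rw [shortestKBase]
  split_ifs
  · exact polyTime_selectBase (.primeArc fst (fst.comp snd) (snd.comp snd))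
  · exact polyTime_selectBase (.selected fst (fst.comp snd) (snd.comp snd))

end Complexity

end KBase

open KBase in
theorem theorem7p2 :
    -- Polynomial-time computation of shortest equivalent `k`-bases, in both measures;
    -- one algorithm serves all `k ≥ 1`.
    (∃ f : ℕ∞ → Formula → Formula,
      (∀ k, PolyTime (f k)) ∧ (∀ k, 1 ≤ k → f k = f 1) ∧
      ∀ (k : ℕ∞) (L : Formula), IsTwoCNF (toClauseSet L) →
        IsShortestKBase numClauses k (toClauseSet L) (toClauseSet (f k L)) ∧
        IsShortestKBase numLitOcc k (toClauseSet L) (toClauseSet (f k L))) ∧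
    -- The facts on which the computation rests.
    ∀ (F : ClauseSet), IsTwoCNF F →
      -- `F` unsatisfiable
      (¬ Satisfiable F → ∀ (k : ℕ∞),
        IsShortestKBase numClauses k F {∅} ∧ IsShortestKBase numLitOcc k F {∅}) ∧
      -- `F` empty
      (F = ∅ → ∀ (k : ℕ∞),
        IsShortestKBase numClauses k F ∅ ∧ IsShortestKBase numLitOcc k F ∅) ∧
      -- splitting off a forced literal
      (Satisfiable F → ∀ (x : Literal), Forced F x → ∀ (k : ℕ∞),
        (∀ G, IsEquivKBase k F G → {x} ∈ G) ∧
        (∀ G, IsShortestKBase numClauses k (setTrue x F) G →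
          IsShortestKBase numClauses k F (insert {x} G)) ∧
        (∀ G, IsShortestKBase numLitOcc k (setTrue x F) G →
          IsShortestKBase numLitOcc k F (insert {x} G))) ∧
      -- without forced literals all clauses and all prime implicates have length 2
      (Satisfiable F → (∀ x, ¬ Forced F x) →
        (∀ C ∈ F, C.card = 2) ∧ ∀ C, IsPrimeImplicate F C → C.card = 2) ∧
      -- `k`-bases consist of prime implicates, and the two measures agree
      (∀ (k : ℕ∞) (G : ClauseSet),
        (IsEquivKBase k F G → ∀ C ∈ G, IsPrimeImplicate F C) ∧
        (IsShortestKBase numClauses k F G ↔ IsShortestKBase numLitOcc k F G)) ∧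
      -- the prime implicates have length at most 2 and form the unique 0-base
      (∀ C, IsPrimeImplicate F C → C.card ≤ 2) ∧
      (∀ G, IsEquivKBase 0 F G ↔ ∀ C, C ∈ G ↔ IsPrimeImplicate F C) ∧
      -- `∞`-bases are 1-bases; for `k ≥ 1` the shortest `k`-bases are precisely the smallest
      -- equivalent sets of prime implicates
      (∀ G, IsEquivKBase ⊤ F G → IsKBase 1 G) ∧
      (∀ (k : ℕ∞), 1 ≤ k → ∀ G,
        IsShortestKBase numClauses k F G ↔ IsSmallestPrimeSubset F G) := by
  refine ⟨⟨shortestKBase, polyTime_shortestKBase, fun _ => shortestKBase_eq_shortestKBase_one,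
    fun k L hL => ?_⟩, fun F hF => ⟨?_, ?_, ?_, ?_, ?_, ?_, ?_, ?_, ?_⟩⟩
  · have shortest := isShortestKBase_shortestKBase hL k
    exact ⟨shortest, (isShortestKBase_numClauses_iff hL).1 shortest⟩
  · exact isShortestKBase_of_unsatisfiable
  · exact fun h k => h ▸ isShortestKBase_empty k
  · exact fun hs x hx k => ⟨fun G hG => hG.isEquivPrimeSubset.unit_mem_of_forced hs hx,
      fun G => hx.isShortestKBase_insert_unit hs fun _ => numClauses_insert_unit,
      fun G => hx.isShortestKBase_insert_unit hs fun _ => numLitOcc_insert_unit⟩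
  · exact card_eq_two_of_not_forced hF
  · exact fun k G => ⟨fun hG C => hG.isPrimeImplicate, isShortestKBase_numClauses_iff hF⟩
  · exact fun C hC => hC.card_le_two hF
  · exact fun G => isEquivKBase_zero_iff hF.1
  · exact fun G hG => hG.isKBase_one hF
  · exact fun k hk G => isShortestKBase_iff_isSmallestPrimeSubset hF hk
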